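/- Fix an integer $k\ge 1$ and a real number $0<\varepsilon<\tfrac13$. For $T\ge 1$ put $H=T^{\frac13+2\varepsilon}$. For $s\in\mathbf C$ and $w\in\mathbf C\setminus[1,\infty)$ let $H_s(w)={}_2F_1(s,1-s;1;w)$ (the branch holomorphic on $\mathbf C\setminus[1,\infty)$). With $t=\operatorname{Im}s$, let $\widetilde H_s=H_s$ if $t\le 1$ and $\widetilde H_s=t^{4k-2}e^{-\pi t}H_s$ if $t>1$. Define the averaged u-channel block $$W(s)=W_T(s)=T^{-4k+\frac52}H\int_{-T^{\varepsilon}/H}^{T^{\varepsilon}/H}e^{-(Hy)^2}e^{2iTy}z^{\frac12}\,\widetilde H_s(1-z^2)\,dy,\qquad z=T^{-1}+iy,$$ with the principal branch of $z^{1/2}$. There is $T_0\ge 1$, depending only on $k$ and $\varepsilon$, such that the following holds for all $T\ge T_0$ and $s=\frac12+it$ with $t>1$. 1. There are real-valued functions $A(T,t)$, $B(T,t)$ with $$W(s)=(1+A(T,t))\cdot\frac12\Big(\frac tT\Big)^{4k-\frac52}e^{-2t/T}\exp\Big(-\Big(\frac{t-T}{H}\Big)^2\Big)+B(T,t),$$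 where $A=\widetilde O(T^{-6\varepsilon})$, that is, $|A(T,t)|\le C_{\delta}T^{\delta}T^{-6\varepsilon}$ for every $\delta>0$, and $B=\widetilde O(\mathbf 1_{t\lessapprox T}H/T+t^{-\infty})$, that is, for all $\delta,\eta>0$ and all integers $n\ge 0$, $$|B(T,t)|\le C_{\delta,\eta,n}\,T^{\delta}\big(\mathbf 1_{t\le T^{1+\eta}}\,H/T+t^{-n}\big).$$ The constants depend only on their subscripts and on $k,\varepsilon$, and not on $T,t$. 2. In particular $W(s)$ is real, and there are a constant $C>0$ depending only on $k,\varepsilon$ and a real-valued function $B'(T,t)$ satisfying the same bounds as $B$ (i.e. $B'=\widetilde O(\mathbf 1_{t\lessapprox T}H/T+t^{-\infty})$), such that $$\mathbf 1_{|t-T|\le H}\le C\,\big(W(s)+B'(T,t)\big).$$ -/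

import Mathlib

section
open Complex MeasureTheory Set

/-- The domain `ℂ \ [1, ∞)`. -/
def cutPlane : Set ℂ := (((↑) : ℝ → ℂ) '' Set.Ici (1 : ℝ))ᶜ

/-- `F` is holomorphic on `ℂ \ [1, ∞)` and is given on the unit disc by the Gauss series
`∑ (a)ₙ (b)ₙ / ((c)ₙ n!) wⁿ`. -/
def IsHypergeometricBranch (a b c : ℂ) (F : ℂ → ℂ) : Prop :=
  DifferentiableOn ℂ F cutPlane ∧ ∀ w : ℂ, ‖w‖ < 1 → F w = ordinaryHypergeometric a b c w

open Classical in
/-- The branch of the Gauss hypergeometric function `₂F₁(a, b; c; ·)` on `ℂ \ [1, ∞)`, i.e. the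
holomorphic continuation of the Gauss series. It is unique by `IsHypergeometricBranch.eqOn`, and it
exists for `0 < re b < re c` by `isHypergeometricBranch_euler`. Mathlib's `ordinaryHypergeometric`
is only the sum of the series, with junk values where the series diverges. -/
noncomputable def gaussHypergeometric (a b c : ℂ) : ℂ → ℂ :=
  if h : ∃ F : ℂ → ℂ, IsHypergeometricBranch a b c F then h.choose else 0

theorem mem_cutPlane_iff (w : ℂ) : w ∈ cutPlane ↔ 1 - w ∈ Complex.slitPlane := by
  rw [Complex.mem_slitPlane_iff_not_le_zero, cutPlane, Set.mem_compl_iff, not_iff_not]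
  constructor
  · rintro ⟨x, hx, rfl⟩
    rw [Complex.le_def]
    simp at hx ⊢
    linarith
  · intro h
    rw [Complex.le_def] at h
    simp at h
    refine ⟨w.re, by simpa using h.1, ?_⟩
    apply Complex.ext <;> simp [h.2]

theorem starConvex_cutPlane : StarConvex ℝ 0 cutPlane := by
  rw [starConvex_iff_forall_pos]
  · intro w hw a b ha hb hab
    rw [mem_cutPlane_iff, Complex.mem_slitPlane_iff] at *
    simp at *
    rcases hw with h | h
    · left; nlinarith
    · right; exact ⟨hb.ne', h⟩
  · rw [mem_cutPlane_iff]; simp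

theorem isOpen_cutPlane : IsOpen cutPlane := by
  have : cutPlane = (fun w : ℂ => 1 - w) ⁻¹' Complex.slitPlane := by
    ext w; exact mem_cutPlane_iff w
  rw [this]
  exact Complex.isOpen_slitPlane.preimage (by fun_prop)

theorem IsHypergeometricBranch.eqOn {a b c : ℂ} {F G : ℂ → ℂ}
    (hF : IsHypergeometricBranch a b c F) (hG : IsHypergeometricBranch a b c G) :
    Set.EqOn F G cutPlane := by
  have h0 : (0 : ℂ) ∈ cutPlane := by rw [mem_cutPlane_iff]; simp
  refine (hF.1.analyticOnNhd isOpen_cutPlane).eqOn_of_preconnected_of_eventuallyEq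
    (hG.1.analyticOnNhd isOpen_cutPlane)
    (starConvex_cutPlane.isPathConnected h0).isConnected.isPreconnected h0 ?_
  filter_upwards [Metric.ball_mem_nhds (0 : ℂ) one_pos] with w hw
  rw [hF.2 w (by simpa using hw), hG.2 w (by simpa using hw)]

theorem gaussHypergeometric_eqOn {a b c : ℂ} {F : ℂ → ℂ}
    (hF : IsHypergeometricBranch a b c F) :
    Set.EqOn (gaussHypergeometric a b c) F cutPlane := by
  have h : ∃ F : ℂ → ℂ, IsHypergeometricBranch a b c F := ⟨F, hF⟩
  have : gaussHypergeometric a b c = h.choose := by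
    unfold gaussHypergeometric; rw [dif_pos h]
  rw [this]
  exact h.choose_spec.eqOn hF

/-- The integrand of Euler's integral representation, used only to show that the branch exists. -/
noncomputable def eulerIntegrand (a b c w : ℂ) (x : ℝ) : ℂ :=
  (x : ℂ) ^ (b - 1) * (1 - (x : ℂ)) ^ (c - b - 1) * (1 - w * x) ^ (-a)

theorem eulerKernel_integrableOn {b c : ℂ} (hb : 0 < b.re) (hc : b.re < c.re) :
   IntegrableOn (fun x : ℝ => (x : ℂ) ^ (b - 1) * (1 - (x : ℂ)) ^ (c - b - 1)) (Set.Ioc 0 1) := by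
  have := Complex.betaIntegral_convergent (u := b) (v := c - b) hb (by simpa using hc)
  rwa [intervalIntegrable_iff_integrableOn_Ioc_of_le zero_le_one] at this

theorem one_sub_mul_mem_slitPlane {w : ℂ} (hw : w ∈ cutPlane) {x : ℝ} (hx : x ∈ Set.Icc (0:ℝ) 1) :
    1 - w * x ∈ Complex.slitPlane := by
  rw [← mem_cutPlane_iff]
  have := starConvex_cutPlane hw (a := 1 - x) (b := x) (by linarith [hx.2]) hx.1 (by ring)
  simpa [mul_comm] using this

theorem differentiableOn_euler {a b c : ℂ} (hb : 0 < b.re) (hc : b.re < c.re) :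
    DifferentiableOn ℂ (fun w => ∫ x in Set.Ioc (0:ℝ) 1, eulerIntegrand a b c w x) cutPlane := by
  intro w hw
  obtain ⟨r, hr, hball⟩ := Metric.nhds_basis_closedBall.mem_iff.1 (isOpen_cutPlane.mem_nhds hw)
  have hcont : ∀ p : ℂ, ContinuousOn (fun q : ℂ × ℝ => (1 - q.1 * q.2) ^ p)
      (Metric.closedBall w r ×ˢ Set.Icc (0:ℝ) 1) := by
    intro p q hq
    have hq' := one_sub_mul_mem_slitPlane (hball hq.1) hq.2
    apply ContinuousAt.continuousWithinAt
    exact ContinuousAt.cpow (by fun_prop) (by fun_prop) hq'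
  obtain ⟨M, hM⟩ := ((isCompact_closedBall w r).prod isCompact_Icc).exists_bound_of_continuousOn
    (((by fun_prop : Continuous (fun q : ℂ × ℝ => (q.2 : ℂ))).continuousOn).mul
      ((continuousOn_const (c := a)).mul (hcont (-a - 1))))
  have hk := eulerKernel_integrableOn hb hc
  have hmeas : ∀ u ∈ Metric.closedBall w r, ∀ p : ℂ, AEStronglyMeasurable
      (fun x : ℝ => (1 - u * (x:ℂ)) ^ p) (volume.restrict (Set.Ioc 0 1)) := by
    intro u hu p
    refine ContinuousOn.aestronglyMeasurable ?_ measurableSet_Ioc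
    exact (hcont p).comp (f := fun x : ℝ => (u, x)) (by fun_prop)
      (fun x hx => ⟨hu, Set.Ioc_subset_Icc_self hx⟩)
  have hw' : w ∈ Metric.closedBall w r := Metric.mem_closedBall_self hr.le
  refine (hasDerivAt_integral_of_dominated_loc_of_deriv_le (F := eulerIntegrand a b c)
    (F' := fun u x => ((x : ℂ) ^ (b - 1) * (1 - (x : ℂ)) ^ (c - b - 1)) *
      (x * (a * (1 - u * x) ^ (-a - 1))))
    (bound := fun x : ℝ => ‖(x : ℂ) ^ (b - 1) * (1 - (x : ℂ)) ^ (c - b - 1)‖ * M)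
    (Metric.ball_mem_nhds w hr) ?_ ?_ ?_ ?_ ?_ ?_).2.differentiableAt.differentiableWithinAt
  · filter_upwards [Metric.ball_mem_nhds w hr] with u hu
    exact hk.aestronglyMeasurable.mul (hmeas u (Metric.ball_subset_closedBall hu) _)
  · obtain ⟨M', hM'⟩ := ((isCompact_closedBall w r).prod isCompact_Icc).exists_bound_of_continuousOn
      (hcont (-a))
    refine Integrable.mul_bdd (c := M') hk (hmeas w hw' _) ?_
    filter_upwards [ae_restrict_mem measurableSet_Ioc] with x hx
    exact hM' (w, x) ⟨hw', Set.Ioc_subset_Icc_self hx⟩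
  · exact hk.aestronglyMeasurable.mul ((Complex.continuous_ofReal.aestronglyMeasurable).mul
      ((hmeas w hw' _).const_mul a))
  · filter_upwards [ae_restrict_mem measurableSet_Ioc] with x hx u hu
    rw [norm_mul]
    exact mul_le_mul_of_nonneg_left
      (hM (u, x) ⟨Metric.ball_subset_closedBall hu, Set.Ioc_subset_Icc_self hx⟩) (norm_nonneg _)
  · exact hk.norm.mul_const M
  · filter_upwards [ae_restrict_mem measurableSet_Ioc] with x hx u hu
    have h1 := one_sub_mul_mem_slitPlane (hball (Metric.ball_subset_closedBall hu)) (Set.Ioc_subset_Icc_self hx)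
    have h2 : HasDerivAt (fun u : ℂ => 1 - u * x) (-(x:ℂ)) u := by
      simpa using ((hasDerivAt_id u).mul_const (x:ℂ)).const_sub 1
    have h3 := (h2.cpow_const (c := -a) h1).const_mul
      ((x : ℂ) ^ (b - 1) * (1 - (x : ℂ)) ^ (c - b - 1))
    have h4 : (x : ℂ) ^ (b - 1) * (1 - (x : ℂ)) ^ (c - b - 1) * (x * (a * (1 - u * x) ^ (-a - 1))) =
        (x : ℂ) ^ (b - 1) * (1 - (x : ℂ)) ^ (c - b - 1) *
          (-a * (1 - u * x) ^ (-a - 1) * -(x : ℂ)) := by ring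
    rw [h4]
    exact h3

theorem betaIntegral_ne_zero_of_re_lt {b c : ℂ} (hb : 0 < b.re) (hc : b.re < c.re) : betaIntegral b (c - b) ≠ 0 := by
  have h := Gamma_mul_Gamma_eq_betaIntegral hb (t := c - b) (by simpa using hc)
  intro h0
  rw [h0, mul_zero] at h
  exact mul_ne_zero (Gamma_ne_zero_of_re_pos hb)
    (Gamma_ne_zero_of_re_pos (s := c - b) (by simpa using hc)) h

theorem betaIntegral_add_nat {b c : ℂ} (hb : 0 < b.re) (hc : b.re < c.re) (n : ℕ) :
    betaIntegral (b + n) (c - b) = betaIntegral b (c - b) *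
      ((ascPochhammer ℂ n).eval b * ((ascPochhammer ℂ n).eval c)⁻¹) := by
  have hcb : 0 < (c - b).re := by simpa using hc
  have hc0 : 0 < c.re := hb.trans hc
  have hne : ∀ z : ℂ, 0 < z.re → ∀ k : ℕ, z ≠ -k := by
    rintro z hz k rfl
    simp at hz
    linarith [(Nat.cast_nonneg k : (0:ℝ) ≤ k)]
  have h1 := Gamma_mul_Gamma_eq_betaIntegral hb hcb
  have h2 := Gamma_mul_Gamma_eq_betaIntegral (s := b + n) (t := c - b)
    (by simp; positivity) hcb
  rw [← Gamma_add_nat_div_Gamma_eq b (hne b hb), ← Gamma_add_nat_div_Gamma_eq c (hne c hc0)]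
  have e1 : b + (c - b) = c := by ring
  have e2 : b + n + (c - b) = c + n := by ring
  rw [e1] at h1
  rw [e2] at h2
  have g1 := Gamma_ne_zero_of_re_pos hb
  have g2 := Gamma_ne_zero_of_re_pos hcb
  have g3 := Gamma_ne_zero_of_re_pos hc0
  have g4 := Gamma_ne_zero_of_re_pos (s := c + n) (by simp; positivity)
  have b1 : betaIntegral b (c - b) = Gamma b * Gamma (c - b) / Gamma c := by
    rw [h1]; field_simp
  have b2 : betaIntegral (b + n) (c - b) = Gamma (b + n) * Gamma (c - b) / Gamma (c + n) := by
    rw [h2]; field_simp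
  rw [b1, b2]
  field_simp

theorem hasSum_one_sub_cpow_neg (a : ℂ) {v : ℂ} (hv : ‖v‖ < 1) :
    HasSum (fun n : ℕ => ((n.factorial : ℂ)⁻¹ * (ascPochhammer ℂ n).eval a) * v ^ n)
      ((1 - v) ^ (-a)) := by
  have h := (Complex.one_div_one_sub_cpow_hasFPowerSeriesOnBall_zero a).hasSum (y := v)
    (by rw [Metric.mem_eball, edist_zero_right]; rw [enorm_eq_nnnorm]; exact_mod_cast hv)
  simp only [zero_add, one_div, ← Complex.cpow_neg] at h
  refine h.congr_fun fun n => ?_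
  have h2 := Ring.factorial_nsmul_multichoose_eq_ascPochhammer a n
  have h3 : Ring.choose (a + n - 1) n = Ring.multichoose a n := by
    rw [Ring.choose]; congr 1; ring
  have h4 : (n.factorial : ℂ) ≠ 0 := by exact_mod_cast n.factorial_ne_zero
  rw [nsmul_eq_mul, Polynomial.ascPochhammer_smeval_eq_eval] at h2
  simp only [FormalMultilinearSeries.ofScalars_apply_eq, smul_eq_mul, h3, ← h2]
  field_simp

theorem integral_euler_eq {a b c : ℂ} (hb : 0 < b.re) (hc : b.re < c.re) {w : ℂ} (hw : ‖w‖ < 1) :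
    (∫ x in Set.Ioc (0:ℝ) 1, eulerIntegrand a b c w x) =
      betaIntegral b (c - b) * ordinaryHypergeometric a b c w := by
  set co : ℕ → ℂ := fun n => (n.factorial : ℂ)⁻¹ * (ascPochhammer ℂ n).eval a
  set K : ℝ → ℂ := fun x : ℝ => (x : ℂ) ^ (b - 1) * (1 - (x : ℂ)) ^ (c - b - 1) with hK
  have hk : IntegrableOn K (Set.Ioc 0 1) := eulerKernel_integrableOn hb hc
  have key : HasSum (fun n : ℕ => ∫ x in Set.Ioc (0:ℝ) 1, K x * (co n * (w * x) ^ n))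
      (∫ x in Set.Ioc (0:ℝ) 1, eulerIntegrand a b c w x) := by
    refine hasSum_integral_of_dominated_convergence (fun n x => ‖K x‖ * ‖co n * w ^ n‖) ?_ ?_ ?_ ?_ ?_
    · intro n
      exact hk.aestronglyMeasurable.mul (Continuous.aestronglyMeasurable (by fun_prop))
    · intro n
      filter_upwards [ae_restrict_mem measurableSet_Ioc] with x hx
      rw [norm_mul, mul_pow, ← mul_assoc (co n), norm_mul (co n * w ^ n)]
      refine mul_le_mul_of_nonneg_left ?_ (norm_nonneg _)
      refine mul_le_of_le_one_right (norm_nonneg _) ?_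
      rw [norm_pow, Complex.norm_real, Real.norm_of_nonneg hx.1.le]
      exact pow_le_one₀ hx.1.le hx.2
    · refine Filter.Eventually.of_forall fun x => Summable.mul_left _ ?_
      exact (hasSum_one_sub_cpow_neg a hw).summable.norm
    · have : (fun x => ∑' n, ‖K x‖ * ‖co n * w ^ n‖) = fun x => ‖K x‖ * ∑' n, ‖co n * w ^ n‖ := by
        ext x; rw [tsum_mul_left]
      rw [this]
      exact hk.norm.mul_const _
    · filter_upwards [ae_restrict_mem measurableSet_Ioc] with x hx
      refine HasSum.mul_left _ (hasSum_one_sub_cpow_neg a ?_)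
      rw [norm_mul, Complex.norm_real, Real.norm_of_nonneg hx.1.le]
      nlinarith [hx.1, hx.2, norm_nonneg w]
  rw [← key.tsum_eq, ordinaryHypergeometric_eq_tsum, ← tsum_mul_left]
  refine tsum_congr fun n => ?_
  have : ∀ x ∈ Set.Ioc (0:ℝ) 1, K x * (co n * (w * x) ^ n) =
      (co n * w ^ n) * ((x:ℂ) ^ (b + n - 1) * (1 - (x:ℂ)) ^ (c - b - 1)) := by
    intro x hx
    have hx0 : (x:ℂ) ≠ 0 := by exact_mod_cast hx.1.ne'
    have : b + n - 1 = (b - 1) + n := by ring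
    rw [this, Complex.cpow_add _ _ hx0, Complex.cpow_natCast, hK, mul_pow]
    ring
  rw [setIntegral_congr_fun measurableSet_Ioc this, integral_const_mul]
  have hB : (∫ x in Set.Ioc (0:ℝ) 1, (x:ℂ) ^ (b + n - 1) * (1 - (x:ℂ)) ^ (c - b - 1)) =
      betaIntegral (b + n) (c - b) := by
    rw [betaIntegral, intervalIntegral.integral_of_le zero_le_one]
  rw [hB, betaIntegral_add_nat hb hc]
  simp only [co, smul_eq_mul]
  ring

theorem isHypergeometricBranch_euler {a b c : ℂ} (hb : 0 < b.re) (hc : b.re < c.re) :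
    IsHypergeometricBranch a b c (fun w =>
      (betaIntegral b (c - b))⁻¹ * ∫ x in Set.Ioc (0:ℝ) 1, eulerIntegrand a b c w x) := by
  refine ⟨(differentiableOn_euler hb hc).const_mul _, fun w hw => ?_⟩
  beta_reduce
  rw [integral_euler_eq hb hc hw, inv_mul_cancel_left₀ (betaIntegral_ne_zero_of_re_lt hb hc)]

end

/-- `H_s(w) = ₂F₁(s, 1 - s; 1; w)` on `ℂ \ [1, ∞)`. -/
noncomputable def blockH (s w : ℂ) : ℂ := gaussHypergeometric s (1 - s) 1 w

/-- The renormalized block: `H_s` if `t ≤ 1`, and `t ^ (4k - 2) e ^ (-π t) H_s` if `t > 1`,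
where `t = im s`. -/
noncomputable def normalizedH (k : ℕ) (s w : ℂ) : ℂ :=
  if s.im ≤ 1 then blockH s w
  else ((s.im ^ (4 * (k : ℝ) - 2) * Real.exp (-Real.pi * s.im) : ℝ) : ℂ) * blockH s w

/-- The window length `H = T ^ (1/3 + 2ε)`. -/
noncomputable def windowH (ε T : ℝ) : ℝ := T ^ (1 / 3 + 2 * ε)

/-- The point `z = T⁻¹ + i y`. -/
noncomputable def linePoint (T y : ℝ) : ℂ := ((T⁻¹ : ℝ) : ℂ) + (y : ℂ) * Complex.I

/-- The averaged u-channel block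
`W(s) = T ^ (-4k + 5/2) H ∫_{|y| ≤ T ^ ε / H} e ^ (-(H y)²) e ^ (2 i T y) z ^ (1/2) H̃_s(1 - z²) dy`,
with `z = T⁻¹ + i y`. -/
noncomputable def averagedBlockW (k : ℕ) (ε T : ℝ) (s : ℂ) : ℂ :=
  ((T ^ (-4 * (k : ℝ) + 5 / 2) * windowH ε T : ℝ) : ℂ) *
    ∫ y in (-(T ^ ε / windowH ε T))..(T ^ ε / windowH ε T),
      ((Real.exp (-(windowH ε T * y) ^ 2) : ℝ) : ℂ) *
        Complex.exp (2 * Complex.I * (T : ℂ) * (y : ℂ)) *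
        linePoint T y ^ (1 / 2 : ℂ) * normalizedH k s (1 - linePoint T y ^ 2)

/-- The main term `½ (t/T) ^ (4k - 5/2) e ^ (-2t/T) exp (-((t - T)/H)²)`. -/
noncomputable def mainTermW (k : ℕ) (ε T t : ℝ) : ℝ :=
  1 / 2 * (t / T) ^ (4 * (k : ℝ) - 5 / 2) * Real.exp (-2 * t / T) *
    Real.exp (-((t - T) / windowH ε T) ^ 2)

/-- `A(T, t) = Õ(T ^ (-6ε))`, uniformly for `T ≥ T₀` and `t > 1`. -/
def IsRelativeErrorW (ε T₀ : ℝ) (A : ℝ → ℝ → ℝ) : Prop :=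
  ∀ δ : ℝ, 0 < δ → ∃ C : ℝ, ∀ T : ℝ, T₀ ≤ T → ∀ t : ℝ, 1 < t →
    |A T t| ≤ C * T ^ δ * T ^ (-6 * ε)

/-- `B(T, t) = Õ(1_{t ⪅ T} H / T + t ^ (-∞))`, uniformly for `T ≥ T₀` and `t > 1`. Here `Õ(Y)` loses
a factor `T ^ δ` for arbitrary `δ > 0`, the region `t ⪅ T` is `t ≤ T ^ (1 + η)` for arbitrary `η > 0`,
and `t ^ (-∞)` is `O(t ^ (-n))` for every `n`; the constant depends on `δ`, `η`, `n`. -/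
def IsAbsoluteErrorW (ε T₀ : ℝ) (B : ℝ → ℝ → ℝ) : Prop :=
  ∀ δ : ℝ, 0 < δ → ∀ η : ℝ, 0 < η → ∀ n : ℕ, ∃ C : ℝ,
    ∀ T : ℝ, T₀ ≤ T → ∀ t : ℝ, 1 < t →
      |B T t| ≤ C * T ^ δ * ((if t ≤ T ^ (1 + η) then windowH ε T / T else 0) + (t ^ n)⁻¹)

/-!
On the line `s = 1/2 + i t` the block `₂F₁(s, 1 - s; 1; 1 - z²)` is a conical function, and it has
the Mehler–Dirichlet integral representation `blockH_sin_sq` at the angle `θ = π - 2 arcsin z`. For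
small real angles the representation follows by comparing power series in `sin (θ / 2) ^ 2`: the
coefficients come from the expansion of `cosh (2 t x) / cos x` in powers of `sin x`
(`hasSum_cosh_div_cos`) and a trigonometric substitution (`hasSum_integral_mehler`). The identity
theorem extends it to the strip `0 < re θ < π`, which covers all `z` in the right half plane near
the origin.

The Mehler–Dirichlet integrand decays like `e ^ (-2 t θ p)` away from the endpoint `p = 0`.
Laplace's method therefore gives, uniformly in `z` (`exists_norm_blockH_sub_le`),
`z ^ (1/2) e ^ (-π t) H_s(1 - z²) = (2 √(π t))⁻¹ e ^ (-2 t arcsin z) (1 - z²) ^ (-1/4)` up to a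
relative error `O(1 / (t |z|))`. Integrated over the window, this error contributes
`H / T` up to logarithms (`exists_norm_averagedBlockW_sub_le`).

Since `arcsin z = z + O(z³)`, what is left is the Gaussian integral with phase `2 (T - t) y`,
perturbed by the factor `arcsinCorrection`. Its saddle point is `y = i (T - t) / H²`. With
`L = log T` there are three ranges.
* For `|T - t| ≤ H L` the contour is moved through the saddle point. This produces the main term
  times the Gaussian average `saddleCoeff` of the correction, which is `1 + O(L³ T / H³)`, and
  `T / H³ = T ^ (-6ε)`. The real part of this coefficient is `1 + A`.
* For `|T - t| > H L` and `t ≤ 2 T L²` a shift by `± L / H` already yields `e ^ (-L²) ≤ 1 / T`, and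
  the Gaussian in the main term is equally small.
* For `t > 2 T L²` no oscillation is needed: the point `z` has real part `1 / T`, so that the
  integrand is `O(e ^ (-t / T))`.

All errors are bounded by `L (H / T) (1 + t / T) ^ (4k) e ^ (-t / (2T))`
(`exists_abs_re_averagedBlockW_sub_le`), which is of the required form by `isAbsoluteErrorW_of_le`.
The averaged block is real because its integrand is conjugated by `y ↦ -y`. The majorant for the
window `|t - T| ≤ H` holds because `(1 + A)` times the main term is nonnegative, and bounded below
on the window (`exists_le_mainTermW`).
-/

open MeasureTheory

/-! ### The expansion of `cosh (2 t x) / cos x` in powers of `sin x` -/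

/-- The coefficients of the expansion of `cosh (2 t x) / cos x` in powers of `sin x ^ 2`. -/
noncomputable def coshSecCoeff (t : ℝ) (n : ℕ) : ℝ :=
  ∏ j ∈ Finset.range n, ((2 * j + 1) ^ 2 + 4 * t ^ 2) / ((2 * j + 1) * (2 * j + 2))

theorem coshSecCoeff_succ_mul (t : ℝ) (n : ℕ) :
    coshSecCoeff t (n + 1) * ((2 * n + 1) * (2 * n + 2)) =
      coshSecCoeff t n * ((2 * n + 1) ^ 2 + 4 * t ^ 2) := by
  rw [coshSecCoeff, Finset.prod_range_succ, ← coshSecCoeff]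
  have : ((2 * n + 1) * (2 * n + 2) : ℝ) ≠ 0 := by positivity
  field_simp

theorem coshSecCoeff_nonneg (t : ℝ) (n : ℕ) : 0 ≤ coshSecCoeff t n :=
  Finset.prod_nonneg fun _ _ => by positivity

theorem coshSecCoeff_le (t : ℝ) (n : ℕ) : coshSecCoeff t n ≤ (1 + 4 * t ^ 2) ^ n := by
  rw [coshSecCoeff]
  calc _ ≤ ∏ j ∈ Finset.range n, (1 + 4 * t ^ 2) := by
        refine Finset.prod_le_prod (fun _ _ => by positivity) fun j _ => ?_
        rw [div_le_iff₀ (by positivity)]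
        have : (0 : ℝ) ≤ j := j.cast_nonneg
        nlinarith [sq_nonneg t, mul_nonneg this (sq_nonneg t),
          mul_nonneg (mul_nonneg this this) (sq_nonneg t)]
    _ = _ := by simp

/-- The partial sums of `∑ cₙ sin x ^ (2n) cos x`, the expansion of `cosh (2 t x)`. -/
noncomputable def coshPartialSum (t : ℝ) (N : ℕ) (x : ℂ) : ℂ :=
  ∑ n ∈ Finset.range N, (coshSecCoeff t n : ℂ) * Complex.sin x ^ (2 * n) * Complex.cos x

theorem hasDerivAt_sin_pow_mul_cos (m : ℕ) (x : ℂ) :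
    HasDerivAt (fun x => Complex.sin x ^ m * Complex.cos x)
      (m * Complex.sin x ^ (m - 1) - (m + 1) * Complex.sin x ^ (m + 1)) x := by
  have h := ((Complex.hasDerivAt_sin x).pow m).mul (Complex.hasDerivAt_cos x)
  refine h.congr_deriv ?_
  rcases m with _ | m
  · simp
  · simp only [Nat.add_sub_cancel, Pi.pow_apply]
    have := Complex.sin_sq_add_cos_sq x
    push_cast
    linear_combination (m + 1) * Complex.sin x ^ m * this

theorem deriv_deriv_sin_pow_mul_cos (m : ℕ) (x : ℂ) :
    deriv (deriv (fun x => Complex.sin x ^ m * Complex.cos x)) x =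
      (m * (m - 1) * Complex.sin x ^ (m - 2) - (m + 1) ^ 2 * Complex.sin x ^ m) *
        Complex.cos x := by
  rw [show deriv (fun x => Complex.sin x ^ m * Complex.cos x) = fun x =>
    (m * Complex.sin x ^ (m - 1) - (m + 1) * Complex.sin x ^ (m + 1)) from
    funext fun x => (hasDerivAt_sin_pow_mul_cos m x).deriv]
  have h := (((Complex.hasDerivAt_sin x).pow (m - 1)).const_mul (m : ℂ)).sub
    (((Complex.hasDerivAt_sin x).pow (m + 1)).const_mul (m + 1 : ℂ))
  refine Eq.trans (HasDerivAt.deriv h) ?_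
  rcases m with _ | m
  · simp
  · simp only [Nat.add_sub_cancel]
    rw [show m + 1 - 2 = m - 1 by omega]
    push_cast
    ring

/-- The recursion of the coefficients says that the second derivative of a partial sum telescopes
to `4 t ^ 2` times the partial sum, up to one boundary term. -/
theorem deriv_deriv_coshPartialSum (t : ℝ) (N : ℕ) (x : ℂ) :
    deriv (deriv (coshPartialSum t (N + 1))) x = 4 * t ^ 2 * coshPartialSum t N x -
      coshSecCoeff t N * (2 * N + 1) ^ 2 * Complex.sin x ^ (2 * N) * Complex.cos x := by
  have key : ∀ N, deriv (deriv (coshPartialSum t N)) x = ∑ n ∈ Finset.range N,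
      (coshSecCoeff t n : ℂ) * ((((2 * n : ℕ) : ℂ) * ((2 * n : ℕ) - 1) * Complex.sin x ^ (2 * n - 2)
        - ((2 * n : ℕ) + 1) ^ 2 * Complex.sin x ^ (2 * n)) * Complex.cos x) := by
    intro N
    have hd : ∀ m : ℕ, Differentiable ℂ (fun x => Complex.sin x ^ m * Complex.cos x) := fun m => by
      fun_prop
    have hd' : ∀ m : ℕ, Differentiable ℂ (deriv (fun x => Complex.sin x ^ m * Complex.cos x)) :=
      fun m => (hd m).contDiff (n := 2) |>.differentiable_deriv_two
    have h1 : deriv (coshPartialSum t N) = fun x => ∑ n ∈ Finset.range N,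
        (coshSecCoeff t n : ℂ) * deriv (fun x => Complex.sin x ^ (2 * n) * Complex.cos x) x := by
      funext x
      have : coshPartialSum t N = fun x => ∑ n ∈ Finset.range N,
          (coshSecCoeff t n : ℂ) * (Complex.sin x ^ (2 * n) * Complex.cos x) := by
        funext x; simp [coshPartialSum, mul_assoc]
      rw [this, deriv_fun_sum fun n _ => ((hd _).const_mul _) x]
      exact Finset.sum_congr rfl fun n _ => deriv_const_mul_field _
    rw [h1, deriv_fun_sum fun n _ => ((hd' _).const_mul _) x]
    refine Finset.sum_congr rfl fun n _ => ?_
    rw [deriv_const_mul_field, deriv_deriv_sin_pow_mul_cos]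
  rw [key]
  induction N with
  | zero => simp [coshPartialSum]
  | succ N ih =>
    rw [Finset.sum_range_succ, ih]
    have hr := congrArg (fun r : ℝ => (r : ℂ)) (coshSecCoeff_succ_mul t N)
    push_cast at hr
    rw [show coshPartialSum t (N + 1) x = coshPartialSum t N x +
      (coshSecCoeff t N : ℂ) * Complex.sin x ^ (2 * N) * Complex.cos x by
        simp [coshPartialSum, Finset.sum_range_succ], show 2 * (N + 1) - 2 = 2 * N by omega]
    push_cast
    linear_combination Complex.sin x ^ (2 * N) * Complex.cos x * hr

/-- Near the origin, `cosh (2 t x) / cos x = ∑ cₙ sin x ^ (2n)`: the sum times `cos x` solves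
`q'' = 4 t ^ 2 q` with `q 0 = 1`, `q' 0 = 0`. -/
theorem hasSum_cosh_div_cos {t : ℝ} (ht : t ≠ 0) : ∃ r > 0, ∀ x : ℝ, |x| < r →
    0 < Real.cos x ∧ (1 + 4 * t ^ 2) * Real.sin x ^ 2 ≤ 1 / 4 ∧
    HasSum (fun n => coshSecCoeff t n * Real.sin x ^ (2 * n))
      (Real.cosh (2 * t * x) / Real.cos x) := by
  obtain ⟨r, hr, hball⟩ : ∃ r > 0, ∀ x ∈ Metric.ball (0 : ℂ) r,
      (1 + 4 * t ^ 2) * ‖Complex.sin x‖ ^ 2 < 1 / 4 ∧ ‖Complex.cos x - 1‖ < 1 := by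
    have h1 : ∀ᶠ x in nhds (0 : ℂ), (1 + 4 * t ^ 2) * ‖Complex.sin x‖ ^ 2 < 1 / 4 := by
      have : ContinuousAt (fun x : ℂ => (1 + 4 * t ^ 2) * ‖Complex.sin x‖ ^ 2) 0 := by fun_prop
      exact this.eventually_lt continuousAt_const (by simp)
    have h2 : ∀ᶠ x in nhds (0 : ℂ), ‖Complex.cos x - 1‖ < 1 := by
      have : ContinuousAt (fun x : ℂ => ‖Complex.cos x - 1‖) 0 := by fun_prop
      exact this.eventually_lt continuousAt_const (by simp)
    exact Metric.eventually_nhds_iff_ball.1 (h1.and h2)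
  set U := Metric.ball (0 : ℂ) r with hU
  have hUo : IsOpen U := Metric.isOpen_ball
  have hbound : ∀ n, ∀ x ∈ U, ‖(coshSecCoeff t n : ℂ) * Complex.sin x ^ (2 * n)‖ ≤ (1 / 4) ^ n := by
    intro n x hx
    rw [norm_mul, Complex.norm_real, Real.norm_of_nonneg (coshSecCoeff_nonneg t n), norm_pow,
      pow_mul]
    calc _ ≤ (1 + 4 * t ^ 2) ^ n * (‖Complex.sin x‖ ^ 2) ^ n := by
          gcongr; exact coshSecCoeff_le t n
      _ = ((1 + 4 * t ^ 2) * ‖Complex.sin x‖ ^ 2) ^ n := by rw [mul_pow]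
      _ ≤ _ := by gcongr; exact (hball x hx).1.le
  have hcos : ∀ x ∈ U, ‖Complex.cos x‖ ≤ 2 := by
    intro x hx
    calc ‖Complex.cos x‖ = ‖(Complex.cos x - 1) + 1‖ := by ring_nf
      _ ≤ ‖Complex.cos x - 1‖ + ‖(1 : ℂ)‖ := norm_add_le _ _
      _ ≤ 2 := by rw [norm_one]; linarith [(hball x hx).2]
  have hcos0 : ∀ x ∈ U, Complex.cos x ≠ 0 := by
    intro x hx h0
    have := (hball x hx).2
    rw [h0] at this
    simp at this
  set q : ℂ → ℂ := fun x => ∑' n, (coshSecCoeff t n : ℂ) * Complex.sin x ^ (2 * n) * Complex.cos x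
    with hq
  have hgeo : Summable fun n : ℕ => ((1 : ℝ) / 4) ^ n * 2 :=
    (summable_geometric_of_lt_one (by norm_num) (by norm_num)).mul_right 2
  have hF : ∀ n, ∀ x ∈ U,
      ‖(coshSecCoeff t n : ℂ) * Complex.sin x ^ (2 * n) * Complex.cos x‖ ≤ (1 / 4) ^ n * 2 := by
    intro n x hx
    rw [norm_mul]
    exact mul_le_mul (hbound n x hx) (hcos x hx) (norm_nonneg _) (by positivity)
  have hlu : TendstoLocallyUniformlyOn (coshPartialSum t) q Filter.atTop U :=
    (tendstoUniformlyOn_tsum_nat hgeo hF).tendstoLocallyUniformlyOn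
  have hdN : ∀ N, Differentiable ℂ (coshPartialSum t N) := fun N => by
    unfold coshPartialSum; fun_prop
  have hd1 := hlu.deriv (Filter.Eventually.of_forall fun N => (hdN N).differentiableOn) hUo
  have hd2 := hd1.deriv (Filter.Eventually.of_forall fun N =>
    ((hdN N).contDiff (n := 2) |>.differentiable_deriv_two).differentiableOn) hUo
  have hqd : DifferentiableOn ℂ q U := hlu.differentiableOn
    (Filter.Eventually.of_forall fun N => (hdN N).differentiableOn) hUo
  have hqd' : DifferentiableOn ℂ (deriv q) U := hqd.deriv hUo
  have hode : ∀ x ∈ U, deriv (deriv q) x = 4 * t ^ 2 * q x := by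
    intro x hx
    have h1 := (hd2.tendsto_at hx).comp (Filter.tendsto_add_atTop_nat 1)
    have h2 := (hlu.tendsto_at hx).const_mul (4 * t ^ 2 : ℂ)
    have h3 : Filter.Tendsto (fun N : ℕ => (coshSecCoeff t N * (2 * N + 1) ^ 2 *
        Complex.sin x ^ (2 * N) * Complex.cos x : ℂ)) Filter.atTop (nhds 0) := by
      have e1 := tendsto_pow_const_mul_const_pow_of_abs_lt_one 2 (r := 1 / 4) (by norm_num [abs_lt])
      have e2 := tendsto_pow_const_mul_const_pow_of_abs_lt_one 0 (r := 1 / 4) (by norm_num [abs_lt])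
      have e3 := (e1.const_mul 16).add (e2.const_mul 4)
      simp only [mul_zero, add_zero] at e3
      refine squeeze_zero_norm (fun N => ?_) e3
      calc _ = ‖(coshSecCoeff t N : ℂ) * Complex.sin x ^ (2 * N) * Complex.cos x‖ *
            ‖((2 * N + 1 : ℝ) : ℂ) ^ 2‖ := by
              rw [← norm_mul]; congr 1; push_cast; ring
        _ ≤ ((1 / 4) ^ N * 2) * (2 * N + 1) ^ 2 := by
            rw [norm_pow, Complex.norm_real, Real.norm_of_nonneg (by positivity)]
            gcongr
            exact hF N x hx
        _ ≤ _ := by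
            have : (0 : ℝ) < (1 / 4) ^ N := by positivity
            nlinarith [sq_nonneg ((N : ℝ) * 2 - 1)]
    have h4 := h2.sub h3
    rw [sub_zero] at h4
    refine tendsto_nhds_unique h1 (h4.congr fun N => ?_)
    simp only [Function.comp_apply]
    exact (deriv_deriv_coshPartialSum t N x).symm
  have h0U : (0 : ℂ) ∈ U := Metric.mem_ball_self hr
  have hq0 : q 0 = 1 := by
    have := (hlu.tendsto_at h0U).comp (Filter.tendsto_add_atTop_nat 1)
    refine tendsto_nhds_unique this (tendsto_const_nhds.congr fun N => ?_)
    simp [coshPartialSum, Finset.sum_range_succ', coshSecCoeff]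
  have hq0' : deriv q 0 = 0 := by
    -- `q` is even
    have hev : ∀ x, q (-x) = q x := fun x => by
      simp only [hq, Complex.sin_neg, Complex.cos_neg, pow_mul, neg_sq]
    have h1 : HasDerivAt q (deriv q 0) 0 :=
      (hqd.differentiableAt (hUo.mem_nhds h0U)).hasDerivAt
    have h2 : HasDerivAt (fun x => q (-x)) (-deriv q 0) 0 := by
      have := (neg_zero (G := ℂ)).symm ▸ h1
      exact (HasDerivAt.scomp (0 : ℂ) this (hasDerivAt_neg (0 : ℂ))).congr_deriv (by simp)
    simp only [hev] at h2
    have := h1.unique h2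
    linear_combination this / 2
  -- Factoring `q'' = σ² q` as two first order equations gives first integrals for `σ = ± 2 t`.
  have hfirst : ∀ σ : ℂ, σ ^ 2 = 4 * t ^ 2 → ∀ x ∈ U,
      Complex.exp (-σ * x) * (deriv q x + σ * q x) = σ := by
    intro σ hσ x hx
    have hder : ∀ x ∈ U,
        HasDerivAt (fun x => Complex.exp (-σ * x) * (deriv q x + σ * q x)) 0 x := by
      intro x hx
      have a1 : HasDerivAt q (deriv q x) x := (hqd.differentiableAt (hUo.mem_nhds hx)).hasDerivAt
      have a2 : HasDerivAt (deriv q) (deriv (deriv q) x) x :=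
        (hqd'.differentiableAt (hUo.mem_nhds hx)).hasDerivAt
      have a3 : HasDerivAt (fun x => Complex.exp (-σ * x)) (Complex.exp (-σ * x) * -σ) x := by
        simpa using ((hasDerivAt_id x).const_mul (-σ)).cexp
      have := a3.mul (a2.add (a1.const_mul σ))
      refine this.congr_deriv ?_
      simp only [Pi.add_apply]
      rw [hode x hx]
      linear_combination -Complex.exp (-σ * x) * q x * hσ
    have := hUo.is_const_of_deriv_eq_zero (convex_ball _ _).isPreconnected
      (fun x hx => (hder x hx).differentiableAt.differentiableWithinAt)
      (fun x hx => (hder x hx).deriv) hx h0U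
    rw [this, hq0, hq0']
    simp
  have hqval : ∀ x ∈ U, q x = Complex.cosh (2 * t * x) := by
    intro x hx
    have e1 := hfirst (2 * t) (by ring) x hx
    have e2 := hfirst (-(2 * t)) (by ring) x hx
    have ht' : (t : ℂ) ≠ 0 := by exact_mod_cast ht
    have x1 : deriv q x + 2 * t * q x = 2 * t * Complex.exp (2 * t * x) := by
      rw [show -(2 * (t : ℂ)) * x = -(2 * t * x) by ring, Complex.exp_neg] at e1
      have := Complex.exp_ne_zero (2 * t * x)
      field_simp at e1
      linear_combination e1
    have x2 : deriv q x - 2 * t * q x = - (2 * t * Complex.exp (-(2 * t * x))) := by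
      rw [show - -(2 * (t : ℂ)) * x = 2 * t * x by ring] at e2
      rw [Complex.exp_neg]
      have := Complex.exp_ne_zero (2 * t * x)
      field_simp
      linear_combination e2
    rw [Complex.cosh]
    have : 4 * (t : ℂ) * q x =
      4 * t * ((Complex.exp (2 * t * x) + Complex.exp (-(2 * t * x))) / 2) := by
      linear_combination x1 - x2
    exact mul_left_cancel₀ (by simpa using ht') this
  refine ⟨min r 1, by positivity, fun x hx => ?_⟩
  have hxU : (x : ℂ) ∈ U := by
    simp only [hU, Metric.mem_ball, dist_zero_right, Complex.norm_real, Real.norm_eq_abs]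
    exact hx.trans_le (min_le_left _ _)
  have hx1 : |x| < 1 := hx.trans_le (min_le_right _ _)
  have hc : 0 < Real.cos x := by
    rw [abs_lt] at hx1
    apply Real.cos_pos_of_mem_Ioo
    constructor <;> linarith [Real.pi_gt_three]
  refine ⟨hc, ?_, ?_⟩
  · have := (hball x hxU).1.le
    rwa [← Complex.ofReal_sin, Complex.norm_real, Real.norm_eq_abs, sq_abs] at this
  · have hs : Summable fun n => (coshSecCoeff t n : ℂ) * Complex.sin x ^ (2 * n) * Complex.cos x :=
      Summable.of_norm_bounded hgeo fun n => hF n x hxU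
    have h1 : HasSum _ (q x) := hs.hasSum
    rw [hqval x hxU] at h1
    have h2 := h1.div_const (Complex.cos x)
    rw [← Complex.hasSum_ofReal]
    push_cast
    refine h2.congr_fun fun n => ?_
    rw [mul_div_cancel_right₀ _ (hcos0 x hxU)]

/-! ### The Mehler–Dirichlet integral at real angles -/

theorem integral_sin_pow_even_symm (n : ℕ) :
    ∫ ψ in (-(Real.pi / 2))..(Real.pi / 2), Real.sin ψ ^ (2 * n) =
      Real.pi * ∏ i ∈ Finset.range n, ((2 * i + 1) / (2 * i + 2) : ℝ) := by
  have hper : Function.Periodic (fun ψ : ℝ => Real.sin ψ ^ (2 * n)) Real.pi := fun ψ => by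
    simp only [Real.sin_add_pi, pow_mul, neg_sq]
  have := hper.intervalIntegral_add_eq (-(Real.pi / 2)) 0
  rw [zero_add, show -(Real.pi / 2) + Real.pi = Real.pi / 2 by ring] at this
  rw [this, integral_sin_pow_even]

theorem abs_arcsin_mul_sin_le {θ : ℝ} (h0 : 0 < θ) (h1 : θ < Real.pi) (ψ : ℝ) :
    |Real.arcsin (Real.sin (θ / 2) * Real.sin ψ)| ≤ θ / 2 := by
  have ha : 0 < Real.sin (θ / 2) := Real.sin_pos_of_pos_of_lt_pi (by linarith) (by linarith)
  have hθ : Real.arcsin (Real.sin (θ / 2)) = θ / 2 :=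
    Real.arcsin_sin (by linarith) (by linarith)
  rw [abs_le]
  constructor
  · have := Real.arcsin_le_arcsin (x := -Real.sin (θ / 2)) (y := Real.sin (θ / 2) * Real.sin ψ)
      (by nlinarith [Real.neg_one_le_sin ψ])
    rwa [Real.arcsin_neg, hθ] at this
  · exact (Real.arcsin_le_arcsin (by nlinarith [Real.sin_le_one ψ])).trans hθ.le

theorem sin_arcsin_mul_sin {a : ℝ} (h0 : 0 ≤ a) (h1 : a ≤ 1) (ψ : ℝ) :
    Real.sin (Real.arcsin (a * Real.sin ψ)) = a * Real.sin ψ :=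
  Real.sin_arcsin (by nlinarith [Real.neg_one_le_sin ψ, Real.sin_le_one ψ])
    (by nlinarith [Real.neg_one_le_sin ψ, Real.sin_le_one ψ])

/-- The change of variables `sin (θ (1 - 2p) / 2) = sin (θ / 2) sin ψ`, which resolves the
singularities of the Mehler–Dirichlet integrand at both ends. -/
theorem integral_mehler_substitution (t : ℝ) {θ : ℝ} (h0 : 0 < θ) (h1 : θ < Real.pi) :
    ∫ p in Set.Ioo (0 : ℝ) 1, Real.exp (t * θ * (1 - 2 * p)) * θ *
        (Real.sin (θ * p) ^ (-1 / 2 : ℝ) * Real.sin (θ * (1 - p)) ^ (-1 / 2 : ℝ)) =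
      ∫ ψ in Set.Ioo (-(Real.pi / 2)) (Real.pi / 2),
        Real.exp (2 * t * Real.arcsin (Real.sin (θ / 2) * Real.sin ψ)) /
          Real.cos (Real.arcsin (Real.sin (θ / 2) * Real.sin ψ)) := by
  set a := Real.sin (θ / 2) with ha
  have ha0 : 0 < a := Real.sin_pos_of_pos_of_lt_pi (by linarith) (by linarith)
  have ha1 : a < 1 := by
    rw [ha, ← Real.sin_pi_div_two]
    exact Real.sin_lt_sin_of_lt_of_le_pi_div_two (by linarith) le_rfl (by linarith)
  have hθa : Real.arcsin a = θ / 2 := Real.arcsin_sin (by linarith) (by linarith)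
  set X : ℝ → ℝ := fun ψ => Real.arcsin (a * Real.sin ψ) with hX
  have hsX : ∀ ψ, Real.sin (X ψ) = a * Real.sin ψ := sin_arcsin_mul_sin ha0.le ha1.le
  have hlt : ∀ ψ ∈ Set.Ioo (-(Real.pi / 2)) (Real.pi / 2), |X ψ| < θ / 2 := by
    intro ψ hψ
    have s1 : Real.sin ψ < 1 := by
      rw [← Real.sin_pi_div_two]
      exact Real.sin_lt_sin_of_lt_of_le_pi_div_two hψ.1.le le_rfl hψ.2
    have s2 : -1 < Real.sin ψ := by
      rw [← Real.sin_pi_div_two, ← Real.sin_neg]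
      exact Real.sin_lt_sin_of_lt_of_le_pi_div_two le_rfl hψ.2.le hψ.1
    rw [abs_lt, ← hθa, ← Real.arcsin_neg]
    exact ⟨Real.arcsin_lt_arcsin (by linarith) (by nlinarith) (by nlinarith),
      Real.arcsin_lt_arcsin (by nlinarith) (by nlinarith) (by linarith)⟩
  have hcX : ∀ ψ, 0 < Real.cos (X ψ) := fun ψ => by
    have := abs_le.1 (abs_arcsin_mul_sin_le h0 h1 ψ)
    exact Real.cos_pos_of_mem_Ioo ⟨by simp only [hX]; linarith [this.1],
      by simp only [hX]; linarith [this.2]⟩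
  set f : ℝ → ℝ := fun ψ => (1 - 2 / θ * X ψ) / 2 with hf
  have himg : f '' Set.Ioo (-(Real.pi / 2)) (Real.pi / 2) = Set.Ioo 0 1 := by
    ext p
    constructor
    · rintro ⟨ψ, hψ, rfl⟩
      have := abs_lt.1 (hlt ψ hψ)
      have e : 2 / θ * X ψ = X ψ / (θ / 2) := by field_simp
      have e1 : X ψ / (θ / 2) < 1 := by rw [div_lt_one (by linarith)]; exact this.2
      have e2 : -1 < X ψ / (θ / 2) := by rw [lt_div_iff₀ (by linarith)]; linarith [this.1]
      simp only [hf, e]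
      constructor <;> linarith
    · rintro ⟨hp0, hp1⟩
      set u := θ * (1 - 2 * p) / 2 with hu
      have hu1 : u < θ / 2 := by rw [hu]; nlinarith
      have hu2 : -(θ / 2) < u := by rw [hu]; nlinarith
      have b1 : Real.sin u < a :=
        Real.sin_lt_sin_of_lt_of_le_pi_div_two (by linarith) (by linarith) hu1
      have b2 : -a < Real.sin u := by
        rw [ha, ← Real.sin_neg]
        exact Real.sin_lt_sin_of_lt_of_le_pi_div_two (by linarith) (by linarith) hu2
      have c1 : Real.sin u / a < 1 := by rwa [div_lt_one ha0]
      have c2 : -1 < Real.sin u / a := by rw [lt_div_iff₀ ha0]; linarith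
      refine ⟨Real.arcsin (Real.sin u / a), ⟨?_, ?_⟩, ?_⟩
      · exact Real.neg_pi_div_two_lt_arcsin.2 c2
      · exact Real.arcsin_lt_pi_div_two.2 c1
      · simp only [hf, hX]
        rw [Real.sin_arcsin c2.le c1.le, mul_div_cancel₀ _ ha0.ne',
          Real.arcsin_sin (by linarith) (by linarith), hu]
        field_simp
        ring
  have hinj : Set.InjOn f (Set.Ioo (-(Real.pi / 2)) (Real.pi / 2)) := by
    intro x hx y hy hxy
    have : X x = X y := by
      simp only [hf] at hxy
      have h2 : 2 / θ * X x = 2 / θ * X y := by linarith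
      exact mul_left_cancel₀ (by positivity) h2
    have h3 := congrArg Real.sin this
    rw [hsX, hsX] at h3
    exact Real.injOn_sin ⟨hx.1.le, hx.2.le⟩ ⟨hy.1.le, hy.2.le⟩ (mul_left_cancel₀ ha0.ne' h3)
  have hder : ∀ ψ, HasDerivAt f (-(1 / θ * (a * Real.cos ψ / Real.cos (X ψ)))) ψ := by
    intro ψ
    have e1 : -1 < a * Real.sin ψ := by nlinarith [Real.neg_one_le_sin ψ]
    have e2 : a * Real.sin ψ < 1 := by nlinarith [Real.sin_le_one ψ]
    have d := (Real.hasDerivAt_arcsin e1.ne' e2.ne).comp ψ ((Real.hasDerivAt_sin ψ).const_mul a)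
    have d2 := ((d.const_mul (2 / θ)).const_sub 1).div_const 2
    refine d2.congr_deriv ?_
    rw [show Real.cos (X ψ) = √(1 - (a * Real.sin ψ) ^ 2) from Real.cos_arcsin _]
    ring
  rw [← himg, integral_image_eq_integral_abs_deriv_smul measurableSet_Ioo
    (fun ψ _ => (hder ψ).hasDerivWithinAt) hinj]
  refine setIntegral_congr_fun measurableSet_Ioo fun ψ hψ => ?_
  have hc : 0 < Real.cos ψ := Real.cos_pos_of_mem_Ioo hψ
  have hl := abs_lt.1 (hlt ψ hψ)
  have e1 : θ * f ψ = θ / 2 - X ψ := by simp only [hf]; field_simp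
  have e2 : θ * (1 - f ψ) = θ / 2 + X ψ := by rw [mul_sub, e1]; ring
  have e3 : t * θ * (1 - 2 * f ψ) = 2 * t * X ψ := by linear_combination -2 * t * e1
  have p1 : 0 < Real.sin (θ / 2 - X ψ) :=
    Real.sin_pos_of_pos_of_lt_pi (by linarith) (by linarith)
  have p2 : 0 < Real.sin (θ / 2 + X ψ) :=
    Real.sin_pos_of_pos_of_lt_pi (by linarith) (by linarith)
  have e4 : Real.sin (θ / 2 - X ψ) * Real.sin (θ / 2 + X ψ) = (a * Real.cos ψ) ^ 2 := by
    rw [Real.sin_sub, Real.sin_add, ← ha, hsX]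
    have q1 := Real.sin_sq_add_cos_sq (θ / 2)
    have q2 := Real.sin_sq_add_cos_sq (X ψ)
    have q3 := Real.sin_sq_add_cos_sq ψ
    rw [hsX] at q2
    rw [← ha] at q1
    linear_combination a ^ 2 * q2 - a ^ 2 * Real.sin ψ ^ 2 * q1 - a ^ 2 * q3
  have hac : 0 < a * Real.cos ψ := by positivity
  simp only [smul_eq_mul, e1, e2, e3]
  rw [← Real.mul_rpow p1.le p2.le, e4, ← Real.rpow_natCast, ← Real.rpow_mul hac.le, abs_neg,
    abs_of_pos (by have := hcX ψ; positivity)]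
  norm_num
  rw [Real.rpow_neg_one]
  have := (hcX ψ).ne'
  simp only [hX] at this ⊢
  field_simp

/-- The Mehler–Dirichlet integral of a small real angle, as a power series in `sin (θ / 2) ^ 2`. -/
theorem hasSum_integral_mehler {t : ℝ} (ht : t ≠ 0) : ∃ r > 0, ∀ θ : ℝ, 0 < θ → θ < r →
    HasSum (fun n => coshSecCoeff t n * Real.sin (θ / 2) ^ (2 * n) *
        (Real.pi * ∏ i ∈ Finset.range n, ((2 * i + 1) / (2 * i + 2) : ℝ)))
      (∫ p in Set.Ioo (0 : ℝ) 1, Real.exp (t * θ * (1 - 2 * p)) * θ *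
        (Real.sin (θ * p) ^ (-1 / 2 : ℝ) * Real.sin (θ * (1 - p)) ^ (-1 / 2 : ℝ))) := by
  obtain ⟨r, hr, h⟩ := hasSum_cosh_div_cos ht
  refine ⟨min r 3, by positivity, fun θ h0 hθr => ?_⟩
  have hθ1 : θ < Real.pi := by linarith [min_le_right r 3, Real.pi_gt_three]
  have hθr' : θ < r := hθr.trans_le (min_le_left _ _)
  rw [integral_mehler_substitution t h0 hθ1]
  set a := Real.sin (θ / 2) with ha
  have ha0 : 0 < a := Real.sin_pos_of_pos_of_lt_pi (by linarith) (by linarith)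
  have hXr : ∀ ψ, |Real.arcsin (a * Real.sin ψ)| < r := fun ψ =>
    (abs_arcsin_mul_sin_le h0 hθ1 ψ).trans_lt (by linarith)
  have hcont : Continuous fun ψ : ℝ => Real.arcsin (a * Real.sin ψ) := by fun_prop
  have hpi : -(Real.pi / 2) ≤ Real.pi / 2 := by linarith [Real.pi_pos]
  -- The reflection `ψ ↦ -ψ` replaces the exponential by the hyperbolic cosine.
  have hsymm : ∫ ψ in Set.Ioo (-(Real.pi / 2)) (Real.pi / 2),
        Real.exp (2 * t * Real.arcsin (a * Real.sin ψ)) / Real.cos (Real.arcsin (a * Real.sin ψ)) =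
      ∫ ψ in (-(Real.pi / 2))..(Real.pi / 2), Real.cosh (2 * t * Real.arcsin (a * Real.sin ψ)) /
        Real.cos (Real.arcsin (a * Real.sin ψ)) := by
    rw [← integral_Ioc_eq_integral_Ioo, ← intervalIntegral.integral_of_le hpi]
    set e : ℝ → ℝ := fun ψ =>
      Real.exp (2 * t * Real.arcsin (a * Real.sin ψ)) / Real.cos (Real.arcsin (a * Real.sin ψ))
    have hec : Continuous e := by
      refine Continuous.div (by fun_prop) (by fun_prop) fun ψ => ((h _ (hXr ψ)).1).ne'
    have hec' : Continuous fun ψ => e (-ψ) := hec.comp continuous_neg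
    have hneg : ∫ ψ in (-(Real.pi / 2))..(Real.pi / 2), e (-ψ) =
        ∫ ψ in (-(Real.pi / 2))..(Real.pi / 2), e ψ := by
      rw [intervalIntegral.integral_comp_neg, neg_neg]
    have hadd : ∀ ψ, Real.cosh (2 * t * Real.arcsin (a * Real.sin ψ)) /
        Real.cos (Real.arcsin (a * Real.sin ψ)) = (e ψ + e (-ψ)) / 2 := by
      intro ψ
      simp only [e, Real.sin_neg, mul_neg, Real.arcsin_neg, Real.cos_neg, Real.cosh_eq]
      ring
    simp_rw [hadd]
    rw [intervalIntegral.integral_div, intervalIntegral.integral_add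
      (hec.intervalIntegrable _ _) (hec'.intervalIntegrable _ _), hneg]
    ring
  rw [hsymm]
  have hsin : ∀ ψ, Real.sin (Real.arcsin (a * Real.sin ψ)) = a * Real.sin ψ :=
    sin_arcsin_mul_sin ha0.le (Real.sin_le_one _)
  have := intervalIntegral.hasSum_integral_of_dominated_convergence (μ := volume)
    (a := -(Real.pi / 2)) (b := Real.pi / 2)
    (F := fun n ψ => coshSecCoeff t n * (a * Real.sin ψ) ^ (2 * n))
    (f := fun ψ => Real.cosh (2 * t * Real.arcsin (a * Real.sin ψ)) /
      Real.cos (Real.arcsin (a * Real.sin ψ))) (fun n _ => (1 / 4) ^ n)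
    (fun n => (by fun_prop : Continuous _).aestronglyMeasurable)
    (fun n => Filter.Eventually.of_forall fun ψ _ => by
      have h2 := (h _ (hXr ψ)).2.1
      rw [hsin] at h2
      rw [norm_mul, Real.norm_of_nonneg (coshSecCoeff_nonneg t n), norm_pow, Real.norm_eq_abs,
        pow_mul, sq_abs]
      calc _ ≤ (1 + 4 * t ^ 2) ^ n * ((a * Real.sin ψ) ^ 2) ^ n := by
            gcongr; exact coshSecCoeff_le t n
        _ = ((1 + 4 * t ^ 2) * (a * Real.sin ψ) ^ 2) ^ n := (mul_pow _ _ _).symm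
        _ ≤ _ := by gcongr)
    (Filter.Eventually.of_forall fun ψ _ =>
      summable_geometric_of_lt_one (by norm_num) (by norm_num))
    (by simp)
    (Filter.Eventually.of_forall fun ψ _ => by
      have h2 := (h _ (hXr ψ)).2.2
      simpa only [hsin] using h2)
  refine this.congr_fun fun n => ?_
  rw [intervalIntegral.integral_const_mul]
  simp_rw [mul_pow]
  rw [intervalIntegral.integral_const_mul, integral_sin_pow_even_symm]
  ring

/-! ### The Mehler–Dirichlet formula at complex angles -/

/-- A parameter integral of holomorphic functions which is dominated, locally uniformly in the
parameter, by an integrable function is holomorphic. -/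
theorem differentiableAt_integral_of_dominated {X : Type*} [MeasurableSpace X] {μ : Measure X}
    {F : ℂ → X → ℂ} {w : ℂ} {r : ℝ} (hr : 0 < r) {b : X → ℝ}
    (hmeas : ∀ u ∈ Metric.ball w r, AEStronglyMeasurable (F u) μ)
    (hd : ∀ᵐ x ∂μ, DifferentiableOn ℂ (fun u => F u x) (Metric.ball w r))
    (hb : ∀ᵐ x ∂μ, ∀ u ∈ Metric.ball w r, ‖F u x‖ ≤ b x) (hbi : Integrable b μ) :
    DifferentiableAt ℂ (fun u => ∫ x, F u x ∂μ) w := by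
  have hw : w ∈ Metric.ball w r := Metric.mem_ball_self hr
  have hdw : ∀ᵐ x ∂μ, HasDerivAt (fun u => F u x) (deriv (fun u => F u x) w) w := by
    filter_upwards [hd] with x hx
    exact (hx.differentiableAt (Metric.isOpen_ball.mem_nhds hw)).hasDerivAt
  refine (hasDerivAt_integral_of_dominated_loc_of_lip (F' := fun x => deriv (fun u => F u x) w)
    (s := Metric.ball w (r / 2)) (bound := fun x => b x / (r / 4))
    (Metric.ball_mem_nhds w (by positivity)) ?_ ?_ ?_ ?_ (hbi.div_const _) hdw).2.differentiableAt
  · filter_upwards [Metric.ball_mem_nhds w hr] with u hu using hmeas u hu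
  · refine hbi.mono' (hmeas w hw) ?_
    filter_upwards [hb] with x hx using hx w hw
  · -- the derivative is a limit of difference quotients
    set h : ℕ → ℂ := fun n => ((r / 2 / (n + 1) : ℝ) : ℂ) with hh
    have hpos : ∀ n : ℕ, 0 < r / 2 / (n + 1) := fun n => by positivity
    have hlim : Filter.Tendsto h Filter.atTop (nhdsWithin 0 {0}ᶜ) := by
      rw [tendsto_nhdsWithin_iff]
      constructor
      · have : Filter.Tendsto (fun n : ℕ => r / 2 / ((n : ℝ) + 1)) Filter.atTop (nhds 0) :=
          tendsto_const_nhds.div_atTop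
            (Filter.tendsto_atTop_add_const_right _ _ tendsto_natCast_atTop_atTop)
        exact (Complex.continuous_ofReal.tendsto' 0 0 Complex.ofReal_zero).comp this
      · exact Filter.Eventually.of_forall fun n => by
          simpa [hh] using (by exact_mod_cast (hpos n).ne' : ((r / 2 / (n + 1) : ℝ) : ℂ) ≠ 0)
    refine aestronglyMeasurable_of_tendsto_ae Filter.atTop
      (f := fun n x => (h n)⁻¹ • (F (w + h n) x - F w x)) (fun n => ?_) ?_
    · have hm : w + h n ∈ Metric.ball w r → AEStronglyMeasurable
          (fun x => F (w + h n) x - F w x) μ := fun hmem => (hmeas _ hmem).sub (hmeas w hw)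
      refine (hm ?_).const_smul (h n)⁻¹
      rw [Metric.mem_ball, dist_self_add_left, hh, Complex.norm_real,
        Real.norm_of_nonneg (hpos n).le, div_lt_iff₀ (by positivity)]
      nlinarith [(n.cast_nonneg : (0 : ℝ) ≤ n)]
    · filter_upwards [hdw] with x hx
      exact (hasDerivAt_iff_tendsto_slope_zero.1 hx).comp hlim
  · filter_upwards [hd, hb] with x hx hbx
    have hbx0 : 0 ≤ b x := (norm_nonneg _).trans (hbx w hw)
    refine Convex.lipschitzOnWith_of_nnnorm_deriv_le (fun u hu => ?_) (fun u hu => ?_)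
      (convex_ball _ _)
    · exact hx.differentiableAt (Metric.isOpen_ball.mem_nhds
        (Metric.ball_subset_ball (by linarith) hu))
    · rw [← NNReal.coe_le_coe, coe_nnnorm, Real.coe_nnabs, abs_of_nonneg (by positivity)]
      have hsub : Metric.closedBall u (r / 4) ⊆ Metric.ball w r := fun v hv => by
        rw [Metric.mem_closedBall] at hv
        rw [Metric.mem_ball] at hu ⊢
        linarith [dist_triangle v u w]
      refine Complex.norm_deriv_le_of_forall_mem_sphere_norm_le (by positivity) ?_ ?_
      · exact (hx.mono hsub).diffContOnCl_ball subset_rfl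
      · exact fun z hz => hbx z (hsub (Metric.sphere_subset_closedBall hz))

/-- The integrand of the Mehler–Dirichlet integral of the conical function at the complex angle
`θ`, on the segment from `θ` to `-θ` parametrized by `p ∈ (0, 1)`. -/
noncomputable def mehlerIntegrand (t : ℝ) (θ : ℂ) (p : ℝ) : ℂ :=
  Complex.exp (t * θ * (1 - 2 * p)) * θ *
    (Complex.sin (θ * p) ^ (-1 / 2 : ℂ) * Complex.sin (θ * (1 - p)) ^ (-1 / 2 : ℂ))

theorem re_sin (z : ℂ) : (Complex.sin z).re = Real.sin z.re * Real.cosh z.im := by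
  rw [Complex.sin_eq, ← Complex.ofReal_sin, ← Complex.ofReal_cos, ← Complex.ofReal_cosh,
    ← Complex.ofReal_sinh, ← Complex.ofReal_mul, ← Complex.ofReal_mul]
  simp only [Complex.add_re, Complex.ofReal_re, Complex.re_ofReal_mul, Complex.I_re, mul_zero,
    add_zero]

theorem im_sin (z : ℂ) : (Complex.sin z).im = Real.cos z.re * Real.sinh z.im := by
  rw [Complex.sin_eq, ← Complex.ofReal_sin, ← Complex.ofReal_cos, ← Complex.ofReal_cosh,
    ← Complex.ofReal_sinh, ← Complex.ofReal_mul, ← Complex.ofReal_mul]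
  simp only [Complex.add_im, Complex.ofReal_im, Complex.im_ofReal_mul, Complex.I_im, mul_one,
    zero_add]

/-- The concavity of the sine on `[0, π]` bounds the endpoint singularities of the Mehler–Dirichlet
integrand. -/
theorem re_sin_ge {θ : ℂ} (h0 : 0 < θ.re) (h1 : θ.re < Real.pi) {p : ℝ} (hp0 : 0 ≤ p)
    (hp1 : p ≤ 1) : p * Real.sin θ.re ≤ (Complex.sin (θ * p)).re := by
  have e : (Complex.sin (θ * p)).re = Real.sin (p * θ.re) * Real.cosh (p * θ.im) := by
    rw [re_sin, Complex.re_mul_ofReal, Complex.im_mul_ofReal, mul_comm p, mul_comm p]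
  rw [e]
  have hconc := strictConcaveOn_sin_Icc.concaveOn.2 (x := θ.re) (y := 0) ⟨h0.le, h1.le⟩
    ⟨le_rfl, Real.pi_pos.le⟩ hp0 (sub_nonneg.2 hp1) (by ring)
  simp only [smul_eq_mul, mul_zero, add_zero, Real.sin_zero] at hconc
  have hs : 0 ≤ p * Real.sin θ.re :=
    mul_nonneg hp0 (Real.sin_nonneg_of_nonneg_of_le_pi h0.le h1.le)
  exact hconc.trans (le_mul_of_one_le_right (hs.trans hconc) (Real.one_le_cosh _))

theorem re_sin_pos {θ : ℂ} (h0 : 0 < θ.re) (h1 : θ.re < Real.pi) {p : ℝ} (hp0 : 0 < p)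
    (hp1 : p ≤ 1) : 0 < (Complex.sin (θ * p)).re :=
  (mul_pos hp0 (Real.sin_pos_of_pos_of_lt_pi h0 h1)).trans_le (re_sin_ge h0 h1 hp0.le hp1)

theorem norm_cpow_neg_half (a : ℂ) : ‖a ^ (-1 / 2 : ℂ)‖ = ‖a‖ ^ (-1 / 2 : ℝ) := by
  have := Complex.norm_cpow_real a (-1 / 2)
  push_cast at this
  exact this

theorem norm_cpow_neg_half_le {a : ℂ} {m : ℝ} (hm : 0 < m) (h : m ≤ ‖a‖) :
    ‖a ^ (-1 / 2 : ℂ)‖ ≤ m ^ (-1 / 2 : ℝ) := by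
  rw [norm_cpow_neg_half]
  exact Real.rpow_le_rpow_of_nonpos hm h (by norm_num)

theorem integrableOn_rpow_neg_half_mul :
    IntegrableOn (fun p : ℝ => p ^ (-1 / 2 : ℝ) * (1 - p) ^ (-1 / 2 : ℝ)) (Set.Ioo 0 1) := by
  have h := (eulerKernel_integrableOn (b := 1 / 2) (c := 1) (by norm_num) (by norm_num)).norm
  replace h := IntegrableOn.mono_set h Set.Ioo_subset_Ioc_self
  refine h.congr_fun (fun p hp => ?_) measurableSet_Ioo
  have h1 : (1 : ℂ) - p = ((1 - p : ℝ) : ℂ) := by push_cast; ring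
  beta_reduce
  rw [norm_mul, h1, Complex.norm_cpow_eq_rpow_re_of_pos hp.1,
    Complex.norm_cpow_eq_rpow_re_of_pos (by linarith [hp.2])]
  norm_num

theorem continuousOn_mehlerIntegrand (t : ℝ) {θ : ℂ} (h0 : 0 < θ.re) (h1 : θ.re < Real.pi) :
    ContinuousOn (mehlerIntegrand t θ) (Set.Ioo 0 1) := by
  intro p hp
  have a1 := re_sin_pos h0 h1 hp.1 hp.2.le
  have a2 := re_sin_pos h0 h1 (p := 1 - p) (by linarith [hp.2]) (by linarith [hp.1])
  push_cast at a2
  unfold mehlerIntegrand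
  refine ContinuousAt.continuousWithinAt (ContinuousAt.mul (by fun_prop) (ContinuousAt.mul ?_ ?_))
  · exact ContinuousAt.cpow (by fun_prop) (by fun_prop) (Or.inl a1)
  · exact ContinuousAt.cpow (by fun_prop) (by fun_prop) (Or.inl a2)

theorem norm_mehlerIntegrand_le (t : ℝ) {θ : ℂ} (h0 : 0 < θ.re) (h1 : θ.re < Real.pi) {p : ℝ}
    (hp : p ∈ Set.Ioo (0 : ℝ) 1) : ‖mehlerIntegrand t θ p‖ ≤
      Real.exp (|t| * ‖θ‖) * ‖θ‖ * (Real.sin θ.re)⁻¹ *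
        (p ^ (-1 / 2 : ℝ) * (1 - p) ^ (-1 / 2 : ℝ)) := by
  have hs := Real.sin_pos_of_pos_of_lt_pi h0 h1
  have hp1 : 0 < 1 - p := by linarith [hp.2]
  have e1 := norm_cpow_neg_half_le (mul_pos hp.1 hs)
    ((re_sin_ge h0 h1 hp.1.le hp.2.le).trans (Complex.re_le_norm _))
  have e2 := norm_cpow_neg_half_le (mul_pos hp1 hs)
    ((re_sin_ge h0 h1 hp1.le (by linarith [hp.1])).trans (Complex.re_le_norm _))
  rw [Real.mul_rpow hp.1.le hs.le] at e1
  rw [Real.mul_rpow hp1.le hs.le] at e2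
  push_cast at e2
  have e3 : ‖Complex.exp (t * θ * (1 - 2 * p))‖ ≤ Real.exp (|t| * ‖θ‖) := by
    rw [Complex.norm_exp]
    refine Real.exp_le_exp.2 ((Complex.re_le_norm _).trans ?_)
    have : ‖(1 - 2 * p : ℂ)‖ ≤ 1 := by
      rw [show (1 - 2 * p : ℂ) = ((1 - 2 * p : ℝ) : ℂ) by push_cast; ring, Complex.norm_real,
        Real.norm_eq_abs, abs_le]
      constructor <;> linarith [hp.1, hp.2]
    rw [norm_mul, norm_mul, Complex.norm_real, Real.norm_eq_abs]
    exact mul_le_of_le_one_right (by positivity) this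
  have e4 : Real.sin θ.re ^ (-1 / 2 : ℝ) * Real.sin θ.re ^ (-1 / 2 : ℝ) = (Real.sin θ.re)⁻¹ := by
    rw [← Real.rpow_add hs, ← Real.rpow_neg_one]; norm_num
  rw [mehlerIntegrand, norm_mul, norm_mul, norm_mul]
  calc _ ≤ Real.exp (|t| * ‖θ‖) * ‖θ‖ * ((p ^ (-1 / 2 : ℝ) * Real.sin θ.re ^ (-1 / 2 : ℝ)) *
        ((1 - p) ^ (-1 / 2 : ℝ) * Real.sin θ.re ^ (-1 / 2 : ℝ))) := by
          have := hp.1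
          gcongr
    _ = _ := by rw [← e4]; ring

theorem differentiableOn_integral_mehlerIntegrand (t : ℝ) :
    DifferentiableOn ℂ (fun θ => ∫ p in Set.Ioo (0 : ℝ) 1, mehlerIntegrand t θ p)
      {θ : ℂ | 0 < θ.re ∧ θ.re < Real.pi} := by
  have hopen : IsOpen {θ : ℂ | 0 < θ.re ∧ θ.re < Real.pi} :=
    (isOpen_lt continuous_const Complex.continuous_re).inter
      (isOpen_lt Complex.continuous_re continuous_const)
  intro w hw
  obtain ⟨r, hr, hball⟩ := Metric.nhds_basis_closedBall.mem_iff.1 (hopen.mem_nhds hw)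
  have hsub : Metric.ball w r ⊆ {θ : ℂ | 0 < θ.re ∧ θ.re < Real.pi} :=
    Metric.ball_subset_closedBall.trans hball
  have hc : ContinuousOn (fun θ : ℂ => Real.exp (|t| * ‖θ‖) * ‖θ‖ * (Real.sin θ.re)⁻¹)
      (Metric.closedBall w r) := by
    refine ContinuousOn.mul (by fun_prop) (ContinuousOn.inv₀ (by fun_prop) fun θ hθ => ?_)
    exact (Real.sin_pos_of_pos_of_lt_pi (hball hθ).1 (hball hθ).2).ne'
  obtain ⟨M, hM⟩ := (isCompact_closedBall w r).exists_bound_of_continuousOn hc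
  refine (differentiableAt_integral_of_dominated hr
    (b := fun p => M * (p ^ (-1 / 2 : ℝ) * (1 - p) ^ (-1 / 2 : ℝ))) ?_ ?_ ?_
    (integrableOn_rpow_neg_half_mul.const_mul M)).differentiableWithinAt
  · exact fun u hu => (continuousOn_mehlerIntegrand t (hsub hu).1 (hsub hu).2).aestronglyMeasurable
      measurableSet_Ioo
  · filter_upwards [ae_restrict_mem measurableSet_Ioo] with p hp u hu
    have a1 := re_sin_pos (hsub hu).1 (hsub hu).2 hp.1 hp.2.le
    have a2 := re_sin_pos (hsub hu).1 (hsub hu).2 (p := 1 - p) (by linarith [hp.2])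
      (by linarith [hp.1])
    push_cast at a2
    unfold mehlerIntegrand
    refine DifferentiableAt.differentiableWithinAt (DifferentiableAt.mul (by fun_prop)
      (DifferentiableAt.mul ?_ ?_))
    · exact DifferentiableAt.cpow (by fun_prop) (by fun_prop) (Or.inl a1)
    · exact DifferentiableAt.cpow (by fun_prop) (by fun_prop) (Or.inl a2)
  · filter_upwards [ae_restrict_mem measurableSet_Ioo] with p hp u hu
    refine (norm_mehlerIntegrand_le t (hsub hu).1 (hsub hu).2 hp).trans ?_
    have hp1 : 0 < 1 - p := by linarith [hp.2]
    have hp0 := hp.1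
    gcongr
    exact (Real.le_norm_self _).trans (hM u (Metric.ball_subset_closedBall hu))

/-- For real angles the complex powers are powers of positive reals. -/
theorem ofReal_integral_mehler (t : ℝ) {θ : ℝ} (h0 : 0 < θ) (h1 : θ < Real.pi) :
    ∫ p in Set.Ioo (0 : ℝ) 1, mehlerIntegrand t θ p =
      ((∫ p in Set.Ioo (0 : ℝ) 1, Real.exp (t * θ * (1 - 2 * p)) * θ *
        (Real.sin (θ * p) ^ (-1 / 2 : ℝ) * Real.sin (θ * (1 - p)) ^ (-1 / 2 : ℝ)) : ℝ) : ℂ) := by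
  rw [← integral_complex_ofReal]
  refine setIntegral_congr_fun measurableSet_Ioo fun p hp => ?_
  have p1 : 0 ≤ Real.sin (θ * p) :=
    Real.sin_nonneg_of_nonneg_of_le_pi (by nlinarith [hp.1]) (by nlinarith [hp.1, hp.2])
  have p2 : 0 ≤ Real.sin (θ * (1 - p)) :=
    Real.sin_nonneg_of_nonneg_of_le_pi (by nlinarith [hp.1, hp.2]) (by nlinarith [hp.1, hp.2])
  simp only [mehlerIntegrand]
  push_cast [Complex.ofReal_cpow p1, Complex.ofReal_cpow p2]
  rfl

/-- The coefficients of the power series of the Mehler–Dirichlet integral are those of the Gauss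
series of `₂F₁(s, 1 - s; 1; ·)` with `s = 1/2 + i t`. -/
theorem coshSecCoeff_mul_prod (t : ℝ) (n : ℕ) :
    ((coshSecCoeff t n * ∏ i ∈ Finset.range n, ((2 * i + 1) / (2 * i + 2) : ℝ) : ℝ) : ℂ) =
      (n.factorial : ℂ)⁻¹ * (ascPochhammer ℂ n).eval (1 / 2 + t * Complex.I) *
        (ascPochhammer ℂ n).eval (1 - (1 / 2 + t * Complex.I)) *
        ((ascPochhammer ℂ n).eval 1)⁻¹ := by
  rw [ascPochhammer_eval_one]
  induction n with
  | zero => simp [coshSecCoeff]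
  | succ n ih =>
    have hr : coshSecCoeff t (n + 1) = coshSecCoeff t n *
        (((2 * n + 1) ^ 2 + 4 * t ^ 2) / ((2 * n + 1) * (2 * n + 2))) := by
      rw [coshSecCoeff, Finset.prod_range_succ, ← coshSecCoeff]
    have e : ((coshSecCoeff t (n + 1) *
        ∏ i ∈ Finset.range (n + 1), ((2 * i + 1) / (2 * i + 2) : ℝ) : ℝ) : ℂ) =
        ((coshSecCoeff t n * ∏ i ∈ Finset.range n, ((2 * i + 1) / (2 * i + 2) : ℝ) : ℝ) : ℂ) *
          (((1 / 2 + n) ^ 2 + t ^ 2) / (n + 1) ^ 2 : ℝ) := by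
      rw [← Complex.ofReal_mul, hr, Finset.prod_range_succ]
      congr 1
      field_simp
      ring
    rw [e, ih, ascPochhammer_succ_eval, ascPochhammer_succ_eval, Nat.factorial_succ]
    have h1 : (n.factorial : ℂ) ≠ 0 := by exact_mod_cast n.factorial_ne_zero
    have h2 : (n + 1 : ℂ) ≠ 0 := by exact_mod_cast n.succ_ne_zero
    have e2 : (1 / 2 + t * Complex.I + n) * (1 - (1 / 2 + t * Complex.I) + n) =
        (1 / 2 + n) ^ 2 + t ^ 2 := by
      linear_combination -(t : ℂ) ^ 2 * Complex.I_sq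
    push_cast
    rw [← e2]
    field_simp

theorem one_sub_sq_mem_cutPlane {z : ℂ} (hz : 0 < z.re) : 1 - z ^ 2 ∈ cutPlane := by
  rw [mem_cutPlane_iff, sub_sub_cancel, Complex.mem_slitPlane_iff_not_le_zero, Complex.le_def]
  rintro ⟨q1, q2⟩
  simp only [sq, Complex.mul_re, Complex.mul_im, Complex.zero_re, Complex.zero_im] at q1 q2
  have : z.im = 0 := by nlinarith
  rw [this] at q1
  nlinarith

/-- The function `H_s`, `s = 1/2 + i t`, is the branch of the Gauss series: it exists because
`0 < re (1 - s) < 1`. -/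
theorem differentiableOn_blockH_and_eq (t : ℝ) :
    DifferentiableOn ℂ (blockH (1 / 2 + t * Complex.I)) cutPlane ∧
      ∀ w ∈ cutPlane, ‖w‖ < 1 → blockH (1 / 2 + t * Complex.I) w =
        ordinaryHypergeometric (1 / 2 + t * Complex.I) (1 - (1 / 2 + t * Complex.I)) (1 : ℂ) w := by
  have hbr := isHypergeometricBranch_euler (a := 1 / 2 + t * Complex.I)
    (b := 1 - (1 / 2 + t * Complex.I)) (c := 1) (by simp; norm_num) (by simp)
  have heq := gaussHypergeometric_eqOn hbr
  exact ⟨hbr.1.congr heq, fun w hw hn => by rw [blockH, heq hw, hbr.2 w hn]⟩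

/-- The **Mehler–Dirichlet formula** for the conical function at complex angles. -/
theorem blockH_sin_sq {t : ℝ} (ht : t ≠ 0) {θ : ℂ} (h0 : 0 < θ.re) (h1 : θ.re < Real.pi) :
    blockH (1 / 2 + t * Complex.I) (Complex.sin (θ / 2) ^ 2) =
      (Real.pi : ℂ)⁻¹ * ∫ p in Set.Ioo (0 : ℝ) 1, mehlerIntegrand t θ p := by
  set s : ℂ := 1 / 2 + t * Complex.I with hs
  set S := {θ : ℂ | 0 < θ.re ∧ θ.re < Real.pi} with hS
  have hopen : IsOpen S :=
    (isOpen_lt continuous_const Complex.continuous_re).inter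
      (isOpen_lt Complex.continuous_re continuous_const)
  have hconv : Convex ℝ S :=
    (convex_halfSpace_re_gt 0).inter (convex_halfSpace_re_lt Real.pi)
  -- Both sides are holomorphic in `θ` on the strip, and they agree for small real `θ`, where both
  -- are given by the same power series in `sin (θ / 2) ^ 2`.
  obtain ⟨hH, hHval⟩ := differentiableOn_blockH_and_eq t
  have hmaps : ∀ θ ∈ S, Complex.sin (θ / 2) ^ 2 ∈ cutPlane := by
    intro θ hθ
    have hre : 0 < (Complex.cos (θ / 2)).re := by
      rw [← Complex.sin_pi_div_two_sub, re_sin]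
      refine mul_pos (Real.sin_pos_of_pos_of_lt_pi ?_ ?_) (Real.cosh_pos _) <;>
        simp <;> linarith [hθ.1, hθ.2]
    rw [Complex.sin_sq]
    exact one_sub_sq_mem_cutPlane hre
  have hL : DifferentiableOn ℂ (fun θ => blockH s (Complex.sin (θ / 2) ^ 2)) S :=
    hH.comp (by fun_prop) hmaps
  have hR : DifferentiableOn ℂ
      (fun θ => (Real.pi : ℂ)⁻¹ * ∫ p in Set.Ioo (0 : ℝ) 1, mehlerIntegrand t θ p) S :=
    (differentiableOn_integral_mehlerIntegrand t).const_mul _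
  obtain ⟨r, hr, hsum⟩ := hasSum_integral_mehler ht
  have hreal : ∀ θ : ℝ, 0 < θ → θ < min r 3 → blockH s (Complex.sin (θ / 2) ^ 2) =
      (Real.pi : ℂ)⁻¹ * ∫ p in Set.Ioo (0 : ℝ) 1, mehlerIntegrand t θ p := by
    intro θ hθ0 hθr
    have hθ3 : θ < 3 := hθr.trans_le (min_le_right _ _)
    have hθpi : θ < Real.pi := hθ3.trans Real.pi_gt_three
    have hlt : Real.sin (θ / 2) < 1 := by
      rw [← Real.sin_pi_div_two]
      exact Real.sin_lt_sin_of_lt_of_le_pi_div_two (by linarith) le_rfl (by linarith)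
    have hgt : 0 < Real.sin (θ / 2) := Real.sin_pos_of_pos_of_lt_pi (by linarith) (by linarith)
    have hcast : Complex.sin ((θ : ℂ) / 2) = ((Real.sin (θ / 2) : ℝ) : ℂ) := by push_cast; rfl
    have hn : ‖Complex.sin ((θ : ℂ) / 2) ^ 2‖ < 1 := by
      rw [hcast, norm_pow, Complex.norm_real, Real.norm_of_nonneg hgt.le]
      exact pow_lt_one₀ hgt.le hlt two_ne_zero
    have hmem : Complex.sin ((θ : ℂ) / 2) ^ 2 ∈ cutPlane :=
      hmaps θ ⟨by simpa using hθ0, by simpa using hθpi⟩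
    rw [hHval _ hmem hn, ofReal_integral_mehler t hθ0 hθpi]
    have h3 := hsum θ hθ0 (hθr.trans_le (min_le_left _ _))
    rw [← Complex.hasSum_ofReal] at h3
    rw [ordinaryHypergeometric_eq_tsum]
    beta_reduce
    rw [← (h3.mul_left (Real.pi : ℂ)⁻¹).tsum_eq]
    refine tsum_congr fun n => ?_
    rw [← coshSecCoeff_mul_prod, smul_eq_mul, ← pow_mul]
    have : (Real.pi : ℂ) ≠ 0 := by exact_mod_cast Real.pi_ne_zero
    push_cast
    field_simp
  set x₀ : ℝ := min r 3 / 2 with hx0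
  have hx0' : 0 < x₀ := by positivity
  have hx0r : x₀ < min r 3 := by
    have : 0 < min r 3 := by positivity
    rw [hx0]; linarith
  have hmem : (x₀ : ℂ) ∈ S := by
    refine ⟨by simpa using hx0', ?_⟩
    have := min_le_right r 3
    simp only [Complex.ofReal_re]
    linarith [Real.pi_gt_three]
  refine (hL.analyticOnNhd hopen).eqOn_of_preconnected_of_frequently_eq (hR.analyticOnNhd hopen)
    hconv.isPreconnected hmem ?_ ⟨h0, h1⟩
  have htend : Filter.Tendsto (fun x : ℝ => (x : ℂ)) (nhdsWithin x₀ {x₀}ᶜ)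
      (nhdsWithin (x₀ : ℂ) {(x₀ : ℂ)}ᶜ) :=
    tendsto_nhdsWithin_of_tendsto_nhds_of_eventually_within _
      ((Complex.continuous_ofReal.tendsto x₀).mono_left nhdsWithin_le_nhds)
      (by filter_upwards [self_mem_nhdsWithin] with x hx; simpa using hx)
  refine htend.frequently (Filter.Eventually.frequently ?_)
  filter_upwards [nhdsWithin_le_nhds (Ioo_mem_nhds hx0' hx0r)] with x hx
  exact hreal x hx.1 hx.2

/-! ### The complex arcsine near the origin -/

/-- The square root of `1 - z ^ 2` that is `1` at `0`, i.e. the cosine of `cArcsin z`. -/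
noncomputable def sqrtOneSubSq (z : ℂ) : ℂ := (1 - z ^ 2) ^ (2⁻¹ : ℂ)

/-- The principal branch of the complex arcsine. It is only used near the origin. -/
noncomputable def cArcsin (z : ℂ) : ℂ := -Complex.I * Complex.log (Complex.I * z + sqrtOneSubSq z)

theorem re_sqrt_nonneg (u : ℂ) : 0 ≤ (u ^ (2⁻¹ : ℂ)).re := by
  rcases eq_or_ne u 0 with rfl | h
  · simp
  · rw [Complex.cpow_def_of_ne_zero h, Complex.exp_re]
    refine mul_nonneg (Real.exp_pos _).le (Real.cos_nonneg_of_mem_Icc ?_)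
    have h1 : (Complex.log u * 2⁻¹).im = u.arg / 2 := by
      rw [show (2⁻¹ : ℂ) = ((2⁻¹ : ℝ) : ℂ) by push_cast; rfl, Complex.im_mul_ofReal, Complex.log_im]
      ring
    rw [h1]
    constructor <;> linarith [Complex.neg_pi_lt_arg u, Complex.arg_le_pi u]

theorem sqrtOneSubSq_sq (z : ℂ) : sqrtOneSubSq z ^ 2 = 1 - z ^ 2 := by
  rw [sqrtOneSubSq, Complex.cpow_ofNat_inv_pow]

theorem norm_sqrtOneSubSq_sub_one_le (z : ℂ) : ‖sqrtOneSubSq z - 1‖ ≤ ‖z‖ ^ 2 := by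
  have h1 : (sqrtOneSubSq z - 1) * (sqrtOneSubSq z + 1) = -z ^ 2 := by
    linear_combination sqrtOneSubSq_sq z
  have h2 : 1 ≤ ‖sqrtOneSubSq z + 1‖ := by
    refine le_trans ?_ (Complex.re_le_norm _)
    have := re_sqrt_nonneg (1 - z ^ 2)
    simpa [sqrtOneSubSq] using this
  have h3 := congrArg norm h1
  rw [norm_mul, norm_neg, norm_pow] at h3
  nlinarith [norm_nonneg (sqrtOneSubSq z - 1)]

theorem re_sqrtOneSubSq_ge {z : ℂ} (hz : ‖z‖ < 1 / 2) : 3 / 4 ≤ (sqrtOneSubSq z).re := by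
  have h1 := norm_sqrtOneSubSq_sub_one_le z
  have h2 := (abs_le.1 (Complex.abs_re_le_norm (sqrtOneSubSq z - 1))).1
  simp only [Complex.sub_re, Complex.one_re] at h2
  nlinarith [norm_nonneg z]

theorem norm_sqrtOneSubSq_ge {z : ℂ} (hz : ‖z‖ < 1 / 2) : 3 / 4 ≤ ‖sqrtOneSubSq z‖ :=
  (re_sqrtOneSubSq_ge hz).trans (Complex.re_le_norm _)

theorem re_I_mul_add_sqrt_pos {z : ℂ} (hz : ‖z‖ < 1 / 2) :
    0 < (Complex.I * z + sqrtOneSubSq z).re := by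
  have h1 := re_sqrtOneSubSq_ge hz
  have h2 := (abs_le.1 (Complex.abs_im_le_norm z)).2
  simp
  linarith

theorem exp_I_mul_cArcsin {z : ℂ} (hz : ‖z‖ < 1 / 2) :
    Complex.exp (cArcsin z * Complex.I) = Complex.I * z + sqrtOneSubSq z := by
  have h0 : Complex.I * z + sqrtOneSubSq z ≠ 0 := fun h => by
    have := re_I_mul_add_sqrt_pos hz
    rw [h] at this
    simp at this
  rw [cArcsin, show ∀ w : ℂ, -Complex.I * w * Complex.I = w from fun w => by
    linear_combination -w * Complex.I_sq, Complex.exp_log h0]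

theorem exp_neg_I_mul_cArcsin {z : ℂ} (hz : ‖z‖ < 1 / 2) :
    Complex.exp (-(cArcsin z * Complex.I)) = sqrtOneSubSq z - Complex.I * z := by
  rw [Complex.exp_neg, exp_I_mul_cArcsin hz]
  apply inv_eq_of_mul_eq_one_right
  linear_combination sqrtOneSubSq_sq z - z ^ 2 * Complex.I_sq

theorem sin_cArcsin {z : ℂ} (hz : ‖z‖ < 1 / 2) : Complex.sin (cArcsin z) = z := by
  rw [Complex.sin, neg_mul, exp_neg_I_mul_cArcsin hz, exp_I_mul_cArcsin hz]
  linear_combination -z * Complex.I_sq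

theorem cos_cArcsin {z : ℂ} (hz : ‖z‖ < 1 / 2) : Complex.cos (cArcsin z) = sqrtOneSubSq z := by
  rw [Complex.cos, neg_mul, exp_neg_I_mul_cArcsin hz, exp_I_mul_cArcsin hz]
  ring

theorem hasDerivAt_sqrtOneSubSq {z : ℂ} (hz : ‖z‖ < 1 / 2) :
    HasDerivAt sqrtOneSubSq (-z / sqrtOneSubSq z) z := by
  have hs : 1 - z ^ 2 ∈ Complex.slitPlane := by
    left
    have h := (abs_le.1 (Complex.abs_re_le_norm (z ^ 2))).2
    rw [norm_pow] at h
    simp only [Complex.sub_re, Complex.one_re]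
    nlinarith [norm_nonneg z]
  have h1 : HasDerivAt (fun z : ℂ => 1 - z ^ 2) (-(2 * z)) z := by
    simpa using ((hasDerivAt_id z).pow 2).const_sub 1
  have h2 := h1.cpow_const (c := 2⁻¹) hs
  refine h2.congr_deriv ?_
  have h0 : sqrtOneSubSq z ≠ 0 := norm_pos_iff.1 (by linarith [norm_sqrtOneSubSq_ge hz])
  have h3 : (1 - z ^ 2) ^ (2⁻¹ - 1 : ℂ) = (sqrtOneSubSq z)⁻¹ := by
    rw [sqrtOneSubSq, ← Complex.cpow_neg]
    norm_num
  rw [h3]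
  field_simp

theorem hasDerivAt_cArcsin {z : ℂ} (hz : ‖z‖ < 1 / 2) :
    HasDerivAt cArcsin (sqrtOneSubSq z)⁻¹ z := by
  have hp := re_I_mul_add_sqrt_pos hz
  have h0 : sqrtOneSubSq z ≠ 0 := norm_pos_iff.1 (by linarith [norm_sqrtOneSubSq_ge hz])
  have h1 : HasDerivAt (fun z => Complex.I * z + sqrtOneSubSq z)
      (Complex.I + -z / sqrtOneSubSq z) z := by
    exact (((hasDerivAt_id z).const_mul Complex.I).add (hasDerivAt_sqrtOneSubSq hz)).congr_deriv
      (by simp)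
  have h2 := (h1.clog (Or.inl hp)).const_mul (-Complex.I)
  refine h2.congr_deriv ?_
  have h3 : Complex.I * z + sqrtOneSubSq z ≠ 0 := fun h => by
    rw [h] at hp
    simp at hp
  field_simp
  linear_combination -sqrtOneSubSq z * Complex.I_sq

theorem cArcsin_zero : cArcsin 0 = 0 := by simp [cArcsin, sqrtOneSubSq]

theorem hasDerivAt_cArcsin_sub_id {z : ℂ} (hz : ‖z‖ < 1 / 2) :
    HasDerivAt (fun z => cArcsin z - z) ((sqrtOneSubSq z)⁻¹ - 1) z :=
  (hasDerivAt_cArcsin hz).sub (hasDerivAt_id z)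

theorem norm_inv_sqrtOneSubSq_sub_one_le {z : ℂ} (hz : ‖z‖ < 1 / 2) :
    ‖(sqrtOneSubSq z)⁻¹ - 1‖ ≤ ‖z‖ ^ 2 := by
  have hg := norm_sqrtOneSubSq_ge hz
  have h0 : sqrtOneSubSq z ≠ 0 := norm_pos_iff.1 (by linarith)
  have h1 : ((sqrtOneSubSq z)⁻¹ - 1) * (sqrtOneSubSq z * (sqrtOneSubSq z + 1)) = z ^ 2 := by
    field_simp
    linear_combination -sqrtOneSubSq_sq z
  have h2 : 7 / 4 ≤ ‖sqrtOneSubSq z + 1‖ := by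
    refine le_trans ?_ (Complex.re_le_norm _)
    have := re_sqrtOneSubSq_ge hz
    simp only [Complex.add_re, Complex.one_re]
    linarith
  have h3 := congrArg norm h1
  rw [norm_mul, norm_mul, norm_pow] at h3
  have h4 : 1 ≤ ‖sqrtOneSubSq z‖ * ‖sqrtOneSubSq z + 1‖ := by nlinarith
  nlinarith [norm_nonneg ((sqrtOneSubSq z)⁻¹ - 1)]

theorem norm_cArcsin_sub_id_sub_le {z w : ℂ} (hz : ‖z‖ < 1 / 2) (hw : ‖w‖ ≤ ‖z‖) :
    ‖(cArcsin z - z) - (cArcsin w - w)‖ ≤ ‖z‖ ^ 2 * ‖z - w‖ := by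
  have hlt : ∀ x ∈ Metric.closedBall (0 : ℂ) ‖z‖, ‖x‖ ≤ ‖z‖ := fun x hx => by simpa using hx
  refine Convex.norm_image_sub_le_of_norm_hasDerivWithin_le (f := fun z => cArcsin z - z)
    (f' := fun z => (sqrtOneSubSq z)⁻¹ - 1) (s := Metric.closedBall (0 : ℂ) ‖z‖)
    (fun x hx => (hasDerivAt_cArcsin_sub_id ((hlt x hx).trans_lt hz)).hasDerivWithinAt)
    (fun x hx => (norm_inv_sqrtOneSubSq_sub_one_le ((hlt x hx).trans_lt hz)).trans
      (pow_le_pow_left₀ (norm_nonneg _) (hlt x hx) 2)) (convex_closedBall _ _) ?_ ?_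
  · simpa using hw
  · simp

theorem norm_cArcsin_sub_le {z : ℂ} (hz : ‖z‖ < 1 / 2) : ‖cArcsin z - z‖ ≤ ‖z‖ ^ 3 := by
  have := norm_cArcsin_sub_id_sub_le hz (w := 0) (by simp)
  rw [cArcsin_zero] at this
  simpa [pow_succ] using this

theorem re_cArcsin_mul_I {y : ℝ} : (cArcsin (y * Complex.I)).re = 0 := by
  have h1 : 1 - ((y : ℂ) * Complex.I) ^ 2 = ((1 + y ^ 2 : ℝ) : ℂ) := by
    push_cast
    linear_combination -(y : ℂ) ^ 2 * Complex.I_sq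
  have h2 : Complex.I * ((y : ℂ) * Complex.I) + sqrtOneSubSq (y * Complex.I) =
      ((-y + √(1 + y ^ 2) : ℝ) : ℂ) := by
    rw [sqrtOneSubSq, h1, Real.sqrt_eq_rpow, Complex.ofReal_add (-y),
      Complex.ofReal_cpow (by positivity)]
    push_cast
    rw [one_div]
    linear_combination (y : ℂ) * Complex.I_sq
  have h3 : 0 ≤ -y + √(1 + y ^ 2) := by
    have : y ≤ √(1 + y ^ 2) := Real.le_sqrt_of_sq_le (by linarith)
    linarith
  rw [cArcsin, h2, ← Complex.ofReal_log h3]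
  simp

/-- The arcsine preserves the imaginary axis, and near the origin `cArcsin z - z` is Lipschitz with
constant `1/4`. -/
theorem re_cArcsin_ge {z : ℂ} (hz : ‖z‖ < 1 / 2) (h0 : 0 ≤ z.re) : z.re / 2 ≤ (cArcsin z).re := by
  have hw : ‖(z.im : ℂ) * Complex.I‖ ≤ ‖z‖ := by
    simpa using Complex.abs_im_le_norm z
  have h1 := norm_cArcsin_sub_id_sub_le hz hw
  have h2 : z - (z.im : ℂ) * Complex.I = (z.re : ℂ) := by
    linear_combination -(Complex.re_add_im z)
  rw [h2, Complex.norm_real, Real.norm_of_nonneg h0] at h1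
  have h3 := (abs_le.1 (Complex.abs_re_le_norm
    ((cArcsin z - z) - (cArcsin (z.im * Complex.I) - z.im * Complex.I)))).1
  simp only [Complex.sub_re, re_cArcsin_mul_I, Complex.re_ofReal_mul, Complex.I_re, mul_zero] at h3
  have h4 : ‖z‖ ^ 2 ≤ 1 / 4 := by nlinarith [norm_nonneg z]
  nlinarith

theorem norm_cArcsin_ge {z : ℂ} (hz : ‖z‖ < 1 / 2) : 3 / 4 * ‖z‖ ≤ ‖cArcsin z‖ := by
  have h1 := norm_cArcsin_sub_le hz
  have h2 := norm_sub_norm_le z (z - cArcsin z)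
  rw [sub_sub_cancel, norm_sub_rev z] at h2
  have h4 : ‖z‖ ^ 2 ≤ 1 / 4 := by nlinarith [norm_nonneg z]
  nlinarith [norm_nonneg z]

theorem norm_cArcsin_le {z : ℂ} (hz : ‖z‖ < 1 / 2) : ‖cArcsin z‖ ≤ 5 / 4 * ‖z‖ := by
  have h1 := norm_cArcsin_sub_le hz
  have h2 := norm_add_le (cArcsin z - z) z
  rw [sub_add_cancel] at h2
  have h4 : ‖z‖ ^ 2 ≤ 1 / 4 := by nlinarith [norm_nonneg z]
  nlinarith [norm_nonneg z]

theorem cpow_conj_of_re_pos {x : ℂ} (hx : 0 < x.re) (r : ℝ) :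
    (starRingEnd ℂ x) ^ (r : ℂ) = starRingEnd ℂ (x ^ (r : ℂ)) := by
  have harg : x.arg ≠ Real.pi := fun h => by
    have := Complex.abs_arg_lt_pi_div_two_iff.2 (Or.inl hx)
    rw [h, abs_of_pos Real.pi_pos] at this
    linarith [Real.pi_pos]
  rw [Complex.conj_cpow _ _ harg, Complex.conj_ofReal]

/-- The arcsine commutes with complex conjugation near the origin. -/
theorem cArcsin_conj {z : ℂ} (hz : ‖z‖ < 1 / 2) :
    cArcsin (starRingEnd ℂ z) = starRingEnd ℂ (cArcsin z) := by
  have hs : 0 < (1 - z ^ 2).re := by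
    have h := (abs_le.1 (Complex.abs_re_le_norm (z ^ 2))).2
    rw [norm_pow] at h
    simp only [Complex.sub_re, Complex.one_re]
    nlinarith [norm_nonneg z]
  have h1 : sqrtOneSubSq (starRingEnd ℂ z) = starRingEnd ℂ (sqrtOneSubSq z) := by
    have := cpow_conj_of_re_pos hs 2⁻¹
    push_cast at this
    rw [sqrtOneSubSq, sqrtOneSubSq, ← this]
    simp
  -- Conjugation turns `i z + √(1 - z²) = e ^ (i arcsin z)` into its inverse at the point `conj z`.
  rw [cArcsin, h1]
  have hp := re_I_mul_add_sqrt_pos hz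
  have harg : (Complex.I * z + sqrtOneSubSq z).arg ≠ Real.pi := fun h => by
    have := Complex.abs_arg_lt_pi_div_two_iff.2 (Or.inl hp)
    rw [h, abs_of_pos Real.pi_pos] at this
    linarith [Real.pi_pos]
  have h4 : Complex.I * starRingEnd ℂ z + starRingEnd ℂ (sqrtOneSubSq z) =
      (starRingEnd ℂ (Complex.I * z + sqrtOneSubSq z))⁻¹ := by
    symm
    apply inv_eq_of_mul_eq_one_right
    have := congrArg (starRingEnd ℂ) (sqrtOneSubSq_sq z)
    simp only [map_pow, map_sub, map_one] at this
    simp only [map_add, map_mul, Complex.conj_I]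
    linear_combination this - (starRingEnd ℂ z) ^ 2 * Complex.I_sq
  have harg2 : (starRingEnd ℂ (Complex.I * z + sqrtOneSubSq z)).arg ≠ Real.pi := fun h => by
    rw [Complex.arg_conj, if_neg harg] at h
    linarith [Complex.arg_le_pi (Complex.I * z + sqrtOneSubSq z), Real.pi_pos,
      Complex.neg_pi_lt_arg (Complex.I * z + sqrtOneSubSq z)]
  rw [h4, Complex.log_inv _ harg2, Complex.log_conj _ harg, cArcsin]
  simp

theorem mul_cpow_of_re_pos {a b : ℂ} (ha : 0 < a.re) (hb : 0 < b.re) (c : ℂ) :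
    (a * b) ^ c = a ^ c * b ^ c := by
  have ha0 : a ≠ 0 := fun h => by simp [h] at ha
  have hb0 : b ≠ 0 := fun h => by simp [h] at hb
  have h1 := abs_lt.1 (Complex.abs_arg_lt_pi_div_two_iff.2 (Or.inl ha))
  have h2 := abs_lt.1 (Complex.abs_arg_lt_pi_div_two_iff.2 (Or.inl hb))
  rw [Complex.cpow_def_of_ne_zero (mul_ne_zero ha0 hb0), Complex.cpow_def_of_ne_zero ha0,
    Complex.cpow_def_of_ne_zero hb0, (Complex.log_mul_eq_add_log_iff ha0 hb0).2
      ⟨by linarith [h1.1, h2.1], by linarith [h1.2, h2.2]⟩, add_mul, Complex.exp_add]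

/-- Square roots in the right half plane do not nearly cancel, so that `a ↦ a ^ (-1/2)` is
Lipschitz there in this homogeneous sense. -/
theorem norm_cpow_neg_half_sub_le {a b : ℂ} (ha : 0 < a.re) (hb : 0 < b.re) :
    ‖a ^ (-1 / 2 : ℂ) - b ^ (-1 / 2 : ℂ)‖ ≤ ‖a - b‖ * ‖a‖⁻¹ * ‖b‖ ^ (-1 / 2 : ℝ) := by
  have ha0 : a ≠ 0 := fun h => by simp [h] at ha
  have hb0 : b ≠ 0 := fun h => by simp [h] at hb
  set u := a ^ (2⁻¹ : ℂ) with hu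
  set v := b ^ (2⁻¹ : ℂ) with hv
  have hu2 : u ^ 2 = a := Complex.cpow_ofNat_inv_pow a 2
  have hv2 : v ^ 2 = b := Complex.cpow_ofNat_inv_pow b 2
  have hu0 : u ≠ 0 := fun h => ha0 (by rw [← hu2, h]; simp)
  have hv0 : v ≠ 0 := fun h => hb0 (by rw [← hv2, h]; simp)
  have ea : a ^ (-1 / 2 : ℂ) = u⁻¹ := by rw [hu, ← Complex.cpow_neg]; norm_num
  have eb : b ^ (-1 / 2 : ℂ) = v⁻¹ := by rw [hv, ← Complex.cpow_neg]; norm_num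
  have hur : 0 ≤ u.re := re_sqrt_nonneg a
  have hvr : 0 ≤ v.re := re_sqrt_nonneg b
  have hui : u.im ^ 2 < u.re ^ 2 := by
    rw [← hu2, sq, Complex.mul_re] at ha; nlinarith
  have hvi : v.im ^ 2 < v.re ^ 2 := by
    rw [← hv2, sq, Complex.mul_re] at hb; nlinarith
  have hcross : 0 ≤ u.re * v.re + u.im * v.im := by
    have : |u.im * v.im| ≤ u.re * v.re := by
      rw [abs_mul]
      exact mul_le_mul (abs_le_of_sq_le_sq hui.le hur) (abs_le_of_sq_le_sq hvi.le hvr)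
        (abs_nonneg _) hur
    linarith [(abs_le.1 this).1]
  have hsum : ‖u‖ ≤ ‖u + v‖ := by
    rw [← sq_le_sq₀ (norm_nonneg _) (norm_nonneg _), ← Complex.normSq_eq_norm_sq,
      ← Complex.normSq_eq_norm_sq, Complex.normSq_apply, Complex.normSq_apply]
    simp only [Complex.add_re, Complex.add_im]
    nlinarith [sq_nonneg v.re, sq_nonneg v.im]
  have hid : u⁻¹ - v⁻¹ = (b - a) * u⁻¹ * (u + v)⁻¹ * v⁻¹ := by
    have huv : u + v ≠ 0 := norm_pos_iff.1 ((norm_pos_iff.2 hu0).trans_le hsum)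
    rw [← hu2, ← hv2]
    field_simp
    ring
  rw [← norm_cpow_neg_half b, ea, eb, hid, norm_mul, norm_mul, norm_mul, norm_sub_rev b a]
  refine mul_le_mul_of_nonneg_right ?_ (norm_nonneg _)
  rw [mul_assoc]
  refine mul_le_mul_of_nonneg_left ?_ (norm_nonneg _)
  rw [norm_inv, norm_inv, ← mul_inv, ← hu2, norm_pow, sq]
  have := norm_pos_iff.2 hu0
  gcongr

/-! ### The Mehler–Dirichlet kernel near its endpoints -/

/-- The angle `θ = π - 2 arcsin z`, which satisfies `sin (θ / 2) ^ 2 = 1 - z ^ 2` and has real part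
below `π` for `z` in the right half plane. -/
noncomputable def mehlerAngle (z : ℂ) : ℂ := Real.pi - 2 * cArcsin z

section mehlerAngle
variable {z : ℂ}

theorem mehlerAngle_re_lt (h0 : 0 < z.re) (hz : ‖z‖ ≤ 1 / 4) : (mehlerAngle z).re < Real.pi := by
  have := re_cArcsin_ge (by linarith) h0.le
  simp [mehlerAngle]
  linarith

theorem two_le_mehlerAngle_re (hz : ‖z‖ ≤ 1 / 4) : 2 ≤ (mehlerAngle z).re := by
  have h1 := norm_cArcsin_le (z := z) (by linarith)
  have h2 := Complex.re_le_norm (cArcsin z)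
  simp [mehlerAngle]
  linarith [Real.pi_gt_three]

theorem norm_mehlerAngle_le (hz : ‖z‖ ≤ 1 / 4) : ‖mehlerAngle z‖ ≤ 5 := by
  have h1 := norm_cArcsin_le (z := z) (by linarith)
  calc ‖mehlerAngle z‖ ≤ ‖(Real.pi : ℂ)‖ + ‖2 * cArcsin z‖ := norm_sub_le _ _
    _ ≤ 5 := by
      rw [norm_mul, Complex.norm_real, Real.norm_of_nonneg Real.pi_pos.le]
      norm_num
      linarith [Real.pi_lt_four]

theorem sin_half_mehlerAngle_sq (hz : ‖z‖ ≤ 1 / 4) :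
    Complex.sin (mehlerAngle z / 2) ^ 2 = 1 - z ^ 2 := by
  rw [show mehlerAngle z / 2 = Real.pi / 2 - cArcsin z by rw [mehlerAngle]; ring,
    Complex.sin_pi_div_two_sub, cos_cArcsin (by linarith), sqrtOneSubSq_sq]

theorem sin_mehlerAngle (hz : ‖z‖ ≤ 1 / 4) :
    Complex.sin (mehlerAngle z) = z * (2 * sqrtOneSubSq z) := by
  rw [mehlerAngle, Complex.sin_pi_sub, Complex.sin_two_mul, sin_cArcsin (by linarith),
    cos_cArcsin (by linarith)]
  ring

/-- The size of `sin (θ p)` on the half of the segment next to `p = 0`. -/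
theorem le_re_sin_mehlerAngle_mul (h0 : 0 < z.re) (hz : ‖z‖ ≤ 1 / 4) {p : ℝ} (hp0 : 0 ≤ p)
    (hp : p ≤ 1 / 2) : p ≤ (Complex.sin (mehlerAngle z * p)).re := by
  have h1 := two_le_mehlerAngle_re hz
  have h2 := mehlerAngle_re_lt h0 hz
  rw [re_sin, Complex.re_mul_ofReal, Complex.im_mul_ofReal]
  have h3 : 2 / Real.pi * ((mehlerAngle z).re * p) ≤ Real.sin ((mehlerAngle z).re * p) :=
    Real.mul_le_sin (by positivity) (by nlinarith)
  have h4 : p ≤ 2 / Real.pi * ((mehlerAngle z).re * p) := by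
    rw [div_mul_eq_mul_div, le_div_iff₀ Real.pi_pos]
    nlinarith [Real.pi_lt_four]
  exact (h4.trans h3).trans
    (le_mul_of_one_le_right (hp0.trans (h4.trans h3)) (Real.one_le_cosh _))

/-- On the other half of the segment `sin (θ q)` comes as close to zero as `sin θ`, which is of size
`‖z‖`, but not closer. -/
theorem norm_sin_mehlerAngle_mul_ge (h0 : 0 < z.re) (hz : ‖z‖ ≤ 1 / 4) {q : ℝ} (hq : 1 / 2 ≤ q)
    (hq1 : q ≤ 1) : ‖z‖ / 2 ≤ ‖Complex.sin (mehlerAngle z * q)‖ := by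
  have h1 := two_le_mehlerAngle_re hz
  have h2 := mehlerAngle_re_lt h0 hz
  set θ := mehlerAngle z with hθ
  have hre : θ.re = Real.pi - 2 * (cArcsin z).re := by simp [hθ, mehlerAngle]
  have him : θ.im = - 2 * (cArcsin z).im := by simp [hθ, mehlerAngle]
  have ha : 0 < (cArcsin z).re := by linarith
  have ha1 : (cArcsin z).re ≤ 1 / 2 := by
    linarith [norm_cArcsin_le (z := z) (by linarith), Complex.re_le_norm (cArcsin z)]
  have hs : (cArcsin z).re ≤ Real.sin (θ.re * q) := by
    rcases le_total (θ.re * q) (Real.pi / 2) with h | h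
    · have := Real.mul_le_sin (x := θ.re * q) (by positivity) h
      refine le_trans ?_ this
      rw [div_mul_eq_mul_div, le_div_iff₀ Real.pi_pos]
      nlinarith [Real.pi_lt_four]
    · have := Real.mul_le_sin (x := Real.pi - θ.re * q) (by nlinarith) (by linarith)
      rw [Real.sin_pi_sub] at this
      refine le_trans ?_ this
      rw [div_mul_eq_mul_div, le_div_iff₀ Real.pi_pos]
      nlinarith [Real.pi_lt_four]
  have hsh : (cArcsin z).im ^ 2 ≤ Real.sinh (θ.im * q) ^ 2 := by
    have e1 : |θ.im * q| ≤ |Real.sinh (θ.im * q)| := by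
      rw [Real.abs_sinh]
      exact Real.self_le_sinh_iff.2 (abs_nonneg _)
    have e2 : |(cArcsin z).im| ≤ |θ.im * q| := by
      rw [him, abs_mul, abs_mul, abs_of_nonneg (by linarith : 0 ≤ q)]
      norm_num
      nlinarith [abs_nonneg (cArcsin z).im]
    exact sq_le_sq.2 (e2.trans e1)
  have h3 : ‖cArcsin z‖ ≤ ‖Complex.sin (θ * q)‖ := by
    rw [← sq_le_sq₀ (norm_nonneg _) (norm_nonneg _), ← Complex.normSq_eq_norm_sq,
      ← Complex.normSq_eq_norm_sq, Complex.normSq_apply, Complex.normSq_apply, re_sin, im_sin,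
      Complex.re_mul_ofReal, Complex.im_mul_ofReal]
    have e1 := Real.cosh_sq (θ.im * q)
    have e2 := Real.sin_sq_add_cos_sq (θ.re * q)
    have e3 : Real.sin (θ.re * q) * Real.cosh (θ.im * q) *
        (Real.sin (θ.re * q) * Real.cosh (θ.im * q)) + Real.cos (θ.re * q) * Real.sinh (θ.im * q) *
        (Real.cos (θ.re * q) * Real.sinh (θ.im * q)) =
        Real.sin (θ.re * q) ^ 2 + Real.sinh (θ.im * q) ^ 2 := by
      linear_combination Real.sin (θ.re * q) ^ 2 * e1 + Real.sinh (θ.im * q) ^ 2 * e2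
    rw [e3]
    nlinarith
  linarith [norm_cArcsin_ge (z := z) (by linarith), norm_nonneg z]

end mehlerAngle

theorem norm_cos_le (w : ℂ) : ‖Complex.cos w‖ ≤ Real.exp ‖w‖ := by
  rw [Complex.cos, norm_div, Complex.norm_ofNat, div_le_iff₀ two_pos]
  have h : ∀ v : ℂ, ‖v‖ = ‖w‖ → ‖Complex.exp v‖ ≤ Real.exp ‖w‖ := fun v hv => by
    rw [Complex.norm_exp]
    exact Real.exp_le_exp.2 ((Complex.re_le_norm v).trans hv.le)
  linarith [norm_add_le (Complex.exp (w * Complex.I)) (Complex.exp (-w * Complex.I)),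
    h (w * Complex.I) (by simp), h (-w * Complex.I) (by simp)]

theorem norm_sin_le (w : ℂ) : ‖Complex.sin w‖ ≤ Real.exp ‖w‖ := by
  rw [Complex.sin, norm_div, Complex.norm_ofNat, div_le_iff₀ two_pos, norm_mul, Complex.norm_I,
    mul_one]
  have h : ∀ v : ℂ, ‖v‖ = ‖w‖ → ‖Complex.exp v‖ ≤ Real.exp ‖w‖ := fun v hv => by
    rw [Complex.norm_exp]
    exact Real.exp_le_exp.2 ((Complex.re_le_norm v).trans hv.le)
  linarith [norm_sub_le (Complex.exp (-w * Complex.I)) (Complex.exp (w * Complex.I)),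
    h (w * Complex.I) (by simp), h (-w * Complex.I) (by simp)]

theorem norm_sin_sub_sin_le {R : ℝ} {a b : ℂ} (ha : ‖a‖ ≤ R) (hb : ‖b‖ ≤ R) :
    ‖Complex.sin a - Complex.sin b‖ ≤ Real.exp R * ‖a - b‖ := by
  refine Convex.norm_image_sub_le_of_norm_hasDerivWithin_le (f := Complex.sin) (f' := Complex.cos)
    (s := Metric.closedBall (0 : ℂ) R) (fun x _ => (Complex.hasDerivAt_sin x).hasDerivWithinAt)
    (fun x hx => (norm_cos_le x).trans (Real.exp_le_exp.2 (by simpa using hx)))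
    (convex_closedBall _ _) (by simpa using hb) (by simpa using ha)

theorem norm_cos_sub_one_le (w : ℂ) : ‖Complex.cos w - 1‖ ≤ Real.exp ‖w‖ * ‖w‖ := by
  have := Convex.norm_image_sub_le_of_norm_hasDerivWithin_le (f := Complex.cos)
    (f' := fun x => -Complex.sin x) (C := Real.exp ‖w‖) (x := 0) (y := w)
    (s := Metric.closedBall (0 : ℂ) ‖w‖) (fun x _ => (Complex.hasDerivAt_cos x).hasDerivWithinAt)
    (fun x hx => by
      rw [norm_neg]
      exact (norm_sin_le x).trans (Real.exp_le_exp.2 (by simpa using hx)))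
    (convex_closedBall _ _) (by simp) (by simp)
  simpa using this

theorem norm_sin_sub_self_le (w : ℂ) : ‖Complex.sin w - w‖ ≤ Real.exp ‖w‖ * ‖w‖ ^ 2 := by
  have := Convex.norm_image_sub_le_of_norm_hasDerivWithin_le (f := fun x => Complex.sin x - x)
    (f' := fun x => Complex.cos x - 1) (C := Real.exp ‖w‖ * ‖w‖) (x := 0) (y := w)
    (s := Metric.closedBall (0 : ℂ) ‖w‖)
    (fun x _ => ((Complex.hasDerivAt_sin x).sub (hasDerivAt_id x)).hasDerivWithinAt)
    (fun x hx => by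
      have hx' : ‖x‖ ≤ ‖w‖ := by simpa using hx
      exact (norm_cos_sub_one_le x).trans (by gcongr))
    (convex_closedBall _ _) (by simp) (by simp)
  simpa [sq, mul_assoc] using this

/-- The kernel of the Mehler–Dirichlet integral at `mehlerAngle z`, measured from the endpoint
`p = 0`, where the integrand is largest. -/
noncomputable def laplaceKernel (t : ℝ) (z : ℂ) (p : ℝ) : ℂ :=
  Complex.exp (-(2 * t * mehlerAngle z) * p) * (mehlerAngle z *
    (Complex.sin (mehlerAngle z * p) ^ (-1 / 2 : ℂ) *
      Complex.sin (mehlerAngle z * (1 - p)) ^ (-1 / 2 : ℂ)))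

/-- The leading term of `laplaceKernel` at `p = 0`. -/
noncomputable def laplaceModel (t : ℝ) (z : ℂ) (p : ℝ) : ℂ :=
  Complex.exp (-(2 * t * mehlerAngle z) * p) * (mehlerAngle z *
    ((mehlerAngle z * p) ^ (-1 / 2 : ℂ) * Complex.sin (mehlerAngle z) ^ (-1 / 2 : ℂ)))

theorem mehlerIntegrand_mehlerAngle (t : ℝ) (z : ℂ) (p : ℝ) :
    Complex.exp (-(Real.pi * t)) * mehlerIntegrand t (mehlerAngle z) p =
      Complex.exp (-(2 * t * cArcsin z)) * laplaceKernel t z p := by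
  have : Complex.exp (-(Real.pi * t)) * Complex.exp (t * mehlerAngle z * (1 - 2 * p)) =
      Complex.exp (-(2 * t * cArcsin z)) * Complex.exp (-(2 * t * mehlerAngle z) * p) := by
    rw [← Complex.exp_add, ← Complex.exp_add]
    congr 1
    rw [mehlerAngle]
    ring
  rw [mehlerIntegrand, laplaceKernel]
  linear_combination (mehlerAngle z * (Complex.sin (mehlerAngle z * p) ^ (-1 / 2 : ℂ) *
      Complex.sin (mehlerAngle z * (1 - p)) ^ (-1 / 2 : ℂ))) * this

theorem norm_exp_mehlerAngle_le {t : ℝ} (ht : 0 ≤ t) {z : ℂ} (hz : ‖z‖ ≤ 1 / 4) {p : ℝ}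
    (hp : 0 ≤ p) :
    ‖Complex.exp (-(2 * t * mehlerAngle z) * p)‖ ≤ Real.exp (-(4 * t * p)) := by
  rw [Complex.norm_exp, Complex.re_mul_ofReal]
  refine Real.exp_le_exp.2 ?_
  have : (-(2 * (t : ℂ) * mehlerAngle z)).re = -(2 * t * (mehlerAngle z).re) := by
    simp
  rw [this]
  nlinarith [two_le_mehlerAngle_re hz, mul_nonneg ht hp,
    mul_nonneg (mul_nonneg ht hp) (sub_nonneg.2 (two_le_mehlerAngle_re hz))]

theorem rpow_neg_half_eq {p : ℝ} (hp : 0 < p) : p ^ (-1 / 2 : ℝ) = p⁻¹ * p ^ (1 / 2 : ℝ) := by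
  rw [← Real.rpow_neg_one, ← Real.rpow_add hp]; norm_num

theorem half_rpow_neg_half_le {x : ℝ} (hx : 0 < x) :
    (x / 2) ^ (-1 / 2 : ℝ) ≤ 2 * x ^ (-1 / 2 : ℝ) := by
  rw [Real.div_rpow hx.le two_pos.le, div_eq_mul_inv, mul_comm, ← Real.rpow_neg two_pos.le]
  gcongr
  calc (2 : ℝ) ^ (-(-1 / 2) : ℝ) ≤ 2 ^ (1 : ℝ) :=
        Real.rpow_le_rpow_of_exponent_le one_le_two (by norm_num)
    _ = 2 := Real.rpow_one 2

/-- Near `p = 0` the kernel differs from its leading term by a relative error of order `p / ‖z‖`. -/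
theorem norm_laplaceKernel_sub_model_le {t : ℝ} (ht : 0 ≤ t) {z : ℂ} (h0 : 0 < z.re)
    (hz : ‖z‖ ≤ 1 / 4) {p : ℝ} (hp0 : 0 < p) (hp : p ≤ 1 / 2) :
    ‖laplaceKernel t z p - laplaceModel t z p‖ ≤
      350 * Real.exp 5 * ‖z‖ ^ (-3 / 2 : ℝ) * (p ^ (1 / 2 : ℝ) * Real.exp (-(4 * t * p))) := by
  have hzp : 0 < ‖z‖ := h0.trans_le (Complex.re_le_norm z)
  have t2 := two_le_mehlerAngle_re hz
  have tpi := mehlerAngle_re_lt h0 hz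
  have tn := norm_mehlerAngle_le hz
  have hexp := norm_exp_mehlerAngle_le ht hz hp0.le
  have hX := le_re_sin_mehlerAngle_mul h0 hz hp0.le hp
  have hZ := norm_sin_mehlerAngle_mul_ge h0 hz (q := 1 - p) (by linarith) (by linarith)
  have hZre := re_sin_pos (θ := mehlerAngle z) (by linarith) tpi (p := 1 - p) (by linarith)
    (by linarith)
  have hZ0 := norm_sin_mehlerAngle_mul_ge h0 hz (q := 1) (by norm_num) le_rfl
  have hZ0re := re_sin_pos (θ := mehlerAngle z) (by linarith) tpi (p := 1) (by linarith) le_rfl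
  simp only [Complex.ofReal_one, mul_one, Complex.ofReal_sub] at hZ hZre hZ0 hZ0re
  set θ := mehlerAngle z with hθ
  set X := Complex.sin (θ * p)
  set Z := Complex.sin (θ * (1 - p))
  set Z₀ := Complex.sin θ
  have hθ2 : 2 ≤ ‖θ‖ := t2.trans (Complex.re_le_norm _)
  have hX0re : 0 < (θ * p).re := by rw [Complex.re_mul_ofReal]; positivity
  have hX0n : ‖θ * p‖ = ‖θ‖ * p := by
    rw [norm_mul, Complex.norm_real, Real.norm_of_nonneg hp0.le]
  have hX0p : p ≤ ‖θ * p‖ := by rw [hX0n]; nlinarith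
  have hXn : p ≤ ‖X‖ := hX.trans (Complex.re_le_norm _)
  -- the two factors are compared one at a time
  have d1 : ‖(θ * p) ^ (-1 / 2 : ℂ) - X ^ (-1 / 2 : ℂ)‖ ≤ 25 * Real.exp 5 * p ^ (1 / 2 : ℝ) := by
    refine (norm_cpow_neg_half_sub_le hX0re (hp0.trans_le hX)).trans ?_
    have e1 : ‖θ * p - X‖ ≤ Real.exp 5 * 25 * p ^ 2 := by
      rw [norm_sub_rev]
      refine (norm_sin_sub_self_le _).trans ?_
      rw [hX0n]
      calc Real.exp (‖θ‖ * p) * (‖θ‖ * p) ^ 2 ≤ Real.exp 5 * (5 * p) ^ 2 := by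
            gcongr; nlinarith
        _ = _ := by ring
    have e2 : ‖θ * p‖⁻¹ ≤ p⁻¹ := by gcongr
    have e3 : ‖X‖ ^ (-1 / 2 : ℝ) ≤ p ^ (-1 / 2 : ℝ) :=
      Real.rpow_le_rpow_of_nonpos hp0 hXn (by norm_num)
    calc _ ≤ (Real.exp 5 * 25 * p ^ 2) * p⁻¹ * p ^ (-1 / 2 : ℝ) := by gcongr
      _ = _ := by rw [rpow_neg_half_eq hp0]; field_simp
  have d2 : ‖Z - Z₀‖ ≤ Real.exp 5 * 5 * p := by
    have e1 : ‖θ * (1 - p)‖ ≤ 5 := by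
      rw [norm_mul, show (1 - p : ℂ) = ((1 - p : ℝ) : ℂ) by push_cast; rfl, Complex.norm_real,
        Real.norm_of_nonneg (by linarith)]
      nlinarith [norm_nonneg θ]
    refine (norm_sin_sub_sin_le e1 tn).trans ?_
    rw [show θ * (1 - p) - θ = -(θ * p) by ring, norm_neg, hX0n, mul_assoc]
    gcongr
  have hhalf := half_rpow_neg_half_le hzp
  have d3 : ‖Z ^ (-1 / 2 : ℂ)‖ ≤ 2 * ‖z‖ ^ (-1 / 2 : ℝ) :=
    (norm_cpow_neg_half_le (half_pos hzp) hZ).trans hhalf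
  have hz32 : ‖z‖⁻¹ * ‖z‖ ^ (-1 / 2 : ℝ) = ‖z‖ ^ (-3 / 2 : ℝ) := by
    rw [← Real.rpow_neg_one, ← Real.rpow_add hzp]; norm_num
  have hzle : ‖z‖ ^ (-1 / 2 : ℝ) ≤ ‖z‖ ^ (-3 / 2 : ℝ) :=
    Real.rpow_le_rpow_of_exponent_ge hzp (by linarith) (by norm_num)
  have d4 : ‖Z ^ (-1 / 2 : ℂ) - Z₀ ^ (-1 / 2 : ℂ)‖ ≤ Real.exp 5 * 20 * p * ‖z‖ ^ (-3 / 2 : ℝ) := by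
    refine (norm_cpow_neg_half_sub_le hZre hZ0re).trans ?_
    have e2 : ‖Z‖⁻¹ ≤ 2 * ‖z‖⁻¹ := by
      calc ‖Z‖⁻¹ ≤ (‖z‖ / 2)⁻¹ := by gcongr
        _ = _ := by field_simp
    have e3 : ‖Z₀‖ ^ (-1 / 2 : ℝ) ≤ 2 * ‖z‖ ^ (-1 / 2 : ℝ) :=
      (Real.rpow_le_rpow_of_nonpos (half_pos hzp) hZ0 (by norm_num)).trans hhalf
    calc _ ≤ (Real.exp 5 * 5 * p) * (2 * ‖z‖⁻¹) * (2 * ‖z‖ ^ (-1 / 2 : ℝ)) := by gcongr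
      _ = _ := by rw [← hz32]; ring
  have d5 : ‖(θ * p) ^ (-1 / 2 : ℂ)‖ ≤ p⁻¹ * p ^ (1 / 2 : ℝ) := by
    rw [← rpow_neg_half_eq hp0]
    exact norm_cpow_neg_half_le hp0 hX0p
  have hid : laplaceKernel t z p - laplaceModel t z p =
      Complex.exp (-(2 * t * θ) * p) * (θ *
        ((θ * p) ^ (-1 / 2 : ℂ) * (Z ^ (-1 / 2 : ℂ) - Z₀ ^ (-1 / 2 : ℂ)) -
          ((θ * p) ^ (-1 / 2 : ℂ) - X ^ (-1 / 2 : ℂ)) * Z ^ (-1 / 2 : ℂ))) := by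
    rw [laplaceKernel, laplaceModel]
    ring
  rw [hid, norm_mul, norm_mul]
  have d6 : ‖(θ * p) ^ (-1 / 2 : ℂ) * (Z ^ (-1 / 2 : ℂ) - Z₀ ^ (-1 / 2 : ℂ)) -
      ((θ * p) ^ (-1 / 2 : ℂ) - X ^ (-1 / 2 : ℂ)) * Z ^ (-1 / 2 : ℂ)‖ ≤
      (p⁻¹ * p ^ (1 / 2 : ℝ)) * (Real.exp 5 * 20 * p * ‖z‖ ^ (-3 / 2 : ℝ)) +
        (25 * Real.exp 5 * p ^ (1 / 2 : ℝ)) * (2 * ‖z‖ ^ (-3 / 2 : ℝ)) := by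
    refine (norm_sub_le _ _).trans (add_le_add ?_ ?_)
    · rw [norm_mul]; gcongr
    · rw [norm_mul]; gcongr; exact d3.trans (by gcongr)
  calc _ ≤ Real.exp (-(4 * t * p)) * (5 *
        ((p⁻¹ * p ^ (1 / 2 : ℝ)) * (Real.exp 5 * 20 * p * ‖z‖ ^ (-3 / 2 : ℝ)) +
        (25 * Real.exp 5 * p ^ (1 / 2 : ℝ)) * (2 * ‖z‖ ^ (-3 / 2 : ℝ)))) := by gcongr
    _ = _ := by field_simp; ring

theorem norm_laplaceKernel_le {t : ℝ} (ht : 0 ≤ t) {z : ℂ} (h0 : 0 < z.re)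
    (hz : ‖z‖ ≤ 1 / 4) {p : ℝ} (hp0 : 1 / 2 < p) (hp : p < 1) :
    ‖laplaceKernel t z p‖ ≤
      10 * ‖z‖ ^ (-3 / 2 : ℝ) * (Real.exp (-(2 * t)) * (1 - p) ^ (-1 / 2 : ℝ)) := by
  have hzp : 0 < ‖z‖ := h0.trans_le (Complex.re_le_norm z)
  have tn := norm_mehlerAngle_le hz
  have hexp := norm_exp_mehlerAngle_le ht hz (p := p) (by linarith)
  have hX := norm_sin_mehlerAngle_mul_ge h0 hz hp0.le hp.le
  have hZ := (le_re_sin_mehlerAngle_mul h0 hz (p := 1 - p) (by linarith) (by linarith)).trans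
    (Complex.re_le_norm _)
  push_cast at hZ
  have hhalf : (‖z‖ / 2) ^ (-1 / 2 : ℝ) ≤ 2 * ‖z‖ ^ (-3 / 2 : ℝ) :=
    (half_rpow_neg_half_le hzp).trans (mul_le_mul_of_nonneg_left
      (Real.rpow_le_rpow_of_exponent_ge hzp (by linarith) (by norm_num)) two_pos.le)
  have d1 := (norm_cpow_neg_half_le (half_pos hzp) hX).trans hhalf
  have d2 := norm_cpow_neg_half_le (by linarith : 0 < 1 - p) hZ
  have d3 : Real.exp (-(4 * t * p)) ≤ Real.exp (-(2 * t)) := Real.exp_le_exp.2 (by nlinarith)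
  rw [laplaceKernel, norm_mul, norm_mul, norm_mul]
  calc _ ≤ Real.exp (-(2 * t)) * (5 * ((2 * ‖z‖ ^ (-3 / 2 : ℝ)) * (1 - p) ^ (-1 / 2 : ℝ))) := by
        gcongr
        exact hexp.trans d3
    _ = _ := by ring

theorem norm_laplaceModel_le {t : ℝ} (ht : 0 ≤ t) {z : ℂ} (h0 : 0 < z.re)
    (hz : ‖z‖ ≤ 1 / 4) {p : ℝ} (hp : 1 / 2 ≤ p) :
    ‖laplaceModel t z p‖ ≤
      20 * ‖z‖ ^ (-3 / 2 : ℝ) * (p ^ (1 / 2 : ℝ) * Real.exp (-(4 * t * p))) := by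
  have hzp : 0 < ‖z‖ := h0.trans_le (Complex.re_le_norm z)
  have hp0 : 0 < p := by linarith
  have tn := norm_mehlerAngle_le hz
  have hexp := norm_exp_mehlerAngle_le ht hz hp0.le
  have hZ0 := norm_sin_mehlerAngle_mul_ge h0 hz (q := 1) (by norm_num) le_rfl
  simp only [Complex.ofReal_one, mul_one] at hZ0
  have hθ2 : 2 ≤ ‖mehlerAngle z‖ := (two_le_mehlerAngle_re hz).trans (Complex.re_le_norm _)
  have hX0p : p ≤ ‖mehlerAngle z * p‖ := by
    rw [norm_mul, Complex.norm_real, Real.norm_of_nonneg hp0.le]; nlinarith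
  have hhalf : (‖z‖ / 2) ^ (-1 / 2 : ℝ) ≤ 2 * ‖z‖ ^ (-3 / 2 : ℝ) :=
    (half_rpow_neg_half_le hzp).trans (mul_le_mul_of_nonneg_left
      (Real.rpow_le_rpow_of_exponent_ge hzp (by linarith) (by norm_num)) two_pos.le)
  have d1 := (norm_cpow_neg_half_le (half_pos hzp) hZ0).trans hhalf
  have d2 : ‖(mehlerAngle z * p) ^ (-1 / 2 : ℂ)‖ ≤ 2 * p ^ (1 / 2 : ℝ) := by
    refine (norm_cpow_neg_half_le hp0 hX0p).trans ?_
    rw [rpow_neg_half_eq hp0]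
    gcongr
    rw [inv_le_comm₀ hp0 two_pos]
    linarith
  rw [laplaceModel, norm_mul, norm_mul, norm_mul]
  calc _ ≤ Real.exp (-(4 * t * p)) * (5 * ((2 * p ^ (1 / 2 : ℝ)) * (2 * ‖z‖ ^ (-3 / 2 : ℝ)))) := by
        gcongr
    _ = _ := by ring

/-! ### Laplace asymptotics of the block -/

theorem integral_rpow_neg_half_mul_cexp {b : ℂ} (hb : 0 < b.re) :
    ∫ p in Set.Ioi (0 : ℝ), (p : ℂ) ^ (-1 / 2 : ℂ) * Complex.exp (-b * p) =
      (Real.pi / b) ^ (1 / 2 : ℂ) := by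
  have h := integral_comp_rpow_Ioi
    (fun p : ℝ => (p : ℂ) ^ (-1 / 2 : ℂ) * Complex.exp (-b * p)) (two_ne_zero (α := ℝ))
  rw [← h]
  have h2 := integral_gaussian_complex_Ioi hb
  have h3 : ∀ x ∈ Set.Ioi (0 : ℝ), (|(2 : ℝ)| * x ^ ((2 : ℝ) - 1)) •
      (((x ^ (2 : ℝ) : ℝ) : ℂ) ^ (-1 / 2 : ℂ) * Complex.exp (-b * ((x ^ (2 : ℝ) : ℝ) : ℂ))) =
      2 * Complex.exp (-b * (x : ℂ) ^ 2) := by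
    intro x hx
    have hx0 : 0 < x := hx
    have e1 : ((x ^ (2 : ℝ) : ℝ) : ℂ) ^ (-1 / 2 : ℂ) = (x : ℂ)⁻¹ := by
      rw [show (-1 / 2 : ℂ) = ((-1 / 2 : ℝ) : ℂ) by push_cast; rfl,
        ← Complex.ofReal_cpow (by positivity), ← Real.rpow_mul hx0.le,
        show (2 : ℝ) * (-1 / 2) = -1 by norm_num, Real.rpow_neg_one, Complex.ofReal_inv]
    have hxc : (x : ℂ) ≠ 0 := by exact_mod_cast hx0.ne'
    rw [e1, abs_of_pos two_pos, show (2 : ℝ) - 1 = 1 by norm_num, Real.rpow_one,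
      Real.rpow_two, Complex.real_smul]
    push_cast
    field_simp
  rw [setIntegral_congr_fun measurableSet_Ioi h3, integral_const_mul, h2]
  ring

theorem integrableOn_rpow_half_mul_exp {t : ℝ} (ht : 0 < t) :
    IntegrableOn (fun p : ℝ => p ^ (1 / 2 : ℝ) * Real.exp (-(4 * t * p))) (Set.Ioi 0) := by
  have := integrableOn_rpow_mul_exp_neg_mul_rpow (p := 1) (s := 1 / 2) (b := 4 * t) (by norm_num)
    one_pos (by positivity)
  refine this.congr_fun (fun p _ => ?_) measurableSet_Ioi
  simp

theorem integral_rpow_half_mul_exp_le {t : ℝ} (ht : 0 < t) :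
    ∫ p in Set.Ioi (0 : ℝ), p ^ (1 / 2 : ℝ) * Real.exp (-(4 * t * p)) ≤
      Real.Gamma (3 / 2) * t ^ (-3 / 2 : ℝ) := by
  have := Real.integral_rpow_mul_exp_neg_mul_Ioi (a := 3 / 2) (r := 4 * t) (by norm_num)
    (by positivity)
  rw [show (3 / 2 - 1 : ℝ) = 1 / 2 by norm_num] at this
  rw [this, mul_comm]
  refine mul_le_mul_of_nonneg_left ?_ (Real.Gamma_nonneg_of_nonneg (by norm_num))
  rw [one_div, Real.inv_rpow (by positivity), ← Real.rpow_neg (by positivity), ← neg_div]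
  exact Real.rpow_le_rpow_of_nonpos ht (by linarith) (by norm_num)

theorem integral_laplaceModel {t : ℝ} (ht : 0 < t) {z : ℂ} (hz : ‖z‖ ≤ 1 / 4) :
    ∫ p in Set.Ioi (0 : ℝ), laplaceModel t z p =
      Complex.sin (mehlerAngle z) ^ (-1 / 2 : ℂ) * (√(Real.pi / (2 * t)) : ℝ) := by
  have t2 := two_le_mehlerAngle_re hz
  set θ := mehlerAngle z with hθ
  have hre : 0 < θ.re := by linarith
  have hθ0 : θ ≠ 0 := fun h => by simp [h] at hre
  have h1 : ∀ p ∈ Set.Ioi (0 : ℝ), laplaceModel t z p =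
      (θ * θ ^ (-1 / 2 : ℂ) * Complex.sin θ ^ (-1 / 2 : ℂ)) *
        ((p : ℂ) ^ (-1 / 2 : ℂ) * Complex.exp (-(2 * t * θ) * p)) := by
    intro p hp
    rw [laplaceModel, ← hθ, mul_cpow_of_re_pos hre (by simpa using hp)]
    ring
  have hb : 0 < (2 * (t : ℂ) * θ).re := by
    rw [show 2 * (t : ℂ) * θ = ((2 * t : ℝ) : ℂ) * θ by push_cast; ring, Complex.re_ofReal_mul]
    positivity
  rw [setIntegral_congr_fun measurableSet_Ioi h1, integral_const_mul,
    integral_rpow_neg_half_mul_cexp hb]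
  have h2 : (Real.pi : ℂ) / (2 * t * θ) = ((Real.pi / (2 * t) : ℝ) : ℂ) * θ⁻¹ := by
    push_cast
    field_simp
  have h3 : 0 < (θ⁻¹).re := by
    rw [Complex.inv_re]
    exact div_pos hre (Complex.normSq_pos.2 hθ0)
  have harg : θ.arg ≠ Real.pi := fun h => by
    have := Complex.abs_arg_lt_pi_div_two_iff.2 (Or.inl hre)
    rw [h, abs_of_pos Real.pi_pos] at this
    linarith [Real.pi_pos]
  have hpos : 0 < Real.pi / (2 * t) := div_pos Real.pi_pos (by positivity)
  rw [h2, mul_cpow_of_re_pos (by rwa [Complex.ofReal_re]) h3, Complex.inv_cpow _ _ harg,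
    ← Complex.cpow_neg, Real.sqrt_eq_rpow, Complex.ofReal_cpow hpos.le]
  have h4 : θ * θ ^ (-1 / 2 : ℂ) * θ ^ (-(1 / 2) : ℂ) = 1 := by
    nth_rewrite 1 [← Complex.cpow_one θ]
    rw [← Complex.cpow_add _ _ hθ0, ← Complex.cpow_add _ _ hθ0]
    norm_num
  push_cast
  linear_combination (Complex.sin θ ^ (-1 / 2 : ℂ) * ((Real.pi : ℂ) / (2 * t)) ^ (1 / 2 : ℂ)) * h4

theorem integrableOn_one_sub_rpow :
    IntegrableOn (fun p : ℝ => (1 - p) ^ (-1 / 2 : ℝ)) (Set.Ioo (1 / 2) 1) := by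
  have h := integrableOn_rpow_neg_half_mul.mono_set
    (Set.Ioo_subset_Ioo_left (by norm_num) : Set.Ioo (1 / 2 : ℝ) 1 ⊆ Set.Ioo 0 1)
  refine Integrable.mono' h
    ((measurable_const.sub measurable_id).pow_const _).aestronglyMeasurable ?_
  filter_upwards [ae_restrict_mem measurableSet_Ioo] with p hp
  have hp0 : 0 < p := by linarith [hp.1]
  have h1 : 0 ≤ (1 - p) ^ (-1 / 2 : ℝ) := Real.rpow_nonneg (by linarith [hp.2]) _
  rw [Real.norm_of_nonneg h1]
  exact le_mul_of_one_le_left h1 (Real.one_le_rpow_of_pos_of_le_one_of_nonpos hp0 hp.2.le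
    (by norm_num))

theorem continuousOn_laplaceKernel (t : ℝ) {z : ℂ} (h0 : 0 < z.re) (hz : ‖z‖ ≤ 1 / 4) :
    ContinuousOn (laplaceKernel t z) (Set.Ioo 0 1) := by
  have t2 := two_le_mehlerAngle_re hz
  have tpi := mehlerAngle_re_lt h0 hz
  intro p hp
  have a1 := re_sin_pos (θ := mehlerAngle z) (by linarith) tpi hp.1 hp.2.le
  have a2 := re_sin_pos (θ := mehlerAngle z) (by linarith) tpi (p := 1 - p) (by linarith [hp.2])
    (by linarith [hp.1])
  push_cast at a2
  unfold laplaceKernel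
  refine ContinuousAt.continuousWithinAt (ContinuousAt.mul (by fun_prop) (ContinuousAt.mul
    (by fun_prop) (ContinuousAt.mul ?_ ?_)))
  · exact ContinuousAt.cpow (by fun_prop) (by fun_prop) (Or.inl a1)
  · exact ContinuousAt.cpow (by fun_prop) (by fun_prop) (Or.inl a2)

theorem continuousOn_laplaceModel (t : ℝ) {z : ℂ} (hz : ‖z‖ ≤ 1 / 4) :
    ContinuousOn (laplaceModel t z) (Set.Ioi 0) := by
  have t2 := two_le_mehlerAngle_re hz
  intro p hp
  have a1 : 0 < (mehlerAngle z * p).re := by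
    rw [Complex.re_mul_ofReal]
    exact mul_pos (by linarith) hp
  unfold laplaceModel
  refine ContinuousAt.continuousWithinAt (ContinuousAt.mul (by fun_prop) (ContinuousAt.mul
    (by fun_prop) (ContinuousAt.mul ?_ (by fun_prop))))
  exact ContinuousAt.cpow (by fun_prop) (by fun_prop) (Or.inl a1)

theorem integrableOn_laplaceModel {t : ℝ} (ht : 0 < t) {z : ℂ} (hz : ‖z‖ ≤ 1 / 4) :
    IntegrableOn (laplaceModel t z) (Set.Ioi 0) := by
  have t2 := two_le_mehlerAngle_re hz
  have hint := integrableOn_rpow_mul_exp_neg_mul_rpow (p := 1) (s := -1 / 2) (b := 4 * t)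
    (by norm_num) one_pos (by positivity)
  refine Integrable.mono' (hint.const_mul (‖mehlerAngle z‖ *
    ‖Complex.sin (mehlerAngle z) ^ (-1 / 2 : ℂ)‖))
    ((continuousOn_laplaceModel t hz).aestronglyMeasurable measurableSet_Ioi) ?_
  filter_upwards [ae_restrict_mem measurableSet_Ioi] with p hp
  have hp0 : 0 < p := hp
  have hX0p : p ≤ ‖mehlerAngle z * p‖ := by
    rw [norm_mul, Complex.norm_real, Real.norm_of_nonneg hp0.le]
    nlinarith [Complex.re_le_norm (mehlerAngle z)]
  have e1 := norm_cpow_neg_half_le hp0 hX0p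
  have e2 := norm_exp_mehlerAngle_le ht.le hz hp0.le
  rw [laplaceModel, norm_mul, norm_mul, norm_mul, Real.rpow_one]
  calc _ ≤ Real.exp (-(4 * t * p)) * (‖mehlerAngle z‖ * (p ^ (-1 / 2 : ℝ) *
        ‖Complex.sin (mehlerAngle z) ^ (-1 / 2 : ℂ)‖)) := by gcongr
    _ = _ := by rw [neg_mul]; ring

theorem exp_neg_two_mul_le {t : ℝ} (ht : 1 < t) : Real.exp (-(2 * t)) ≤ t ^ (-3 / 2 : ℝ) := by
  have h0 : 0 < t := by linarith
  have h1 : t ^ 2 ≤ Real.exp (2 * t) := by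
    rw [two_mul, Real.exp_add, sq]
    have := Real.add_one_le_exp t
    exact mul_le_mul (by linarith) (by linarith) h0.le (Real.exp_pos _).le
  rw [Real.exp_neg, show (-3 / 2 : ℝ) = -(3 / 2) by norm_num, Real.rpow_neg h0.le]
  have h2 : t ^ (3 / 2 : ℝ) ≤ t ^ (2 : ℝ) :=
    Real.rpow_le_rpow_of_exponent_le ht.le (by norm_num)
  rw [Real.rpow_two] at h2
  have h3 : 0 < t ^ (3 / 2 : ℝ) := by positivity
  gcongr
  exact h2.trans h1

/-- Watson's lemma for the Mehler–Dirichlet integral: the kernel is replaced by its leading term at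
`p = 0`. The error is uniform in `z`, the point `z = 0` being the logarithmic singularity of the
hypergeometric function. -/
theorem exists_norm_integral_laplaceKernel_sub_le : ∃ C > 0, ∀ t : ℝ, 1 < t → ∀ z : ℂ, 0 < z.re →
    ‖z‖ ≤ 1 / 4 →
    ‖(∫ p in Set.Ioo (0 : ℝ) 1, laplaceKernel t z p) -
      Complex.sin (mehlerAngle z) ^ (-1 / 2 : ℂ) * (√(Real.pi / (2 * t)) : ℝ)‖ ≤
      C * ‖z‖ ^ (-3 / 2 : ℝ) * t ^ (-3 / 2 : ℝ) := by
  set c := ∫ p in Set.Ioo (1 / 2 : ℝ) 1, (1 - p) ^ (-1 / 2 : ℝ) with hc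
  have hc0 : 0 ≤ c := setIntegral_nonneg measurableSet_Ioo fun p hp =>
    Real.rpow_nonneg (by linarith [hp.2]) _
  have hG : 0 < Real.Gamma (3 / 2) := Real.Gamma_pos_of_pos (by norm_num)
  set K := 350 * Real.exp 5 with hK
  have hK20 : 20 ≤ K := by
    rw [hK]; nlinarith [Real.add_one_le_exp 5]
  refine ⟨K * (Real.Gamma (3 / 2) + c), by positivity, fun t ht z h0 hz => ?_⟩
  have ht0 : 0 < t := by linarith
  have hzp : 0 < ‖z‖ := h0.trans_le (Complex.re_le_norm z)
  set b : ℝ → ℝ := fun p => K * ‖z‖ ^ (-3 / 2 : ℝ) * (p ^ (1 / 2 : ℝ) * Real.exp (-(4 * t * p)) +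
    (Set.Ioo (1 / 2 : ℝ) 1).indicator (fun p => Real.exp (-(2 * t)) * (1 - p) ^ (-1 / 2 : ℝ)) p)
    with hb
  have hind : IntegrableOn ((Set.Ioo (1 / 2 : ℝ) 1).indicator
      (fun p => Real.exp (-(2 * t)) * (1 - p) ^ (-1 / 2 : ℝ))) (Set.Ioi 0) :=
    ((integrable_indicator_iff measurableSet_Ioo).2
      (integrableOn_one_sub_rpow.const_mul _)).integrableOn
  have hbi : IntegrableOn b (Set.Ioi 0) :=
    ((integrableOn_rpow_half_mul_exp ht0).add hind).const_mul _
  set k := (Set.Ioo (0 : ℝ) 1).indicator (laplaceKernel t z) with hk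
  have hbound : ∀ p ∈ Set.Ioi (0 : ℝ), ‖k p - laplaceModel t z p‖ ≤ b p := by
    intro p hp
    have hp0 : 0 < p := hp
    have hpos1 : 0 ≤ p ^ (1 / 2 : ℝ) * Real.exp (-(4 * t * p)) := by positivity
    have hz32 : 0 ≤ ‖z‖ ^ (-3 / 2 : ℝ) := by positivity
    rcases le_or_gt p (1 / 2) with h | h
    · have hkp : k p = laplaceKernel t z p :=
        Set.indicator_of_mem (Set.mem_Ioo.2 ⟨hp0, by linarith⟩) _
      rw [hkp, hb]
      simp only [Set.indicator_of_notMem (fun hh : p ∈ Set.Ioo (1 / 2 : ℝ) 1 =>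
        absurd hh.1 (not_lt.2 h)), add_zero]
      exact norm_laplaceKernel_sub_model_le ht0.le h0 hz hp0 h
    · have hm := norm_laplaceModel_le ht0.le h0 hz h.le
      rcases lt_or_ge p 1 with h1 | h1
      · have hkp : k p = laplaceKernel t z p :=
          Set.indicator_of_mem (Set.mem_Ioo.2 ⟨hp0, h1⟩) _
        have hkb := norm_laplaceKernel_le ht0.le h0 hz h h1
        rw [hkp, hb]
        simp only [Set.indicator_of_mem (Set.mem_Ioo.2 ⟨h, h1⟩)]
        have hpos2 : 0 ≤ Real.exp (-(2 * t)) * (1 - p) ^ (-1 / 2 : ℝ) :=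
          mul_nonneg (Real.exp_pos _).le (Real.rpow_nonneg (by linarith) _)
        refine (norm_sub_le _ _).trans ((add_le_add hkb hm).trans ?_)
        rw [mul_add, add_comm]
        gcongr
        linarith
      · have hkp : k p = 0 :=
          Set.indicator_of_notMem (fun hh : p ∈ Set.Ioo (0 : ℝ) 1 => absurd hh.2 (not_lt.2 h1)) _
        rw [hkp, zero_sub, norm_neg, hb]
        simp only [Set.indicator_of_notMem (fun hh : p ∈ Set.Ioo (1 / 2 : ℝ) 1 =>
          absurd hh.2 (not_lt.2 h1)), add_zero]
        refine hm.trans ?_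
        gcongr
  have hmodel := integrableOn_laplaceModel ht0 hz
  have hkint : ∫ p in Set.Ioi (0 : ℝ), k p = ∫ p in Set.Ioo (0 : ℝ) 1, laplaceKernel t z p := by
    rw [hk, setIntegral_indicator measurableSet_Ioo, Set.inter_eq_right.2 Set.Ioo_subset_Ioi_self]
  have hkmeas : AEStronglyMeasurable k (volume.restrict (Set.Ioi 0)) :=
    ((aestronglyMeasurable_indicator_iff measurableSet_Ioo).2
      ((continuousOn_laplaceKernel t h0 hz).aestronglyMeasurable measurableSet_Ioo)).restrict
  have hdiff : IntegrableOn (fun p => k p - laplaceModel t z p) (Set.Ioi 0) := by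
    refine Integrable.mono' hbi (hkmeas.sub hmodel.aestronglyMeasurable) ?_
    filter_upwards [ae_restrict_mem measurableSet_Ioi] with p hp using hbound p hp
  have hki : IntegrableOn k (Set.Ioi 0) := by
    refine (hdiff.add hmodel).congr_fun (fun p _ => ?_) measurableSet_Ioi
    simp
  rw [← integral_laplaceModel ht0 hz, ← hkint, ← integral_sub hki hmodel]
  refine (norm_integral_le_of_norm_le hbi ?_).trans ?_
  · filter_upwards [ae_restrict_mem measurableSet_Ioi] with p hp using hbound p hp
  · rw [hb, integral_const_mul, integral_add (integrableOn_rpow_half_mul_exp ht0) hind,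
      setIntegral_indicator measurableSet_Ioo,
      Set.inter_eq_right.2 (fun x hx => by
        have : (1 / 2 : ℝ) < x := hx.1
        exact Set.mem_Ioi.2 (by linarith)), integral_const_mul, ← hc]
    have e1 := integral_rpow_half_mul_exp_le ht0
    have e2 := exp_neg_two_mul_le ht
    calc _ ≤ K * ‖z‖ ^ (-3 / 2 : ℝ) *
          (Real.Gamma (3 / 2) * t ^ (-3 / 2 : ℝ) + t ^ (-3 / 2 : ℝ) * c) := by gcongr
      _ = _ := by ring

/-- The normalized block is `e ^ (-2 t arcsin z)` up to a factor, with an error that is small once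
`t ‖z‖` is large. -/
theorem exists_norm_blockH_sub_le : ∃ C > 0, ∀ t : ℝ, 1 < t → ∀ z : ℂ, 0 < z.re → ‖z‖ ≤ 1 / 4 →
    ‖z ^ (1 / 2 : ℂ) * (Complex.exp (-(Real.pi * t)) *
        blockH (1 / 2 + t * Complex.I) (1 - z ^ 2)) -
      ((2 * √(Real.pi * t))⁻¹ : ℝ) * (Complex.exp (-(2 * t * cArcsin z)) *
        sqrtOneSubSq z ^ (-1 / 2 : ℂ))‖ ≤
      C * (√t)⁻¹ * Real.exp (-(2 * t * (cArcsin z).re)) * (t * ‖z‖)⁻¹ := by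
  obtain ⟨C, hC, h⟩ := exists_norm_integral_laplaceKernel_sub_le
  refine ⟨C, hC, fun t ht z h0 hz => ?_⟩
  have ht0 : 0 < t := by linarith
  have hzp : 0 < ‖z‖ := h0.trans_le (Complex.re_le_norm z)
  have hz0 : z ≠ 0 := norm_pos_iff.1 hzp
  have hpi : (Real.pi : ℂ) ≠ 0 := by exact_mod_cast Real.pi_ne_zero
  have t2 := two_le_mehlerAngle_re hz
  have tpi := mehlerAngle_re_lt h0 hz
  have hS : 0 < (sqrtOneSubSq z).re := by linarith [re_sqrtOneSubSq_ge (z := z) (by linarith)]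
  have hH := blockH_sin_sq ht0.ne' (θ := mehlerAngle z) (by linarith) tpi
  rw [sin_half_mehlerAngle_sq hz] at hH
  have hH2 : Complex.exp (-(Real.pi * t)) * blockH (1 / 2 + t * Complex.I) (1 - z ^ 2) =
      (Real.pi : ℂ)⁻¹ * (Complex.exp (-(2 * t * cArcsin z)) *
        ∫ p in Set.Ioo (0 : ℝ) 1, laplaceKernel t z p) := by
    rw [hH, mul_left_comm, ← integral_const_mul]
    simp_rw [mehlerIntegrand_mehlerAngle]
    rw [integral_const_mul]
  have hmain : z ^ (1 / 2 : ℂ) * ((Real.pi : ℂ)⁻¹ *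
      (Complex.sin (mehlerAngle z) ^ (-1 / 2 : ℂ) * (√(Real.pi / (2 * t)) : ℝ))) =
      ((2 * √(Real.pi * t))⁻¹ : ℝ) * sqrtOneSubSq z ^ (-1 / 2 : ℂ) := by
    have e0 : 0 < (2 * sqrtOneSubSq z).re := by
      rw [show (2 : ℂ) = ((2 : ℝ) : ℂ) by norm_num, Complex.re_ofReal_mul]; positivity
    have e1 : z ^ (1 / 2 : ℂ) * z ^ (-1 / 2 : ℂ) = 1 := by
      rw [← Complex.cpow_add _ _ hz0]; norm_num
    have e2 : (2 : ℂ) ^ (-1 / 2 : ℂ) = ((√2)⁻¹ : ℝ) := by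
      rw [Real.sqrt_eq_rpow, ← Real.rpow_neg two_pos.le, Complex.ofReal_cpow two_pos.le]
      norm_num
    have e3 : Real.pi⁻¹ * ((√2)⁻¹ * √(Real.pi / (2 * t))) = (2 * √(Real.pi * t))⁻¹ := by
      rw [Real.sqrt_div Real.pi_pos.le, Real.sqrt_mul two_pos.le, Real.sqrt_mul Real.pi_pos.le]
      have s1 := Real.sqrt_pos.2 Real.pi_pos
      have s2 := Real.sqrt_pos.2 ht0
      have s3 : 0 < √(2 : ℝ) := by positivity
      have q1 := Real.sq_sqrt Real.pi_pos.le
      have q3 := Real.sq_sqrt (two_pos.le : (0 : ℝ) ≤ 2)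
      have : Real.pi⁻¹ = (√Real.pi ^ 2)⁻¹ := by rw [q1]
      rw [this]
      field_simp
      rw [q3]
    rw [sin_mehlerAngle hz, mul_cpow_of_re_pos h0 e0, mul_cpow_of_re_pos (by norm_num) hS, e2, ← e3]
    push_cast
    linear_combination ((Real.pi : ℂ)⁻¹ * ((((√2 : ℝ) : ℂ))⁻¹ * sqrtOneSubSq z ^ (-1 / 2 : ℂ)) *
      (√(Real.pi / (2 * t)) : ℝ)) * e1
  have hid : z ^ (1 / 2 : ℂ) * (Complex.exp (-(Real.pi * t)) *
        blockH (1 / 2 + t * Complex.I) (1 - z ^ 2)) -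
      ((2 * √(Real.pi * t))⁻¹ : ℝ) * (Complex.exp (-(2 * t * cArcsin z)) *
        sqrtOneSubSq z ^ (-1 / 2 : ℂ)) =
      z ^ (1 / 2 : ℂ) * (Real.pi : ℂ)⁻¹ * Complex.exp (-(2 * t * cArcsin z)) *
        ((∫ p in Set.Ioo (0 : ℝ) 1, laplaceKernel t z p) -
          Complex.sin (mehlerAngle z) ^ (-1 / 2 : ℂ) * (√(Real.pi / (2 * t)) : ℝ)) := by
    rw [hH2]
    linear_combination Complex.exp (-(2 * t * cArcsin z)) * hmain
  have n1 : ‖z ^ (1 / 2 : ℂ)‖ = ‖z‖ ^ (1 / 2 : ℝ) := by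
    have := Complex.norm_cpow_real z (1 / 2)
    push_cast at this
    exact this
  have n2 : ‖(Real.pi : ℂ)⁻¹‖ ≤ 1 := by
    rw [norm_inv, Complex.norm_real, Real.norm_of_nonneg Real.pi_pos.le]
    exact inv_le_one_of_one_le₀ (by linarith [Real.pi_gt_three])
  have n3 : ‖Complex.exp (-(2 * t * cArcsin z))‖ = Real.exp (-(2 * t * (cArcsin z).re)) := by
    rw [Complex.norm_exp]
    congr 1
    rw [Complex.neg_re, show 2 * (t : ℂ) * cArcsin z = ((2 * t : ℝ) : ℂ) * cArcsin z by
      push_cast; ring, Complex.re_ofReal_mul]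
  have n4 : ‖z‖ ^ (1 / 2 : ℝ) * ‖z‖ ^ (-3 / 2 : ℝ) = ‖z‖⁻¹ := by
    rw [← Real.rpow_add hzp, ← Real.rpow_neg_one]; norm_num
  have n5 : t ^ (-3 / 2 : ℝ) = (√t)⁻¹ * t⁻¹ := by
    rw [Real.sqrt_eq_rpow, ← Real.rpow_neg ht0.le, ← Real.rpow_neg_one, ← Real.rpow_add ht0]
    norm_num
  rw [hid, norm_mul, norm_mul, norm_mul, n1, n3]
  calc _ ≤ ‖z‖ ^ (1 / 2 : ℝ) * 1 * Real.exp (-(2 * t * (cArcsin z).re)) *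
        (C * ‖z‖ ^ (-3 / 2 : ℝ) * t ^ (-3 / 2 : ℝ)) := by
        gcongr
        exact h t ht z h0 hz
    _ = C * (t ^ (-3 / 2 : ℝ)) * Real.exp (-(2 * t * (cArcsin z).re)) *
        (‖z‖ ^ (1 / 2 : ℝ) * ‖z‖ ^ (-3 / 2 : ℝ)) := by ring
    _ = _ := by rw [n4, n5, mul_inv]; ring

/-! ### Contour shifts and averages of Gaussians -/

/-- The factor by which `e ^ (-2 t arcsin z) (1 - z ^ 2) ^ (-1/4)` deviates from `e ^ (-2 t z)`. -/
noncomputable def arcsinCorrection (t : ℝ) (z : ℂ) : ℂ :=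
  Complex.exp (-(2 * t * (cArcsin z - z))) * sqrtOneSubSq z ^ (-1 / 2 : ℂ)

theorem norm_sqrtOneSubSq_rpow_le {z : ℂ} (hz : ‖z‖ < 1 / 2) :
    ‖sqrtOneSubSq z ^ (-1 / 2 : ℂ)‖ ≤ 2 := by
  refine (norm_cpow_neg_half_le (by norm_num) (norm_sqrtOneSubSq_ge hz)).trans ?_
  rw [show (-1 / 2 : ℝ) = -(1 / 2) by norm_num, Real.rpow_neg (by norm_num), ← Real.sqrt_eq_rpow]
  have : (1 / 2 : ℝ) ≤ √(3 / 4) := Real.le_sqrt_of_sq_le (by norm_num)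
  calc (√(3 / 4))⁻¹ ≤ (1 / 2 : ℝ)⁻¹ := by gcongr
    _ = 2 := by norm_num

theorem norm_two_mul_mul_cArcsin_sub_le {t : ℝ} (ht : 0 ≤ t) {z : ℂ} (hz : ‖z‖ < 1 / 2) :
    ‖-(2 * t * (cArcsin z - z))‖ ≤ 2 * (t * ‖z‖ ^ 3) := by
  rw [norm_neg, norm_mul, norm_mul, Complex.norm_real, Real.norm_of_nonneg ht, Complex.norm_ofNat,
    mul_assoc]
  gcongr
  exact norm_cArcsin_sub_le hz

theorem norm_arcsinCorrection_le {t : ℝ} (ht : 0 ≤ t) {z : ℂ} (hz : ‖z‖ < 1 / 2)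
    (htz : t * ‖z‖ ^ 3 ≤ 1 / 2) : ‖arcsinCorrection t z‖ ≤ 6 := by
  rw [arcsinCorrection, norm_mul]
  have h1 : ‖Complex.exp (-(2 * t * (cArcsin z - z)))‖ ≤ 3 := by
    rw [Complex.norm_exp]
    calc _ ≤ Real.exp 1 := Real.exp_le_exp.2 ((Complex.re_le_norm _).trans
          ((norm_two_mul_mul_cArcsin_sub_le ht hz).trans (by linarith)))
      _ ≤ 3 := by linarith [Real.exp_one_lt_d9]
  calc _ ≤ 3 * (2 : ℝ) := mul_le_mul h1 (norm_sqrtOneSubSq_rpow_le hz) (norm_nonneg _) (by norm_num)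
    _ = 6 := by norm_num

theorem norm_arcsinCorrection_sub_one_le {t : ℝ} (ht : 0 ≤ t) {z : ℂ} (hz : ‖z‖ < 1 / 2)
    (htz : t * ‖z‖ ^ 3 ≤ 1 / 2) : ‖arcsinCorrection t z - 1‖ ≤ 8 * (t * ‖z‖ ^ 3 + ‖z‖ ^ 2) := by
  have h1 := norm_two_mul_mul_cArcsin_sub_le ht hz
  have h2 : ‖Complex.exp (-(2 * t * (cArcsin z - z))) - 1‖ ≤ 4 * (t * ‖z‖ ^ 3) := by
    refine (Complex.norm_exp_sub_one_le (h1.trans (by linarith))).trans (by linarith)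
  have h3 : ‖sqrtOneSubSq z ^ (-1 / 2 : ℂ) - 1‖ ≤ 2 * ‖z‖ ^ 2 := by
    have hre := re_sqrtOneSubSq_ge hz
    have := norm_cpow_neg_half_sub_le (a := sqrtOneSubSq z) (b := 1) (by linarith) (by simp)
    simp only [Complex.one_cpow, norm_one, Real.one_rpow, mul_one] at this
    refine this.trans ?_
    have h4 : ‖sqrtOneSubSq z‖⁻¹ ≤ 2 := by
      rw [inv_le_comm₀ (by linarith [norm_sqrtOneSubSq_ge hz]) two_pos]
      linarith [norm_sqrtOneSubSq_ge hz]
    calc _ ≤ ‖z‖ ^ 2 * 2 := by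
          gcongr
          exact norm_sqrtOneSubSq_sub_one_le z
      _ = _ := by ring
  have hid : arcsinCorrection t z - 1 = (Complex.exp (-(2 * t * (cArcsin z - z))) - 1) *
      sqrtOneSubSq z ^ (-1 / 2 : ℂ) + (sqrtOneSubSq z ^ (-1 / 2 : ℂ) - 1) := by
    rw [arcsinCorrection]; ring
  rw [hid]
  refine (norm_add_le _ _).trans ?_
  rw [norm_mul]
  have h5 : 0 ≤ t * ‖z‖ ^ 3 := by positivity
  calc _ ≤ (4 * (t * ‖z‖ ^ 3)) * 2 + 2 * ‖z‖ ^ 2 := by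
        gcongr
        exact norm_sqrtOneSubSq_rpow_le hz
    _ ≤ _ := by nlinarith [sq_nonneg ‖z‖]

theorem differentiableAt_arcsinCorrection (t : ℝ) {z : ℂ} (hz : ‖z‖ < 1 / 2) :
    DifferentiableAt ℂ (arcsinCorrection t) z := by
  have h1 := (hasDerivAt_cArcsin hz).differentiableAt
  have h2 := (hasDerivAt_sqrtOneSubSq hz).differentiableAt
  unfold arcsinCorrection
  refine DifferentiableAt.mul ?_ ?_
  · exact ((h1.sub differentiableAt_id).const_mul _).neg.cexp
  · exact h2.cpow_const (Or.inl (by linarith [re_sqrtOneSubSq_ge hz]))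

/-- The Gaussian with frequency `2 D`, at a complex argument. -/
noncomputable def gaussPhase (H D : ℝ) (ζ : ℂ) : ℂ :=
  Complex.exp (-(H * ζ) ^ 2 + 2 * Complex.I * D * ζ)

theorem norm_gaussPhase (H D u v : ℝ) : ‖gaussPhase H D (u + v * Complex.I)‖ =
    Real.exp (-(H * u) ^ 2) * Real.exp ((H * v) ^ 2 - 2 * D * v) := by
  rw [gaussPhase, Complex.norm_exp, ← Real.exp_add]
  congr 1
  have : -((H : ℂ) * (u + v * Complex.I)) ^ 2 + 2 * Complex.I * D * (u + v * Complex.I) =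
      ((-(H * u) ^ 2 + ((H * v) ^ 2 - 2 * D * v) : ℝ) : ℂ) +
        ((-2 * H ^ 2 * u * v + 2 * D * u : ℝ) : ℂ) * Complex.I := by
    push_cast
    linear_combination (-(H : ℂ) ^ 2 * v ^ 2 + 2 * D * v) * Complex.I_sq
  rw [this, Complex.add_re, Complex.ofReal_re, Complex.re_ofReal_mul, Complex.I_re, mul_zero,
    add_zero]

/-- On the horizontal line through the saddle point the phase is constant. -/
theorem gaussPhase_saddle {H : ℝ} (hH : H ≠ 0) (D u : ℝ) :
    gaussPhase H D (u + (D / H ^ 2 : ℝ) * Complex.I) =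
      ((Real.exp (-(D / H) ^ 2) * Real.exp (-(H * u) ^ 2) : ℝ) : ℂ) := by
  have hHc : (H : ℂ) ≠ 0 := by exact_mod_cast hH
  rw [gaussPhase, ← Real.exp_add, Complex.ofReal_exp]
  congr 1
  push_cast
  field_simp
  linear_combination (D : ℂ) ^ 2 * Complex.I_sq

/-- Moving the segment of integration to height `c`, at most up to the saddle point `D / H ^ 2`,
costs only the two short vertical sides, where the Gaussian is already small. -/
theorem norm_integral_gaussPhase_sub_shift_le {H D Y c a ρ M : ℝ} {g : ℂ → ℂ} (hY : 0 ≤ Y)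
    (ha : 0 ≤ a) (hcD : (H * c) ^ 2 ≤ D * c) (hρ : a + Y + |c| ≤ ρ)
    (hg : ∀ z : ℂ, ‖z‖ ≤ ρ → DifferentiableAt ℂ g z) (hM : ∀ z : ℂ, ‖z‖ ≤ ρ → ‖g z‖ ≤ M) :
    ‖(∫ u in (-Y)..Y, gaussPhase H D u * g (a + u * Complex.I)) -
      ∫ u in (-Y)..Y, gaussPhase H D (u + c * Complex.I) * g (((a - c : ℝ) : ℂ) + u * Complex.I)‖ ≤
      2 * M * |c| * Real.exp (-(H * Y) ^ 2) := by
  set Ψ : ℂ → ℂ := fun ζ => gaussPhase H D ζ * g (a + ζ * Complex.I) with hΨ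
  have hnorm : ∀ u v : ℝ, |u| ≤ Y → |v| ≤ |c| →
      ‖(a : ℂ) + (u + v * Complex.I) * Complex.I‖ ≤ ρ := by
    intro u v hu hv
    have e : (a : ℂ) + (u + v * Complex.I) * Complex.I =
        (a : ℂ) + (u : ℂ) * Complex.I - (v : ℂ) := by
      linear_combination (v : ℂ) * Complex.I_sq
    rw [e]
    refine (norm_sub_le _ _).trans ((add_le_add_left (norm_add_le _ _) _).trans ?_)
    simp only [norm_mul, Complex.norm_real, Complex.norm_I, mul_one, Real.norm_eq_abs,
      abs_of_nonneg ha]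
    linarith
  have hdiff : DifferentiableOn ℂ Ψ (Set.uIcc (-Y) Y ×ℂ Set.uIcc 0 c) := by
    intro ζ hζ
    have h1 : |ζ.re| ≤ Y := by
      have := hζ.1
      simp only [Set.mem_preimage, Set.uIcc_of_le (by linarith : -Y ≤ Y)] at this
      exact abs_le.2 this
    have h2 : |ζ.im| ≤ |c| := by
      simpa using Set.abs_sub_left_of_mem_uIcc hζ.2
    have h3 := hg _ (by simpa only [Complex.re_add_im] using hnorm _ _ h1 h2)
    have h4 : DifferentiableAt ℂ (fun ζ : ℂ => g (a + ζ * Complex.I)) ζ :=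
      DifferentiableAt.comp (𝕜 := ℂ) ζ (f := fun ζ : ℂ => (a : ℂ) + ζ * Complex.I) h3 (by fun_prop)
    have h5 : DifferentiableAt ℂ (gaussPhase H D) ζ := by
      unfold gaussPhase; fun_prop
    exact (h5.mul h4).differentiableWithinAt
  have hrect := Complex.integral_boundary_rect_eq_zero_of_differentiableOn Ψ (((-Y : ℝ) : ℂ))
    ((Y : ℂ) + (c : ℂ) * Complex.I) (by simpa using hdiff)
  simp only [Complex.ofReal_re, Complex.ofReal_im, Complex.add_re, Complex.add_im,
    Complex.re_ofReal_mul, Complex.im_ofReal_mul, Complex.I_re, Complex.I_im, mul_zero, mul_one,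
    add_zero, zero_add, Complex.ofReal_zero, zero_mul, smul_eq_mul] at hrect
  have hside : ∀ σ : ℝ, |σ| = Y → ‖∫ v in (0 : ℝ)..c, Ψ (σ + v * Complex.I)‖ ≤
      M * Real.exp (-(H * Y) ^ 2) * |c| := by
    intro σ hσ
    have := intervalIntegral.norm_integral_le_of_norm_le_const (a := 0) (b := c)
      (f := fun v : ℝ => Ψ (σ + v * Complex.I)) (C := M * Real.exp (-(H * Y) ^ 2)) ?_
    · simpa using this
    · intro v hv
      have hv' := Set.uIoc_subset_uIcc hv
      have hvc : |v| ≤ |c| := by simpa using Set.abs_sub_left_of_mem_uIcc hv'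
      -- The growth factor in the vertical direction is at most one between the real axis and the
      -- saddle point, and `v` lies in this range.
      have hsign : (H * v) ^ 2 - 2 * D * v ≤ 0 := by
        rcases le_total 0 c with hc | hc
        · rw [Set.uIcc_of_le hc] at hv'
          rcases eq_or_lt_of_le hc with h | h
          · have : v = 0 := le_antisymm (h ▸ hv'.2) hv'.1
            simp [this]
          · have : H ^ 2 * c ≤ D := by
              have : (H ^ 2 * c) * c ≤ D * c := by nlinarith
              exact le_of_mul_le_mul_right this h
            have h6 : H ^ 2 * v ≤ H ^ 2 * c := by nlinarith [hv'.2, sq_nonneg H]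
            have h7 : 0 ≤ H ^ 2 * v := mul_nonneg (sq_nonneg H) hv'.1
            nlinarith [hv'.1]
        · rw [Set.uIcc_of_ge hc] at hv'
          rcases eq_or_lt_of_le hc with h | h
          · have : v = 0 := le_antisymm hv'.2 (h ▸ hv'.1)
            simp [this]
          · have : D ≤ H ^ 2 * c := by
              have : D * (-c) ≤ (H ^ 2 * c) * (-c) := by nlinarith
              exact le_of_mul_le_mul_right this (by linarith)
            have h6 : H ^ 2 * c ≤ H ^ 2 * v := by nlinarith [hv'.1, sq_nonneg H]
            have h7 : H ^ 2 * v ≤ 0 := mul_nonpos_of_nonneg_of_nonpos (sq_nonneg H) hv'.2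
            nlinarith [hv'.2]
      rw [hΨ]
      simp only [norm_mul]
      rw [norm_gaussPhase, mul_comm]
      have e1 : (H * σ) ^ 2 = (H * Y) ^ 2 := by rw [mul_pow, mul_pow, ← sq_abs σ, hσ]
      rw [e1]
      have hgM := hM _ (hnorm σ v hσ.le hvc)
      refine mul_le_mul hgM (mul_le_of_le_one_right (Real.exp_pos _).le
        (Real.exp_le_one_iff.2 hsign)) (by positivity) ((norm_nonneg _).trans hgM)
  have hshift : ∀ u : ℝ, (a : ℂ) + (u + c * Complex.I) * Complex.I =
      ((a - c : ℝ) : ℂ) + u * Complex.I := fun u => by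
    push_cast
    linear_combination (c : ℂ) * Complex.I_sq
  have hΨ1 : ∀ u : ℝ, Ψ (u + c * Complex.I) =
      gaussPhase H D (u + c * Complex.I) * g (((a - c : ℝ) : ℂ) + u * Complex.I) := fun u => by
    simp only [hΨ]
    rw [hshift]
  simp_rw [← hΨ1]
  have hS1 := hside Y (abs_of_nonneg hY)
  have hS2 := hside (-Y) (by rw [abs_neg, abs_of_nonneg hY])
  have hval : (∫ u in (-Y)..Y, Ψ u) - ∫ u in (-Y)..Y, Ψ (u + c * Complex.I) =
      Complex.I * (∫ v in (0 : ℝ)..c, Ψ (((-Y : ℝ) : ℂ) + v * Complex.I)) -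
        Complex.I * ∫ v in (0 : ℝ)..c, Ψ ((Y : ℂ) + v * Complex.I) := by
    linear_combination hrect
  rw [show (fun u : ℝ => gaussPhase H D u * g (a + u * Complex.I)) = fun u : ℝ => Ψ u from rfl,
    hval]
  refine (norm_sub_le _ _).trans ?_
  rw [norm_mul, norm_mul, Complex.norm_I, one_mul, one_mul]
  linarith

theorem gauss_integrable {H : ℝ} (hH : 0 < H) {b : ℝ} (hb : 0 < b) :
    Integrable fun u : ℝ => Real.exp (-(b * (H * u) ^ 2)) := by
  have := integrable_exp_neg_mul_sq (b := b * H ^ 2) (by positivity)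
  refine this.congr (Filter.Eventually.of_forall fun u => ?_)
  simp only
  congr 1
  ring

theorem gauss_integral {H : ℝ} (hH : 0 < H) {b : ℝ} (hb : 0 < b) :
    ∫ u : ℝ, Real.exp (-(b * (H * u) ^ 2)) = √(Real.pi / b) / H := by
  have := integral_gaussian (b * H ^ 2)
  rw [show Real.pi / (b * H ^ 2) = Real.pi / b / H ^ 2 by field_simp,
    Real.sqrt_div (div_nonneg Real.pi_pos.le hb.le), Real.sqrt_sq hH.le] at this
  rw [← this]
  congr 1
  funext u
  congr 1
  ring

theorem intervalIntegral_gauss_le {H : ℝ} (hH : 0 < H) {Y : ℝ} (hY : 0 ≤ Y) :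
    ∫ u in (-Y)..Y, Real.exp (-(H * u) ^ 2) ≤ √Real.pi / H := by
  have h1 := gauss_integral hH one_pos
  have h2 := gauss_integrable hH one_pos
  simp only [one_mul, div_one] at h1 h2
  rw [← h1, intervalIntegral.integral_of_le (by linarith)]
  exact setIntegral_le_integral h2 (Filter.Eventually.of_forall fun u => (Real.exp_pos _).le)

/-- The Gaussian average over `[-Y, Y]`, normalized to total mass one on the line. -/
noncomputable def gaussAverage (H Y : ℝ) (f : ℝ → ℂ) : ℂ :=
  ((H / √Real.pi : ℝ) : ℂ) * ∫ u in (-Y)..Y, ((Real.exp (-(H * u) ^ 2) : ℝ) : ℂ) * f u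

theorem one_add_abs_pow_six_le (x : ℝ) : (1 + |x|) ^ 6 ≤ 1728 * Real.exp (1 / 2 * x ^ 2) := by
  have h1 : (1 + |x|) ^ 2 ≤ 2 * (1 + x ^ 2) := by nlinarith [sq_nonneg (1 - |x|), sq_abs x]
  have h2 : 1 + x ^ 2 ≤ 6 * Real.exp (1 / 6 * x ^ 2) := by
    nlinarith [Real.add_one_le_exp (1 / 6 * x ^ 2), sq_nonneg x]
  calc (1 + |x|) ^ 6 = ((1 + |x|) ^ 2) ^ 3 := by ring
    _ ≤ (2 * (6 * Real.exp (1 / 6 * x ^ 2))) ^ 3 := by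
        gcongr
        linarith
    _ = 1728 * Real.exp (1 / 2 * x ^ 2) := by
        rw [mul_pow, mul_pow, ← Real.exp_nat_mul, ← mul_assoc]
        norm_num
        ring_nf

/-- A Gaussian average of a function close to one near the origin is close to one. The bound
off the segment, `1 ≤ q (1 + |H u|) ^ 6`, accounts for the tails. The sixth power makes this hold
with `q` of order `T ^ (-6ε)` if `H Y = T ^ ε`. -/
theorem norm_gaussAverage_sub_one_le {H Y q : ℝ} (hH : 0 < H) (hY : 0 ≤ Y)
    {f : ℝ → ℂ} (hf : ContinuousOn f (Set.Icc (-Y) Y))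
    (hin : ∀ u, |u| ≤ Y → ‖f u - 1‖ ≤ q * (1 + |H * u|) ^ 6)
    (hout : ∀ u, Y ≤ |u| → 1 ≤ q * (1 + |H * u|) ^ 6) :
    ‖gaussAverage H Y f - 1‖ ≤ 1728 * 2 * q := by
  have hg1 := gauss_integrable hH one_pos
  have hi1 := gauss_integral hH one_pos
  simp only [one_mul, div_one] at hg1 hi1
  have hg2 := gauss_integrable hH (b := 1 / 2) (by norm_num)
  have hi2 := gauss_integral hH (b := 1 / 2) (by norm_num)
  have hpi : 0 < √Real.pi := Real.sqrt_pos.2 Real.pi_pos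
  set φ : ℝ → ℂ := (Set.Ioc (-Y) Y).indicator
    (fun u => ((Real.exp (-(H * u) ^ 2) : ℝ) : ℂ) * f u) with hφ
  have hφi : Integrable φ := by
    rw [hφ, integrable_indicator_iff measurableSet_Ioc]
    refine IntegrableOn.mono_set (ContinuousOn.integrableOn_Icc ?_) Set.Ioc_subset_Icc_self
    exact ContinuousOn.mul (by fun_prop) hf
  have h1 : gaussAverage H Y f - 1 = ((H / √Real.pi : ℝ) : ℂ) *
      ∫ u : ℝ, (φ u - ((Real.exp (-(H * u) ^ 2) : ℝ) : ℂ)) := by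
    have hgc : Integrable fun u : ℝ => ((Real.exp (-(H * u) ^ 2) : ℝ) : ℂ) := hg1.ofReal
    rw [integral_sub hφi hgc, integral_complex_ofReal, hi1, hφ,
      integral_indicator measurableSet_Ioc, gaussAverage,
      intervalIntegral.integral_of_le (by linarith), mul_sub, ← Complex.ofReal_mul]
    rw [show H / √Real.pi * (√Real.pi / H) = 1 by field_simp]
    simp
  have hpt : ∀ u, ‖φ u - ((Real.exp (-(H * u) ^ 2) : ℝ) : ℂ)‖ ≤
      q * 1728 * Real.exp (-(1 / 2 * (H * u) ^ 2)) := by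
    intro u
    have hq6 : Real.exp (-(H * u) ^ 2) * (q * (1 + |H * u|) ^ 6) ≤
        q * 1728 * Real.exp (-(1 / 2 * (H * u) ^ 2)) := by
      have hq : 0 ≤ q := by
        have h := hout (Y + 1) (by rw [abs_of_nonneg (by linarith)]; linarith)
        by_contra hneg
        have : q * (1 + |H * (Y + 1)|) ^ 6 ≤ 0 :=
          mul_nonpos_of_nonpos_of_nonneg (by linarith) (by positivity)
        linarith
      calc _ ≤ Real.exp (-(H * u) ^ 2) * (q * (1728 * Real.exp (1 / 2 * (H * u) ^ 2))) := by
            gcongr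
            exact one_add_abs_pow_six_le _
        _ = q * 1728 * (Real.exp (-(H * u) ^ 2) * Real.exp (1 / 2 * (H * u) ^ 2)) := by ring
        _ = _ := by rw [← Real.exp_add]; ring_nf
    refine le_trans ?_ hq6
    by_cases hu : u ∈ Set.Ioc (-Y) Y
    · rw [hφ, Set.indicator_of_mem hu, show ((Real.exp (-(H * u) ^ 2) : ℝ) : ℂ) * f u -
        ((Real.exp (-(H * u) ^ 2) : ℝ) : ℂ) = ((Real.exp (-(H * u) ^ 2) : ℝ) : ℂ) * (f u - 1) by
          ring, norm_mul, Complex.norm_real, Real.norm_of_nonneg (Real.exp_pos _).le]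
      gcongr
      exact hin u (abs_le.2 ⟨hu.1.le, hu.2⟩)
    · rw [hφ, Set.indicator_of_notMem hu, zero_sub, norm_neg, Complex.norm_real,
        Real.norm_of_nonneg (Real.exp_pos _).le]
      refine le_mul_of_one_le_right (Real.exp_pos _).le (hout u ?_)
      by_contra hlt
      have := abs_lt.1 (not_le.1 hlt)
      exact hu ⟨this.1, this.2.le⟩
  rw [h1, norm_mul, Complex.norm_real, Real.norm_of_nonneg (by positivity)]
  have h2 := norm_integral_le_of_norm_le (hg2.const_mul (q * 1728))
    (Filter.Eventually.of_forall hpt)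
  rw [integral_const_mul, hi2] at h2
  have hq : 0 ≤ q * 1728 := by
    have := (norm_nonneg _).trans (hpt 0)
    simpa using this
  have h3 : √(Real.pi / (1 / 2)) ≤ 2 * √Real.pi := by
    rw [show Real.pi / (1 / 2) = 2 * Real.pi by ring, Real.sqrt_mul two_pos.le]
    gcongr
    rw [Real.sqrt_le_left (by norm_num)]
    norm_num
  calc _ ≤ H / √Real.pi * (q * 1728 * (2 * √Real.pi / H)) := by
        gcongr
        exact h2.trans (by gcongr)
    _ = _ := by field_simp

/-! ### The averaged block and its model integral -/

theorem mehlerIntegrand_conj (t : ℝ) {θ : ℂ} (h0 : 0 < θ.re) (h1 : θ.re < Real.pi) {p : ℝ}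
    (hp : p ∈ Set.Ioo (0 : ℝ) 1) :
    mehlerIntegrand t (starRingEnd ℂ θ) p = starRingEnd ℂ (mehlerIntegrand t θ p) := by
  have a1 := re_sin_pos h0 h1 hp.1 hp.2.le
  have a2 := re_sin_pos h0 h1 (p := 1 - p) (by linarith [hp.2]) (by linarith [hp.1])
  have c1 := cpow_conj_of_re_pos a1 (-1 / 2)
  have c2 := cpow_conj_of_re_pos a2 (-1 / 2)
  push_cast at c1 c2
  rw [← Complex.sin_conj] at c1 c2
  simp only [map_mul, map_sub, map_one, Complex.conj_ofReal] at c1 c2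
  simp only [mehlerIntegrand, map_mul, ← Complex.exp_conj, map_sub, map_one, Complex.conj_ofReal,
    map_ofNat, c1, c2]

/-- On the line `re s = 1/2` the block is real in the sense of the Schwarz reflection principle. -/
theorem blockH_one_sub_conj_sq {t : ℝ} (ht : t ≠ 0) {z : ℂ} (h0 : 0 < z.re) (hz : ‖z‖ ≤ 1 / 4) :
    blockH (1 / 2 + t * Complex.I) (1 - (starRingEnd ℂ z) ^ 2) =
      starRingEnd ℂ (blockH (1 / 2 + t * Complex.I) (1 - z ^ 2)) := by
  have t2 := two_le_mehlerAngle_re hz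
  have tpi := mehlerAngle_re_lt h0 hz
  have hz' : ‖starRingEnd ℂ z‖ ≤ 1 / 4 := by simpa using hz
  have hconj : mehlerAngle (starRingEnd ℂ z) = starRingEnd ℂ (mehlerAngle z) := by
    rw [mehlerAngle, mehlerAngle, cArcsin_conj (z := z) (by linarith), map_sub, map_mul,
      Complex.conj_ofReal, map_ofNat]
  have e1 := blockH_sin_sq ht (θ := mehlerAngle z) (by linarith) tpi
  have e2 := blockH_sin_sq ht (θ := mehlerAngle (starRingEnd ℂ z))
    (by rw [hconj, Complex.conj_re]; linarith) (by rw [hconj, Complex.conj_re]; exact tpi)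
  rw [sin_half_mehlerAngle_sq hz] at e1
  rw [sin_half_mehlerAngle_sq hz'] at e2
  rw [e1, e2, map_mul, map_inv₀, Complex.conj_ofReal, ← integral_conj, hconj]
  congr 1
  exact setIntegral_congr_fun measurableSet_Ioo fun p hp =>
    mehlerIntegrand_conj t (by linarith) tpi hp

theorem linePoint_re (T y : ℝ) : (linePoint T y).re = T⁻¹ := by
  rw [linePoint, Complex.add_re, Complex.ofReal_re, Complex.re_ofReal_mul, Complex.I_re, mul_zero,
    add_zero]

theorem linePoint_im (T y : ℝ) : (linePoint T y).im = y := by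
  rw [linePoint, Complex.add_im, Complex.ofReal_im, Complex.im_ofReal_mul, Complex.I_im, mul_one,
    zero_add]

theorem linePoint_neg (T y : ℝ) : linePoint T (-y) = starRingEnd ℂ (linePoint T y) := by
  apply Complex.ext
  · simp only [Complex.conj_re, linePoint_re]
  · simp only [Complex.conj_im, linePoint_im]

theorem norm_linePoint_le {T y Y : ℝ} (hT : 0 < T) (hy : |y| ≤ Y) :
    ‖linePoint T y‖ ≤ T⁻¹ + Y := by
  refine (Complex.norm_le_abs_re_add_abs_im _).trans ?_
  rw [linePoint_re, linePoint_im, abs_of_pos (by positivity)]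
  gcongr

theorem norm_linePoint_ge {T y : ℝ} (hT : 0 < T) : (T⁻¹ + |y|) / 2 ≤ ‖linePoint T y‖ := by
  have h1 := Complex.abs_re_le_norm (linePoint T y)
  have h2 := Complex.abs_im_le_norm (linePoint T y)
  rw [linePoint_re, abs_of_pos (by positivity)] at h1
  rw [linePoint_im] at h2
  linarith

theorem normalizedH_eq (k : ℕ) {t : ℝ} (ht : 1 < t) (w : ℂ) :
    normalizedH k (1 / 2 + t * Complex.I) w = ((t ^ (4 * (k : ℝ) - 2) : ℝ) : ℂ) *
      (Complex.exp (-(Real.pi * t)) * blockH (1 / 2 + t * Complex.I) w) := by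
  have him : ((1 / 2 : ℂ) + t * Complex.I).im = t := by simp
  rw [normalizedH, him, if_neg (not_le.2 ht)]
  push_cast
  rw [neg_mul]
  ring

/-- The averaged block is real: the reflection `y ↦ -y` conjugates the integrand. -/
theorem averagedBlockW_im {k : ℕ} {ε T t : ℝ} (hT : 0 < T) (ht : 1 < t)
    (hY0 : 0 ≤ T ^ ε / windowH ε T) (hY : T⁻¹ + T ^ ε / windowH ε T ≤ 1 / 4) :
    (averagedBlockW k ε T (1 / 2 + t * Complex.I)).im = 0 := by
  rw [averagedBlockW, Complex.im_ofReal_mul]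
  refine mul_eq_zero_of_right _ ?_
  set Y := T ^ ε / windowH ε T
  set f : ℝ → ℂ := fun y => ((Real.exp (-(windowH ε T * y) ^ 2) : ℝ) : ℂ) *
        Complex.exp (2 * Complex.I * (T : ℂ) * (y : ℂ)) *
        linePoint T y ^ (1 / 2 : ℂ) *
        normalizedH k (1 / 2 + t * Complex.I) (1 - linePoint T y ^ 2) with hf
  have hconj : ∀ y, |y| ≤ Y → f (-y) = starRingEnd ℂ (f y) := by
    intro y hy
    have hre : 0 < (linePoint T y).re := by rw [linePoint_re]; positivity
    have hz := (norm_linePoint_le hT hy).trans hY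
    have c1 := cpow_conj_of_re_pos hre (1 / 2)
    push_cast at c1
    simp only [hf, linePoint_neg, normalizedH_eq k ht, map_mul, c1, Complex.conj_ofReal,
      blockH_one_sub_conj_sq (by linarith : t ≠ 0) hre hz, ← Complex.exp_conj, Complex.conj_I,
      map_ofNat, map_neg, mul_neg, neg_sq, Complex.ofReal_neg, neg_mul]
  have h1 : ∫ y in (-Y)..Y, f (-y) = ∫ y in (-Y)..Y, f y := by
    rw [intervalIntegral.integral_comp_neg, neg_neg]
  have h2 : ∫ y in (-Y)..Y, f (-y) = starRingEnd ℂ (∫ y in (-Y)..Y, f y) := by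
    rw [intervalIntegral.integral_of_le (by linarith),
      intervalIntegral.integral_of_le (by linarith), ← integral_conj]
    exact setIntegral_congr_fun measurableSet_Ioc fun y hy => hconj y (abs_le.2 ⟨hy.1.le, hy.2⟩)
  exact Complex.conj_eq_iff_im.1 (h2.symm.trans h1)

theorem integral_inv_add_abs {a Y : ℝ} (ha : 0 < a) (hY : 0 ≤ Y) :
    ∫ y in (-Y)..Y, (a + |y|)⁻¹ = 2 * Real.log (1 + Y / a) := by
  have hc : Continuous fun y : ℝ => (a + |y|)⁻¹ :=
    Continuous.inv₀ (by fun_prop) fun y => by positivity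
  have h1 : ∫ y in (0 : ℝ)..Y, (a + |y|)⁻¹ = Real.log (1 + Y / a) := by
    have e : ∫ y in (0 : ℝ)..Y, (a + |y|)⁻¹ = ∫ y in (0 : ℝ)..Y, (a + y)⁻¹ := by
      refine intervalIntegral.integral_congr fun y hy => ?_
      rw [Set.uIcc_of_le hY] at hy
      simp only [abs_of_nonneg hy.1]
    rw [e, intervalIntegral.integral_comp_add_left (fun x => x⁻¹) a,
      integral_inv_of_pos (by linarith) (by linarith)]
    congr 1
    field_simp
    ring
  have h2 : ∫ y in (-Y)..0, (a + |y|)⁻¹ = ∫ y in (0 : ℝ)..Y, (a + |y|)⁻¹ := by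
    have := intervalIntegral.integral_comp_neg (a := -Y) (b := 0) (fun y : ℝ => (a + |y|)⁻¹)
    simpa using this
  rw [← intervalIntegral.integral_add_adjacent_intervals (hc.intervalIntegrable _ 0)
    (hc.intervalIntegrable 0 _), h2, h1]
  ring

/-- The oscillatory Gaussian integral that remains when the block is replaced by its leading
asymptotics, with the decay `e ^ (-2 t / T)` pulled out. -/
noncomputable def modelIntegral (H Y T t : ℝ) : ℂ :=
  ((H / √Real.pi : ℝ) : ℂ) * ∫ u in (-Y)..Y,
    gaussPhase H (T - t) u * arcsinCorrection t (((T⁻¹ : ℝ) : ℂ) + u * Complex.I)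

theorem gaussPhase_mul_arcsinCorrection (H : ℝ) {T : ℝ} (t y : ℝ) (hT : T ≠ 0) :
    ((Real.exp (-2 * t / T) : ℝ) : ℂ) * (gaussPhase H (T - t) y *
      arcsinCorrection t (linePoint T y)) =
    ((Real.exp (-(H * y) ^ 2) : ℝ) : ℂ) * Complex.exp (2 * Complex.I * T * y) *
      (Complex.exp (-(2 * t * cArcsin (linePoint T y))) *
        sqrtOneSubSq (linePoint T y) ^ (-1 / 2 : ℂ)) := by
  have hTc : (T : ℂ) ≠ 0 := by exact_mod_cast hT
  have : ((Real.exp (-2 * t / T) : ℝ) : ℂ) * (gaussPhase H (T - t) y *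
      Complex.exp (-(2 * t * (cArcsin (linePoint T y) - linePoint T y)))) =
      ((Real.exp (-(H * y) ^ 2) : ℝ) : ℂ) * Complex.exp (2 * Complex.I * T * y) *
      Complex.exp (-(2 * t * cArcsin (linePoint T y))) := by
    rw [gaussPhase, Complex.ofReal_exp, Complex.ofReal_exp, ← Complex.exp_add, ← Complex.exp_add,
      ← Complex.exp_add, ← Complex.exp_add]
    congr 1
    rw [show (cArcsin (linePoint T y) - linePoint T y) =
      cArcsin (linePoint T y) - (((T⁻¹ : ℝ) : ℂ) + y * Complex.I) from rfl]
    push_cast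
    field_simp
    ring
  rw [arcsinCorrection]
  linear_combination sqrtOneSubSq (linePoint T y) ^ (-1 / 2 : ℂ) * this

/-- The powers of `T` and `t` in the definition of the averaged block combine to a power of
`t / T`. -/
theorem rpow_prefactor_eq (k : ℕ) {T t : ℝ} (hT : 0 < T) (ht : 0 < t) :
    T ^ (-4 * (k : ℝ) + 5 / 2) * t ^ (4 * (k : ℝ) - 2) * (√t)⁻¹ =
      (t / T) ^ (4 * (k : ℝ) - 5 / 2) := by
  rw [Real.div_rpow ht.le hT.le, Real.sqrt_eq_rpow, ← Real.rpow_neg ht.le, mul_assoc,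
    ← Real.rpow_add ht, show -4 * (k : ℝ) + 5 / 2 = -(4 * (k : ℝ) - 5 / 2) by ring,
    show 4 * (k : ℝ) - 2 + -(1 / 2) = 4 * (k : ℝ) - 5 / 2 by ring, Real.rpow_neg hT.le]
  exact inv_mul_eq_div _ _

/-- Replacing the block by its leading asymptotics in the averaged block. The relative error
`1 / (t ‖z‖)`, integrated over the window, costs a factor `H / T` and a logarithm. -/
theorem exists_norm_averagedBlockW_sub_le (k : ℕ) : ∃ C > 0, ∀ ε T t : ℝ, 0 < T → 1 < t →
    0 < windowH ε T → T⁻¹ + T ^ ε / windowH ε T ≤ 1 / 4 →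
    ‖averagedBlockW k ε T (1 / 2 + t * Complex.I) -
      ((1 / 2 * (t / T) ^ (4 * (k : ℝ) - 5 / 2) * Real.exp (-2 * t / T) : ℝ) : ℂ) *
        modelIntegral (windowH ε T) (T ^ ε / windowH ε T) T t‖ ≤
      C * (t / T) ^ (4 * (k : ℝ) - 7 / 2) * Real.exp (-(t / T)) * (windowH ε T / T) *
        Real.log (1 + T * (T ^ ε / windowH ε T)) := by
  obtain ⟨C, hC, h⟩ := exists_norm_blockH_sub_le
  refine ⟨4 * C, by positivity, fun ε T t hT ht hH hY => ?_⟩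
  set H := windowH ε T with hHdef
  set Y := T ^ ε / H with hYdef
  have hY0 : 0 ≤ Y := by positivity
  have ht0 : 0 < t := by linarith
  set s : ℂ := 1 / 2 + t * Complex.I with hs
  set e : ℝ → ℂ := fun y => ((Real.exp (-(H * y) ^ 2) : ℝ) : ℂ) *
    Complex.exp (2 * Complex.I * T * y) with he
  set Q : ℝ → ℂ := fun y => linePoint T y ^ (1 / 2 : ℂ) * (Complex.exp (-(Real.pi * t)) *
        blockH s (1 - linePoint T y ^ 2)) with hQ
  set M : ℝ → ℂ := fun y => ((2 * √(Real.pi * t))⁻¹ : ℝ) *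
    (Complex.exp (-(2 * t * cArcsin (linePoint T y))) *
        sqrtOneSubSq (linePoint T y) ^ (-1 / 2 : ℂ)) with hM
  have hre : ∀ y, 0 < (linePoint T y).re := fun y => by rw [linePoint_re]; positivity
  have hn : ∀ y, |y| ≤ Y → ‖linePoint T y‖ ≤ 1 / 4 := fun y hy => (norm_linePoint_le hT hy).trans hY
  have hline : Continuous (linePoint T) := by unfold linePoint; fun_prop
  have hec : Continuous e := by fun_prop
  have hQc : Continuous Q := by
    have h1 : Continuous fun y => blockH s (1 - linePoint T y ^ 2) := by
      rw [continuous_iff_continuousAt]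
      intro y
      have := ((differentiableOn_blockH_and_eq t).1.differentiableAt
        (isOpen_cutPlane.mem_nhds (one_sub_sq_mem_cutPlane (hre y)))).continuousAt
      exact ContinuousAt.comp (f := fun y => 1 - linePoint T y ^ 2) this (by fun_prop)
    have h2 : Continuous fun y => linePoint T y ^ (1 / 2 : ℂ) :=
      hline.cpow continuous_const fun y => Or.inl (hre y)
    exact h2.mul (continuous_const.mul h1)
  have huIcc : Set.uIcc (-Y) Y = Set.Icc (-Y) Y := Set.uIcc_of_le (by linarith)
  have hMc : ContinuousOn M (Set.uIcc (-Y) Y) := by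
    intro y hy
    rw [huIcc] at hy
    have hz : ‖linePoint T y‖ < 1 / 2 := by linarith [hn y (abs_le.2 hy)]
    have d1 : ContinuousAt (fun y => cArcsin (linePoint T y)) y :=
      ContinuousAt.comp (f := linePoint T) (hasDerivAt_cArcsin hz).continuousAt hline.continuousAt
    have d2 : ContinuousAt (fun y => sqrtOneSubSq (linePoint T y)) y :=
      ContinuousAt.comp (f := linePoint T) (hasDerivAt_sqrtOneSubSq hz).continuousAt
        hline.continuousAt
    have d3 : ContinuousAt (fun y => sqrtOneSubSq (linePoint T y) ^ (-1 / 2 : ℂ)) y :=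
      d2.cpow continuousAt_const (Or.inl (by linarith [re_sqrtOneSubSq_ge hz]))
    have d4 : ContinuousAt (fun y => Complex.exp (-(2 * t * cArcsin (linePoint T y)))) y :=
      (continuousAt_const.mul d1).neg.cexp
    exact (continuousAt_const.mul (d4.mul d3)).continuousWithinAt
  have hW : averagedBlockW k ε T s =
      ((T ^ (-4 * (k : ℝ) + 5 / 2) * H * t ^ (4 * (k : ℝ) - 2) : ℝ) : ℂ) *
      ∫ y in (-Y)..Y, e y * Q y := by
    have h1 : ∫ y in (-Y)..Y, ((Real.exp (-(H * y) ^ 2) : ℝ) : ℂ) *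
        Complex.exp (2 * Complex.I * T * y) * linePoint T y ^ (1 / 2 : ℂ) *
          normalizedH k s (1 - linePoint T y ^ 2) =
        ((t ^ (4 * (k : ℝ) - 2) : ℝ) : ℂ) * ∫ y in (-Y)..Y, e y * Q y := by
      rw [← intervalIntegral.integral_const_mul]
      refine intervalIntegral.integral_congr fun y _ => ?_
      simp only [he, hQ, hs, normalizedH_eq k ht]
      ring
    rw [averagedBlockW, ← hHdef, ← hYdef, h1, ← mul_assoc, ← Complex.ofReal_mul]
  have hmodel : ((1 / 2 * (t / T) ^ (4 * (k : ℝ) - 5 / 2) * Real.exp (-2 * t / T) : ℝ) : ℂ) *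
      modelIntegral H Y T t = ((T ^ (-4 * (k : ℝ) + 5 / 2) * H * t ^ (4 * (k : ℝ) - 2) : ℝ) : ℂ) *
      ∫ y in (-Y)..Y, e y * M y := by
    have h1 : ∀ y, e y * M y = (((2 * √(Real.pi * t))⁻¹ * Real.exp (-2 * t / T) : ℝ) : ℂ) *
        (gaussPhase H (T - t) y * arcsinCorrection t (((T⁻¹ : ℝ) : ℂ) + y * Complex.I)) := by
      intro y
      have := gaussPhase_mul_arcsinCorrection H t y hT.ne'
      rw [linePoint] at this
      simp only [he, hM, linePoint]
      rw [Complex.ofReal_mul]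
      linear_combination -(((2 * √(Real.pi * t))⁻¹ : ℝ) : ℂ) * this
    simp_rw [h1]
    have h2 : 1 / 2 * (t / T) ^ (4 * (k : ℝ) - 5 / 2) * Real.exp (-2 * t / T) * (H / √Real.pi) =
        T ^ (-4 * (k : ℝ) + 5 / 2) * H * t ^ (4 * (k : ℝ) - 2) *
          ((2 * √(Real.pi * t))⁻¹ * Real.exp (-2 * t / T)) := by
      rw [← rpow_prefactor_eq k hT ht0, Real.sqrt_mul Real.pi_pos.le]
      have s1 := Real.sqrt_pos.2 Real.pi_pos
      have s2 := Real.sqrt_pos.2 ht0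
      field_simp
    rw [intervalIntegral.integral_const_mul, modelIntegral, ← mul_assoc, ← mul_assoc,
      ← Complex.ofReal_mul, ← Complex.ofReal_mul, h2]
  have hbound : ∀ y ∈ Set.Ioc (-Y) Y, ‖e y * (Q y - M y)‖ ≤
      C * (√t)⁻¹ * Real.exp (-(t / T)) * t⁻¹ * 2 * (T⁻¹ + |y|)⁻¹ := by
    intro y hy
    have hy' : |y| ≤ Y := abs_le.2 ⟨hy.1.le, hy.2⟩
    have e1 : ‖e y‖ ≤ 1 := by
      simp only [he, norm_mul, Complex.norm_real, Real.norm_of_nonneg (Real.exp_pos _).le]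
      rw [show 2 * Complex.I * (T : ℂ) * y = ((2 * T * y : ℝ) : ℂ) * Complex.I by push_cast; ring,
        Complex.norm_exp_ofReal_mul_I, mul_one]
      exact Real.exp_le_one_iff.2 (neg_nonpos.2 (sq_nonneg _))
    have e2 := h t ht (linePoint T y) (hre y) (hn y hy')
    have e3 : Real.exp (-(2 * t * (cArcsin (linePoint T y)).re)) ≤ Real.exp (-(t / T)) := by
      refine Real.exp_le_exp.2 (neg_le_neg ?_)
      have := re_cArcsin_ge (z := linePoint T y) (by linarith [hn y hy']) (hre y).le
      rw [linePoint_re] at this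
      calc t / T = 2 * t * (T⁻¹ / 2) := by field_simp
        _ ≤ _ := by gcongr
    have e4 : (t * ‖linePoint T y‖)⁻¹ ≤ t⁻¹ * 2 * (T⁻¹ + |y|)⁻¹ := by
      have hpos : 0 < (T⁻¹ + |y|) / 2 := by positivity
      calc _ ≤ (t * ((T⁻¹ + |y|) / 2))⁻¹ := by
            gcongr
            exact norm_linePoint_ge hT
        _ = _ := by field_simp
    rw [norm_mul]
    calc _ ≤ 1 * (C * (√t)⁻¹ * Real.exp (-(t / T)) * (t⁻¹ * 2 * (T⁻¹ + |y|)⁻¹)) := by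
          refine mul_le_mul e1 (e2.trans ?_) (norm_nonneg _) zero_le_one
          gcongr
      _ = _ := by ring
  have hI1 : IntervalIntegrable (fun y => e y * Q y) volume (-Y) Y :=
    (hec.mul hQc).intervalIntegrable _ _
  have hI2 : IntervalIntegrable (fun y => e y * M y) volume (-Y) Y :=
    (hec.continuousOn.mul hMc).intervalIntegrable
  have hinvc : Continuous fun y : ℝ => (T⁻¹ + |y|)⁻¹ :=
    Continuous.inv₀ (by fun_prop) fun y => by positivity
  rw [hW, hmodel, ← mul_sub, ← intervalIntegral.integral_sub hI1 hI2, norm_mul, Complex.norm_real,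
    Real.norm_of_nonneg (by positivity)]
  have hint : ‖∫ y in (-Y)..Y, (e y * Q y - e y * M y)‖ ≤
      C * (√t)⁻¹ * Real.exp (-(t / T)) * t⁻¹ * 2 * (2 * Real.log (1 + T * Y)) := by
    have h3 := intervalIntegral.norm_integral_le_of_norm_le (a := -Y) (b := Y)
      (μ := volume) (f := fun y => e y * Q y - e y * M y)
      (g := fun y => C * (√t)⁻¹ * Real.exp (-(t / T)) * t⁻¹ * 2 * (T⁻¹ + |y|)⁻¹) (by linarith)
      (Filter.Eventually.of_forall fun y hy => by
        rw [← mul_sub]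
        exact hbound y hy)
      ((hinvc.intervalIntegrable _ _).const_mul _)
    rw [intervalIntegral.integral_const_mul, integral_inv_add_abs (by positivity) hY0] at h3
    rwa [div_inv_eq_mul, mul_comm Y] at h3
  have hx : (t / T) ^ (4 * (k : ℝ) - 5 / 2) = (t / T) ^ (4 * (k : ℝ) - 7 / 2) * (t / T) := by
    rw [← Real.rpow_add_one (by positivity)]
    ring_nf
  calc _ ≤ T ^ (-4 * (k : ℝ) + 5 / 2) * H * t ^ (4 * (k : ℝ) - 2) *
        (C * (√t)⁻¹ * Real.exp (-(t / T)) * t⁻¹ * 2 * (2 * Real.log (1 + T * Y))) := by gcongr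
    _ = (T ^ (-4 * (k : ℝ) + 5 / 2) * t ^ (4 * (k : ℝ) - 2) * (√t)⁻¹) *
        (4 * C * H * Real.exp (-(t / T)) * t⁻¹ * Real.log (1 + T * Y)) := by ring
    _ = _ := by
        rw [rpow_prefactor_eq k hT ht0, hx]
        field_simp

/-! ### The model integral by the saddle point method -/

/-- The inequalities between the Gaussian width parameter `H`, the cutoff `Y`, the logarithmic
scale `L` and `T` that hold once `T` is large when `H = T ^ (1/3 + 2ε)`, `Y = T ^ ε / H` and
`L = log T`. -/
structure IsLargeScale (H Y L T : ℝ) : Prop where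
  T_pos : 0 < T
  one_le_H : 1 ≤ H
  one_le_L : 1 ≤ L
  exp_neg_sq_le : Real.exp (-L ^ 2) ≤ T⁻¹
  L_le : L ≤ H * Y
  inv_T_le : T⁻¹ ≤ Y
  Y_le : 3 * Y ≤ 1 / 4
  two_mul_H_le : 2 * H ≤ T
  H_mul_L_le : H * L ≤ T
  cube_le : 54 * L ^ 2 * (T * Y ^ 3) ≤ 1 / 2
  tail_le : 1 ≤ T / H ^ 3 * (H * Y) ^ 6
  log_le : Real.log (1 + T * Y) ≤ L

namespace IsLargeScale

variable {H Y L T : ℝ}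

theorem H_pos (h : IsLargeScale H Y L T) : 0 < H := by linarith [h.one_le_H]

theorem L_pos (h : IsLargeScale H Y L T) : 0 < L := by linarith [h.one_le_L]

theorem Y_pos (h : IsLargeScale H Y L T) : 0 < Y :=
  lt_of_lt_of_le (inv_pos.2 h.T_pos) h.inv_T_le

theorem L_div_H_le (h : IsLargeScale H Y L T) : L / H ≤ Y := by
  rw [div_le_iff₀ h.H_pos, mul_comm]
  exact h.L_le

theorem exp_neg_cutoff_le (h : IsLargeScale H Y L T) : Real.exp (-(H * Y) ^ 2) ≤ T⁻¹ := by
  refine le_trans (Real.exp_le_exp.2 ?_) h.exp_neg_sq_le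
  have := h.L_le
  have := h.L_pos
  gcongr

theorem mul_norm_cube_le (h : IsLargeScale H Y L T) {t : ℝ}
    (ht : t ≤ 2 * T * L ^ 2) {z : ℂ} (hz : ‖z‖ ≤ 3 * Y) : t * ‖z‖ ^ 3 ≤ 1 / 2 := by
  have := h.T_pos
  calc t * ‖z‖ ^ 3 ≤ (2 * T * L ^ 2) * (3 * Y) ^ 3 := by gcongr
    _ = 54 * L ^ 2 * (T * Y ^ 3) := by ring
    _ ≤ 1 / 2 := h.cube_le

/-- A shift of the contour by at most `L / H` is possible for `t ≤ 2 T L²`, because `t ‖z‖ ^ 3`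
stays bounded on the rectangle in between. -/
theorem norm_modelIntegral_sub_shift_le (h : IsLargeScale H Y L T) {t c : ℝ} (ht0 : 0 ≤ t)
    (ht : t ≤ 2 * T * L ^ 2) (hc : |c| ≤ L / H) (hcD : (H * c) ^ 2 ≤ (T - t) * c) :
    ‖modelIntegral H Y T t - ((H / √Real.pi : ℝ) : ℂ) * ∫ u in (-Y)..Y,
      gaussPhase H (T - t) (u + c * Complex.I) *
        arcsinCorrection t (((T⁻¹ - c : ℝ) : ℂ) + u * Complex.I)‖ ≤ 12 * L / T := by
  have hH := h.H_pos
  have hT := h.T_pos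
  have hL := h.L_pos
  have h1 : ∀ z : ℂ, ‖z‖ ≤ 3 * Y → ‖z‖ < 1 / 2 := fun z hz => by linarith [h.Y_le]
  have key := norm_integral_gaussPhase_sub_shift_le (H := H) (D := T - t) (Y := Y) (c := c)
    (a := T⁻¹) (ρ := 3 * Y) (M := 6) (g := arcsinCorrection t) h.Y_pos.le (inv_pos.2 hT).le hcD
    (by linarith [h.inv_T_le, h.L_div_H_le])
    (fun z hz => differentiableAt_arcsinCorrection t (h1 z hz))
    (fun z hz => norm_arcsinCorrection_le ht0 (h1 z hz) (h.mul_norm_cube_le ht hz))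
  have hpi : H / √Real.pi ≤ H := div_le_self hH.le
    (by rw [Real.one_le_sqrt]; linarith [Real.pi_gt_three])
  rw [modelIntegral, ← mul_sub, norm_mul, Complex.norm_real, Real.norm_of_nonneg (by positivity)]
  calc _ ≤ H * (2 * 6 * (L / H) * T⁻¹) := by
        refine mul_le_mul hpi (key.trans ?_) (norm_nonneg _) hH.le
        have := h.exp_neg_cutoff_le
        gcongr
    _ = 12 * L / T := by field_simp; norm_num

/-- Near `t = T` the contour passes through the saddle point of the Gaussian phase. -/
theorem norm_modelIntegral_sub_near_le (h : IsLargeScale H Y L T) {t : ℝ} (ht0 : 0 ≤ t)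
    (ht : |T - t| ≤ H * L) :
    ‖modelIntegral H Y T t - ((Real.exp (-((T - t) / H) ^ 2) : ℝ) : ℂ) *
      gaussAverage H Y (fun u => arcsinCorrection t
        (((T⁻¹ - (T - t) / H ^ 2 : ℝ) : ℂ) + u * Complex.I))‖ ≤ 12 * L / T := by
  have hH := h.H_pos
  have hL := h.one_le_L
  have hT := h.T_pos
  have ht' : t ≤ 2 * T * L ^ 2 :=
    (show t ≤ 2 * T by linarith [(abs_le.1 ht).1, h.H_mul_L_le]).trans
      (le_mul_of_one_le_right (by positivity) (one_le_pow₀ hL))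
  have hc : |(T - t) / H ^ 2| ≤ L / H := by
    rw [abs_div, abs_of_pos (by positivity : 0 < H ^ 2)]
    calc _ ≤ H * L / H ^ 2 := by gcongr
      _ = L / H := by field_simp
  have key := h.norm_modelIntegral_sub_shift_le ht0 ht' hc
    (by apply le_of_eq; field_simp)
  convert key using 3
  rw [gaussAverage, mul_left_comm]
  congr 1
  rw [← intervalIntegral.integral_const_mul]
  refine intervalIntegral.integral_congr fun u _ => ?_
  simp only [gaussPhase_saddle hH.ne']
  push_cast
  ring

/-- Away from `t = T` a shift of the contour by `± L / H` already gains a factor `e ^ (-L²)`. -/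
theorem norm_modelIntegral_le_of_le_abs (h : IsLargeScale H Y L T) {t : ℝ} (ht0 : 0 ≤ t)
    (ht : t ≤ 2 * T * L ^ 2) (hD : H * L ≤ |T - t|) :
    ‖modelIntegral H Y T t‖ ≤ 18 * L / T := by
  have hH := h.H_pos
  have hL := h.one_le_L
  have hT := h.T_pos
  have hY := h.Y_pos
  obtain ⟨c, hc, hcD⟩ : ∃ c : ℝ, |c| = L / H ∧ (T - t) * c = |T - t| * (L / H) := by
    rcases le_total 0 (T - t) with h0 | h0
    · exact ⟨L / H, abs_of_nonneg (by positivity), by rw [abs_of_nonneg h0]⟩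
    · exact ⟨-(L / H), by rw [abs_neg, abs_of_nonneg (by positivity)], by
        rw [abs_of_nonpos h0]; ring⟩
  have hHc : (H * c) ^ 2 = L ^ 2 := by
    rw [mul_pow, ← sq_abs c, hc]
    field_simp
  have hDc : L ^ 2 ≤ (T - t) * c := by
    rw [hcD]
    calc L ^ 2 = H * L * (L / H) := by field_simp
      _ ≤ _ := by gcongr
  have key := h.norm_modelIntegral_sub_shift_le ht0 ht hc.le (hHc.trans_le hDc)
  have hbd : ‖∫ u in (-Y)..Y, gaussPhase H (T - t) (u + c * Complex.I) *
        arcsinCorrection t (((T⁻¹ - c : ℝ) : ℂ) + u * Complex.I)‖ ≤ T⁻¹ * 6 * (√Real.pi / H) := by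
    have hcont : Continuous fun u : ℝ => T⁻¹ * 6 * Real.exp (-(H * u) ^ 2) := by fun_prop
    refine (intervalIntegral.norm_integral_le_of_norm_le (by linarith)
      (Filter.Eventually.of_forall fun u hu => ?_) (hcont.intervalIntegrable _ _)).trans ?_
    · have hz : ‖((T⁻¹ - c : ℝ) : ℂ) + u * Complex.I‖ ≤ 3 * Y := by
        refine (norm_add_le _ _).trans ?_
        rw [norm_mul, Complex.norm_I, mul_one, Complex.norm_real, Complex.norm_real,
          Real.norm_eq_abs, Real.norm_eq_abs]
        have h2 : |u| ≤ Y := abs_le.2 ⟨hu.1.le, hu.2⟩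
        have h3 := abs_sub T⁻¹ c
        rw [abs_of_pos (inv_pos.2 hT), hc] at h3
        linarith [h.inv_T_le, h.L_div_H_le]
      rw [norm_mul, norm_gaussPhase]
      have h4 := norm_arcsinCorrection_le ht0 (by linarith [h.Y_le]) (h.mul_norm_cube_le ht hz)
      have h5 : Real.exp ((H * c) ^ 2 - 2 * (T - t) * c) ≤ T⁻¹ :=
        (Real.exp_le_exp.2 (by rw [hHc]; linarith)).trans h.exp_neg_sq_le
      calc _ ≤ Real.exp (-(H * u) ^ 2) * T⁻¹ * 6 := by gcongr
        _ = _ := by ring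
    · rw [intervalIntegral.integral_const_mul]
      gcongr
      exact intervalIntegral_gauss_le hH hY.le
  have hpi := Real.sqrt_pos.2 Real.pi_pos
  have hI : ‖((H / √Real.pi : ℝ) : ℂ) * ∫ u in (-Y)..Y, gaussPhase H (T - t) (u + c * Complex.I) *
        arcsinCorrection t (((T⁻¹ - c : ℝ) : ℂ) + u * Complex.I)‖ ≤ 6 * L / T := by
    rw [norm_mul, Complex.norm_real, Real.norm_of_nonneg (by positivity)]
    calc _ ≤ H / √Real.pi * (T⁻¹ * 6 * (√Real.pi / H)) := by gcongr
      _ = 6 * 1 / T := by field_simp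
      _ ≤ 6 * L / T := by gcongr
  calc _ ≤ _ := norm_le_norm_sub_add _ _
    _ ≤ 12 * L / T + 6 * L / T := add_le_add key hI
    _ = 18 * L / T := by ring

/-- The bound for the model integral without exploiting any oscillation. -/
theorem norm_exp_mul_modelIntegral_le (h : IsLargeScale H Y L T) {t : ℝ} (ht0 : 0 ≤ t) :
    ‖((Real.exp (-2 * t / T) : ℝ) : ℂ) * modelIntegral H Y T t‖ ≤ 2 * Real.exp (-(t / T)) := by
  have hH := h.H_pos
  have hT := h.T_pos
  have hY := h.Y_pos
  have hpi := Real.sqrt_pos.2 Real.pi_pos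
  have hcont : Continuous fun u : ℝ => 2 * Real.exp (-(t / T)) * Real.exp (-(H * u) ^ 2) := by
    fun_prop
  rw [modelIntegral, mul_left_comm, ← intervalIntegral.integral_const_mul, norm_mul,
    Complex.norm_real, Real.norm_of_nonneg (by positivity)]
  have hbd : ‖∫ u in (-Y)..Y, ((Real.exp (-2 * t / T) : ℝ) : ℂ) * (gaussPhase H (T - t) u *
      arcsinCorrection t (((T⁻¹ : ℝ) : ℂ) + u * Complex.I))‖ ≤
      2 * Real.exp (-(t / T)) * (√Real.pi / H) := by
    refine (intervalIntegral.norm_integral_le_of_norm_le (by linarith)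
      (Filter.Eventually.of_forall fun u hu => ?_) (hcont.intervalIntegrable _ _)).trans ?_
    · have hz : ‖linePoint T u‖ < 1 / 2 :=
        (norm_linePoint_le hT (abs_le.2 ⟨hu.1.le, hu.2⟩)).trans_lt
          (by linarith [h.inv_T_le, h.Y_le])
      have hre := re_cArcsin_ge hz (by rw [linePoint_re]; positivity)
      rw [linePoint_re] at hre
      have e1 := gaussPhase_mul_arcsinCorrection H t u hT.ne'
      rw [show ((T⁻¹ : ℝ) : ℂ) + u * Complex.I = linePoint T u from rfl, e1, norm_mul, norm_mul,
        norm_mul, Complex.norm_real, Real.norm_of_nonneg (Real.exp_pos _).le,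
        show 2 * Complex.I * (T : ℂ) * u = ((2 * T * u : ℝ) : ℂ) * Complex.I by push_cast; ring,
        Complex.norm_exp_ofReal_mul_I, mul_one, Complex.norm_exp]
      have e2 : (-(2 * t * cArcsin (linePoint T u))).re ≤ -(t / T) := by
        rw [Complex.neg_re, show 2 * (t : ℂ) = ((2 * t : ℝ) : ℂ) by push_cast; ring,
          Complex.re_ofReal_mul]
        refine neg_le_neg ?_
        calc t / T = 2 * t * (T⁻¹ / 2) := by field_simp
          _ ≤ _ := by gcongr
      calc _ ≤ Real.exp (-(H * u) ^ 2) * (Real.exp (-(t / T)) * 2) := by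
            gcongr
            exact norm_sqrtOneSubSq_rpow_le hz
        _ = _ := by ring
    · rw [intervalIntegral.integral_const_mul]
      gcongr
      exact intervalIntegral_gauss_le hH hY.le
  calc _ ≤ H / √Real.pi * (2 * Real.exp (-(t / T)) * (√Real.pi / H)) := by gcongr
    _ = _ := by field_simp

end IsLargeScale

open Classical in
/-- The ratio between the model integral and the Gaussian at the saddle point: the Gaussian average
of the arcsine correction on the shifted contour for `|T - t| ≤ H L`. It is set to `1` outside this
range, where the Gaussian is negligible. -/
noncomputable def saddleCoeff (H Y L T t : ℝ) : ℂ :=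
  if |T - t| ≤ H * L then gaussAverage H Y (fun u => arcsinCorrection t
    (((T⁻¹ - (T - t) / H ^ 2 : ℝ) : ℂ) + u * Complex.I)) else 1

namespace IsLargeScale

variable {H Y L T : ℝ}

/-- The arcsine correction is `1 + O(t ‖z‖ ^ 3 + ‖z‖ ^ 2)` and `‖z‖` has order `L / H` in the bulk
of the Gaussian. -/
theorem norm_saddleCoeff_sub_one_le (h : IsLargeScale H Y L T) {t : ℝ} (ht0 : 0 ≤ t) :
    ‖saddleCoeff H Y L T t - 1‖ ≤ 552960 * (L ^ 3 * (T / H ^ 3)) := by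
  have hH := h.H_pos
  have hT := h.T_pos
  have hL := h.one_le_L
  have hY := h.Y_pos
  rw [saddleCoeff]
  split_ifs with hD
  swap
  · rw [sub_self, norm_zero]
    positivity
  have ht2 : t ≤ 2 * T := by linarith [(abs_le.1 hD).1, h.H_mul_L_le]
  have ht' : t ≤ 2 * T * L ^ 2 := ht2.trans (le_mul_of_one_le_right (by positivity)
    (one_le_pow₀ hL))
  have hc : |(T - t) / H ^ 2| ≤ L / H := by
    rw [abs_div, abs_of_pos (by positivity : 0 < H ^ 2)]
    calc _ ≤ H * L / H ^ 2 := by gcongr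
      _ = L / H := by field_simp
  have hTH : T⁻¹ ≤ L / H := by
    rw [inv_eq_one_div, div_le_div_iff₀ hT hH]
    nlinarith [h.two_mul_H_le]
  have hz : ∀ u : ℝ, ‖((T⁻¹ - (T - t) / H ^ 2 : ℝ) : ℂ) + u * Complex.I‖ ≤
      T⁻¹ + L / H + |u| := by
    intro u
    refine (norm_add_le _ _).trans ?_
    rw [norm_mul, Complex.norm_I, mul_one, Complex.norm_real, Complex.norm_real,
      Real.norm_eq_abs, Real.norm_eq_abs]
    have h3 := abs_sub T⁻¹ ((T - t) / H ^ 2)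
    rw [abs_of_pos (inv_pos.2 hT)] at h3
    linarith
  have hz3 : ∀ u : ℝ, |u| ≤ Y →
      ‖((T⁻¹ - (T - t) / H ^ 2 : ℝ) : ℂ) + u * Complex.I‖ ≤ 3 * Y := fun u hu => by
    linarith [hz u, h.inv_T_le, h.L_div_H_le]
  have hzH : ∀ u : ℝ, ‖((T⁻¹ - (T - t) / H ^ 2 : ℝ) : ℂ) + u * Complex.I‖ ≤
      2 * L / H * (1 + |H * u|) := by
    intro u
    refine (hz u).trans ?_
    rw [abs_mul, abs_of_pos hH]
    have : |u| ≤ 2 * L / H * (H * |u|) := by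
      rw [show 2 * L / H * (H * |u|) = 2 * L * |u| by field_simp]
      exact le_mul_of_one_le_left (abs_nonneg _) (by linarith)
    linarith [show 2 * L / H = L / H + L / H by ring]
  have hq : ‖gaussAverage H Y (fun u => arcsinCorrection t
      (((T⁻¹ - (T - t) / H ^ 2 : ℝ) : ℂ) + u * Complex.I)) - 1‖ ≤
      1728 * 2 * (160 * (L ^ 3 * (T / H ^ 3))) := by
    refine norm_gaussAverage_sub_one_le hH hY.le ?_ ?_ ?_
    · intro u hu
      have := hz3 u (abs_le.2 hu)
      have hd := (differentiableAt_arcsinCorrection t (z := ((T⁻¹ - (T - t) / H ^ 2 : ℝ) : ℂ) +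
        u * Complex.I) (by linarith [h.Y_le])).continuousAt
      exact (ContinuousAt.comp (f := fun u : ℝ => ((T⁻¹ - (T - t) / H ^ 2 : ℝ) : ℂ) +
        u * Complex.I) hd (by fun_prop)).continuousWithinAt
    · intro u hu
      have hu3 := hz3 u hu
      refine (norm_arcsinCorrection_sub_one_le ht0 (by linarith [h.Y_le])
        (h.mul_norm_cube_le ht' hu3)).trans ?_
      set v := 1 + |H * u| with hv
      have hv1 : 1 ≤ v := by linarith [abs_nonneg (H * u)]
      have hT3 : (1 : ℝ) / H ^ 2 ≤ T / H ^ 3 := by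
        rw [div_le_div_iff₀ (by positivity) (by positivity)]
        nlinarith [h.two_mul_H_le, pow_pos hH 2]
      calc _ ≤ 8 * ((2 * T) * (2 * L / H * v) ^ 3 + (2 * L / H * v) ^ 2) := by
            have := hzH u
            gcongr
        _ = 128 * (L ^ 3 * (T / H ^ 3)) * v ^ 3 + 32 * (L ^ 2 * (1 / H ^ 2)) * v ^ 2 := by
            field_simp
            ring
        _ ≤ 128 * (L ^ 3 * (T / H ^ 3)) * v ^ 6 + 32 * (L ^ 3 * (T / H ^ 3)) * v ^ 6 := by
            gcongr <;> first | exact hv1 | exact hL | norm_num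
        _ = _ := by ring
    · intro u hu
      have h1 : (H * Y) ^ 6 ≤ (1 + |H * u|) ^ 6 := by
        rw [abs_mul, abs_of_pos hH]
        have : H * Y ≤ H * |u| := by gcongr
        exact pow_le_pow_left₀ (by positivity) (by linarith) 6
      calc 1 ≤ 1 * (T / H ^ 3 * (H * Y) ^ 6) := by rw [one_mul]; exact h.tail_le
        _ ≤ (160 * L ^ 3) * (T / H ^ 3 * (1 + |H * u|) ^ 6) := by
            gcongr
            nlinarith [one_le_pow₀ hL (n := 3)]
        _ = _ := by ring
  linarith

/-- The model integral agrees with the Gaussian at the saddle point, up to `L / T`. -/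
theorem norm_exp_mul_modelIntegral_sub_le (h : IsLargeScale H Y L T) {t : ℝ} (ht0 : 0 ≤ t) :
    ‖((Real.exp (-2 * t / T) : ℝ) : ℂ) * modelIntegral H Y T t -
      ((Real.exp (-2 * t / T) * Real.exp (-((t - T) / H) ^ 2) : ℝ) : ℂ) *
        saddleCoeff H Y L T t‖ ≤ 19 * L / T * Real.exp (-(t / T / 2)) := by
  have hH := h.H_pos
  have hT := h.T_pos
  have hL := h.one_le_L
  have hx : 0 ≤ t / T := by positivity
  have hsq : Real.exp (-((t - T) / H) ^ 2) = Real.exp (-((T - t) / H) ^ 2) := by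
    congr 1
    ring
  have he : Real.exp (-2 * t / T) ≤ Real.exp (-(t / T / 2)) := by
    refine Real.exp_le_exp.2 ?_
    rw [show -2 * t / T = -2 * (t / T) by ring]
    linarith
  rcases le_or_gt |T - t| (H * L) with hD | hD
  · rw [saddleCoeff, if_pos hD, hsq, Complex.ofReal_mul, mul_assoc, ← mul_sub, norm_mul,
      Complex.norm_real, Real.norm_of_nonneg (Real.exp_pos _).le]
    calc _ ≤ Real.exp (-(t / T / 2)) * (19 * L / T) := by
          refine mul_le_mul he ((h.norm_modelIntegral_sub_near_le ht0 hD).trans ?_) (norm_nonneg _)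
            (Real.exp_pos _).le
          gcongr
          norm_num
      _ = _ := mul_comm _ _
  rw [saddleCoeff, if_neg (not_le.2 hD), mul_one, hsq]
  have hg : Real.exp (-((T - t) / H) ^ 2) ≤ L / T := by
    have h1 : Real.exp (-((T - t) / H) ^ 2) ≤ Real.exp (-L ^ 2) := by
      refine Real.exp_le_exp.2 (neg_le_neg ?_)
      rw [← sq_abs ((T - t) / H)]
      refine pow_le_pow_left₀ (by linarith) ?_ 2
      rw [abs_div, abs_of_pos hH, le_div_iff₀ hH, mul_comm]
      exact hD.le
    calc _ ≤ T⁻¹ := h1.trans h.exp_neg_sq_le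
      _ = 1 / T := inv_eq_one_div T
      _ ≤ L / T := by gcongr
  rcases le_or_gt t (2 * T * L ^ 2) with ht | ht
  · rw [Complex.ofReal_mul, ← mul_sub, norm_mul, Complex.norm_real,
      Real.norm_of_nonneg (Real.exp_pos _).le]
    calc _ ≤ Real.exp (-(t / T / 2)) * (19 * L / T) := by
          refine mul_le_mul he ((norm_sub_le _ _).trans ?_) (norm_nonneg _) (Real.exp_pos _).le
          rw [Complex.norm_real, Real.norm_of_nonneg (Real.exp_pos _).le]
          calc _ ≤ 18 * L / T + L / T :=
                add_le_add (h.norm_modelIntegral_le_of_le_abs ht0 ht hD.le) hg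
            _ = _ := by ring
      _ = _ := mul_comm _ _
  · -- Here `t / T / 2 > L²`, so that half of the decay in `t / T` already yields `1 / T`.
    have h3 : Real.exp (-(t / T / 2)) ≤ L / T := by
      have h4 : L ^ 2 ≤ t / T / 2 := by
        rw [le_div_iff₀ two_pos, le_div_iff₀ hT]
        linarith
      calc _ ≤ T⁻¹ := (Real.exp_le_exp.2 (neg_le_neg h4)).trans h.exp_neg_sq_le
        _ = 1 / T := inv_eq_one_div T
        _ ≤ L / T := by gcongr
    have h5 : Real.exp (-(t / T)) = Real.exp (-(t / T / 2)) * Real.exp (-(t / T / 2)) := by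
      rw [← Real.exp_add]
      congr 1
      ring
    refine (norm_sub_le _ _).trans ?_
    rw [Complex.norm_real, Real.norm_of_nonneg (by positivity)]
    calc _ ≤ 2 * (Real.exp (-(t / T / 2)) * (L / T)) + Real.exp (-(t / T / 2)) * (L / T) := by
          refine add_le_add ((h.norm_exp_mul_modelIntegral_le ht0).trans ?_) ?_
          · rw [h5]
            gcongr
          · gcongr
      _ = 3 * L / T * Real.exp (-(t / T / 2)) := by ring
      _ ≤ _ := by gcongr; norm_num

end IsLargeScale

/-! ### Error terms and the final estimate -/

/-- The asymptotics of the averaged block in one inequality, valid for all `t > 1`. -/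
theorem exists_abs_re_averagedBlockW_sub_le {k : ℕ} (hk : 1 ≤ k) : ∃ C > 0, ∀ ε T t L : ℝ,
    IsLargeScale (windowH ε T) (T ^ ε / windowH ε T) L T → 1 < t →
    |(averagedBlockW k ε T (1 / 2 + t * Complex.I)).re -
      (saddleCoeff (windowH ε T) (T ^ ε / windowH ε T) L T t).re * mainTermW k ε T t| ≤
      C * L * (windowH ε T / T) * ((1 + t / T) ^ (4 * k) * Real.exp (-(t / T / 2))) := by
  obtain ⟨C, hC, hmain⟩ := exists_norm_averagedBlockW_sub_le k
  refine ⟨C + 19, by positivity, fun ε T t L h ht => ?_⟩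
  set H := windowH ε T with hHdef
  set Y := T ^ ε / H with hYdef
  have hH := h.H_pos
  have hT := h.T_pos
  have hL := h.one_le_L
  have ht0 : 0 < t := by linarith
  have hx : 0 < t / T := by positivity
  have hk' : (1 : ℝ) ≤ k := by exact_mod_cast hk
  have hpow : ∀ a : ℝ, 0 ≤ a → a ≤ 4 * k → (t / T) ^ a ≤ (1 + t / T) ^ (4 * k) := by
    intro a ha ha'
    calc (t / T) ^ a ≤ (1 + t / T) ^ a := Real.rpow_le_rpow hx.le (by linarith) ha
      _ ≤ (1 + t / T) ^ (4 * (k : ℝ)) := Real.rpow_le_rpow_of_exponent_le (by linarith) ha'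
      _ = _ := by
          rw [show 4 * (k : ℝ) = ((4 * k : ℕ) : ℝ) by push_cast; ring, Real.rpow_natCast]
  have h1 := hmain ε T t hT ht hH (by linarith [h.inv_T_le, h.Y_le])
  have h2 := h.norm_exp_mul_modelIntegral_sub_le ht0.le
  set P := 1 / 2 * (t / T) ^ (4 * (k : ℝ) - 5 / 2) with hP
  set x := t / T with hxdef
  have hP0 : 0 ≤ P := by positivity
  have hP1 : P ≤ (1 + x) ^ (4 * k) := by
    have := hpow (4 * k - 5 / 2) (by linarith) (by linarith)
    have : 0 ≤ x ^ (4 * (k : ℝ) - 5 / 2) := by positivity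
    linarith
  set W := averagedBlockW k ε T (1 / 2 + t * Complex.I) with hW
  set g := saddleCoeff H Y L T t with hg
  have hsplit : W - g * (mainTermW k ε T t : ℝ) =
      (W - ((P * Real.exp (-2 * t / T) : ℝ) : ℂ) * modelIntegral H Y T t) +
      (P : ℂ) * (((Real.exp (-2 * t / T) : ℝ) : ℂ) * modelIntegral H Y T t -
        ((Real.exp (-2 * t / T) * Real.exp (-((t - T) / H) ^ 2) : ℝ) : ℂ) * g) := by
    rw [mainTermW, ← hHdef, ← hxdef, ← hP]
    push_cast
    ring
  have hre : W.re - g.re * mainTermW k ε T t = (W - g * (mainTermW k ε T t : ℝ)).re := by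
    rw [Complex.sub_re, Complex.re_mul_ofReal]
  have he : Real.exp (-x) ≤ Real.exp (-(x / 2)) := Real.exp_le_exp.2 (by linarith)
  rw [hre]
  refine (Complex.abs_re_le_norm _).trans ?_
  rw [hsplit]
  refine (norm_add_le _ _).trans ?_
  rw [norm_mul (P : ℂ), Complex.norm_real, Real.norm_of_nonneg hP0]
  have hTY : 0 ≤ Real.log (1 + T * Y) := Real.log_nonneg (by
    have := mul_pos hT h.Y_pos
    linarith)
  calc _ ≤ C * (1 + x) ^ (4 * k) * Real.exp (-(x / 2)) * (H / T) * L +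
        (1 + x) ^ (4 * k) * (19 * L / T * Real.exp (-(x / 2))) := by
        refine add_le_add (h1.trans ?_) (mul_le_mul hP1 h2 (norm_nonneg _) (by positivity))
        have := hpow (4 * k - 7 / 2) (by linarith) (by linarith)
        have := h.log_le
        gcongr
    _ ≤ C * (1 + x) ^ (4 * k) * Real.exp (-(x / 2)) * (H / T) * L +
        (1 + x) ^ (4 * k) * (19 * L * (H / T) * Real.exp (-(x / 2))) := by
        have : 19 * L / T ≤ 19 * L * (H / T) := by
          rw [mul_div_assoc']
          exact div_le_div_of_nonneg_right
            (le_mul_of_one_le_right (by positivity) h.one_le_H) hT.le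
        gcongr
    _ = _ := by ring

theorem one_add_pow_mul_exp_le (m : ℕ) {x : ℝ} (hx : 0 ≤ x) :
    (1 + x) ^ m * Real.exp (-(x / 2)) ≤ m.factorial * 2 ^ m * Real.exp (1 / 2) := by
  have h1 := Real.pow_div_factorial_le_exp ((1 + x) / 2) (by positivity) m
  rw [div_le_iff₀ (by positivity), div_pow, div_le_iff₀ (by positivity)] at h1
  calc _ ≤ Real.exp ((1 + x) / 2) * m.factorial * 2 ^ m * Real.exp (-(x / 2)) := by gcongr
    _ = m.factorial * 2 ^ m * (Real.exp ((1 + x) / 2) * Real.exp (-(x / 2))) := by ring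
    _ = _ := by
        rw [← Real.exp_add]
        congr 2
        ring

/-- If `t > T ^ (1 + η)`, then a large power of `t / T` dominates `t ^ n`. -/
theorem pow_le_div_pow_of_rpow_lt {η T t : ℝ} (hη : 0 < η) (hT : 0 < T) (ht : 1 < t)
    (h : T ^ (1 + η) < t) {n M : ℕ} (hM : n * (1 + η) ≤ M * η) : t ^ n ≤ (t / T) ^ M := by
  have ht0 : 0 < t := by linarith
  have h1 : t ^ η ≤ (t / T) ^ (1 + η) := by
    rw [Real.div_rpow ht0.le hT.le, le_div_iff₀ (by positivity), Real.rpow_add ht0, Real.rpow_one,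
      mul_comm]
    gcongr
  refine (Real.rpow_le_rpow_iff (by positivity) (by positivity)
    (by linarith : 0 < 1 + η)).1 ?_
  calc (t ^ n) ^ (1 + η) = t ^ (n * (1 + η)) := by rw [← Real.rpow_natCast, ← Real.rpow_mul ht0.le]
    _ ≤ t ^ (M * η) := Real.rpow_le_rpow_of_exponent_le ht.le hM
    _ = (t ^ η) ^ M := by rw [mul_comm, Real.rpow_mul ht0.le, Real.rpow_natCast]
    _ ≤ ((t / T) ^ (1 + η)) ^ M := by gcongr
    _ = ((t / T) ^ M) ^ (1 + η) := by
        rw [← Real.rpow_natCast, ← Real.rpow_natCast, ← Real.rpow_mul (by positivity),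
          ← Real.rpow_mul (by positivity), mul_comm]

/-- A logarithm is absorbed by `T ^ δ`. The decay in `t / T` makes the remaining factor bounded for
`t ≤ T ^ (1 + η)`, and smaller than any power of `t` beyond that. -/
theorem isAbsoluteErrorW_of_le {ε T₀ C : ℝ} {N : ℕ} {B : ℝ → ℝ → ℝ} (hε : ε < 1 / 3)
    (hT₀ : 1 ≤ T₀) (hC : 0 ≤ C)
    (h : ∀ T, T₀ ≤ T → ∀ t, 1 < t → |B T t| ≤ C * Real.log T * (windowH ε T / T) *
      ((1 + t / T) ^ N * Real.exp (-(t / T / 2)))) : IsAbsoluteErrorW ε T₀ B := by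
  intro δ hδ η hη n
  obtain ⟨M, hM⟩ := exists_nat_ge (n * (1 + η) / η)
  rw [div_le_iff₀ hη] at hM
  set K : ℝ := (N + M).factorial * 2 ^ (N + M) * Real.exp (1 / 2) with hK
  refine ⟨C * δ⁻¹ * K, fun T hT t ht => (h T hT t ht).trans ?_⟩
  have hT1 : 1 ≤ T := hT₀.trans hT
  have hT0 : 0 < T := by linarith
  have ht0 : 0 < t := by linarith
  have hlog : Real.log T ≤ δ⁻¹ * T ^ δ := by
    rw [inv_mul_eq_div]
    exact Real.log_le_rpow_div hT0.le hδ
  have hlog0 : 0 ≤ Real.log T := Real.log_nonneg hT1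
  have hx : 0 < t / T := by positivity
  have hH : 0 < windowH ε T := Real.rpow_pos_of_pos hT0 _
  have hHT : windowH ε T / T ≤ 1 := by
    rw [div_le_one hT0]
    calc windowH ε T ≤ T ^ (1 : ℝ) := Real.rpow_le_rpow_of_exponent_le hT1 (by linarith)
      _ = T := Real.rpow_one T
  have hKb := one_add_pow_mul_exp_le (N + M) hx.le
  rw [← hK] at hKb
  have hpre : C * Real.log T * (windowH ε T / T) ≤ C * (δ⁻¹ * T ^ δ) * (windowH ε T / T) := by
    gcongr
  have hF0 : 0 ≤ (1 + t / T) ^ N * Real.exp (-(t / T / 2)) := by positivity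
  have h1M : 1 ≤ (1 + t / T) ^ M := one_le_pow₀ (by linarith)
  have hFM : (1 + t / T) ^ N * Real.exp (-(t / T / 2)) * (1 + t / T) ^ M ≤ K := by
    rw [pow_add] at hKb
    linarith
  split_ifs with hcase
  · calc _ ≤ C * (δ⁻¹ * T ^ δ) * (windowH ε T / T) * K := by
          gcongr
          exact (le_mul_of_one_le_right hF0 h1M).trans hFM
      _ = C * δ⁻¹ * K * T ^ δ * (windowH ε T / T) := by ring
      _ ≤ _ := by
          gcongr
          exact le_add_of_nonneg_right (by positivity)
  · have hpow := pow_le_div_pow_of_rpow_lt hη hT0 ht (not_le.1 hcase) hM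
    have hpow' : t ^ n ≤ (1 + t / T) ^ M := hpow.trans (by gcongr; linarith)
    have hF : (1 + t / T) ^ N * Real.exp (-(t / T / 2)) ≤ K * (t ^ n)⁻¹ := by
      rw [← div_eq_mul_inv, le_div_iff₀ (by positivity)]
      exact (mul_le_mul_of_nonneg_left hpow' hF0).trans hFM
    calc _ ≤ C * (δ⁻¹ * T ^ δ) * 1 * (K * (t ^ n)⁻¹) := by
          refine mul_le_mul (hpre.trans ?_) hF hF0 (by positivity)
          gcongr
      _ = _ := by ring

theorem isRelativeErrorW_of_le {ε T₀ C : ℝ} {A : ℝ → ℝ → ℝ} (hT₀ : 1 ≤ T₀) (hC : 0 ≤ C)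
    (h : ∀ T, T₀ ≤ T → ∀ t, 1 < t → |A T t| ≤ C * (Real.log T ^ 3 * T ^ (-6 * ε))) :
    IsRelativeErrorW ε T₀ A := by
  intro δ hδ
  refine ⟨C * (δ / 3)⁻¹ ^ 3, fun T hT t ht => (h T hT t ht).trans ?_⟩
  have hT1 : 1 ≤ T := hT₀.trans hT
  have hT0 : 0 < T := by linarith
  have hlog : Real.log T ≤ (δ / 3)⁻¹ * T ^ (δ / 3) := by
    rw [inv_mul_eq_div]
    exact Real.log_le_rpow_div hT0.le (by positivity)
  have hlog0 : 0 ≤ Real.log T := Real.log_nonneg hT1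
  have h3 : (T ^ (δ / 3)) ^ 3 = T ^ δ := by
    rw [← Real.rpow_natCast, ← Real.rpow_mul hT0.le]
    congr 1
    push_cast
    ring
  calc _ ≤ C * (((δ / 3)⁻¹ * T ^ (δ / 3)) ^ 3 * T ^ (-6 * ε)) := by gcongr
    _ = _ := by
        rw [mul_pow, h3]
        ring

theorem eventually_mul_log_pow_le (K : ℝ) (j : ℕ) {a : ℝ} (ha : 0 < a) :
    ∀ᶠ T : ℝ in Filter.atTop, K * Real.log T ^ j ≤ T ^ a := by
  have h := (isLittleO_log_rpow_rpow_atTop (j : ℝ) ha).def (c := (|K| + 1)⁻¹) (by positivity)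
  filter_upwards [h, Filter.eventually_ge_atTop 1] with T hT hT1
  have hlog : 0 ≤ Real.log T := Real.log_nonneg hT1
  rw [Real.rpow_natCast, Real.norm_of_nonneg (by positivity),
    Real.norm_of_nonneg (by positivity), inv_mul_eq_div, le_div_iff₀ (by positivity)] at hT
  calc K * Real.log T ^ j ≤ (|K| + 1) * Real.log T ^ j := by
        gcongr
        linarith [le_abs_self K]
    _ ≤ T ^ a := by linarith

theorem div_windowH_cube {ε T : ℝ} (hT : 0 < T) : T / windowH ε T ^ 3 = T ^ (-6 * ε) := by
  rw [windowH, ← Real.rpow_natCast, ← Real.rpow_mul hT.le]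
  nth_rewrite 1 [← Real.rpow_one T]
  rw [← Real.rpow_sub hT]
  congr 1
  push_cast
  ring

theorem eventually_isLargeScale {ε : ℝ} (hε : 0 < ε) (hε' : ε < 1 / 3) :
    ∀ᶠ T : ℝ in Filter.atTop,
      IsLargeScale (windowH ε T) (T ^ ε / windowH ε T) (Real.log T) T := by
  filter_upwards [Filter.eventually_ge_atTop (Real.exp 1), Filter.eventually_ge_atTop 2,
    eventually_mul_log_pow_le 1 1 hε, eventually_mul_log_pow_le 12 0 (a := 1 / 3 + ε) (by linarith),
    eventually_mul_log_pow_le 2 0 (a := 2 / 3 - 2 * ε) (by linarith),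
    eventually_mul_log_pow_le 1 1 (a := 2 / 3 - 2 * ε) (by linarith),
    eventually_mul_log_pow_le 108 2 (a := 3 * ε) (by linarith)] with T he h2 e1 e2 e3 e4 e5
  have hT : 0 < T := by linarith
  have hT1 : 1 ≤ T := by linarith
  have hL : 1 ≤ Real.log T := (Real.le_log_iff_exp_le hT).2 he
  have hH : 0 < windowH ε T := Real.rpow_pos_of_pos hT _
  have hHY : windowH ε T * (T ^ ε / windowH ε T) = T ^ ε := by field_simp
  have hY : T ^ ε / windowH ε T = T ^ (-(1 / 3 + ε)) := by
    rw [windowH, ← Real.rpow_sub hT]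
    congr 1
    ring
  have hHT : windowH ε T * T ^ (2 / 3 - 2 * ε) = T := by
    rw [windowH, ← Real.rpow_add hT, show 1 / 3 + 2 * ε + (2 / 3 - 2 * ε) = 1 by ring,
      Real.rpow_one]
  have hY3 : 3 * (T ^ ε / windowH ε T) ≤ 1 / 4 := by
    rw [hY, Real.rpow_neg hT.le, ← div_eq_mul_inv, div_le_iff₀ (by positivity)]
    linarith
  exact
  { T_pos := hT
    one_le_H := Real.one_le_rpow hT1 (by linarith)
    one_le_L := hL
    exp_neg_sq_le := by
      rw [← Real.exp_log (inv_pos.2 hT), Real.log_inv]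
      exact Real.exp_le_exp.2 (by nlinarith)
    L_le := by
      rw [hHY]
      linarith
    inv_T_le := by
      rw [hY, ← Real.rpow_neg_one]
      exact Real.rpow_le_rpow_of_exponent_le hT1 (by linarith)
    Y_le := hY3
    two_mul_H_le := by
      rw [pow_zero, mul_one] at e3
      nlinarith
    H_mul_L_le := by
      rw [pow_one, one_mul] at e4
      nlinarith
    cube_le := by
      have : T * (T ^ ε / windowH ε T) ^ 3 = (T ^ (3 * ε))⁻¹ := by
        rw [hY, ← Real.rpow_natCast, ← Real.rpow_mul hT.le, ← Real.rpow_neg hT.le]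
        nth_rewrite 1 [← Real.rpow_one T]
        rw [← Real.rpow_add hT]
        congr 1
        push_cast
        ring
      rw [this, ← div_eq_mul_inv, div_le_iff₀ (by positivity)]
      linarith
    tail_le := by
      rw [div_windowH_cube hT, hHY, ← Real.rpow_natCast, ← Real.rpow_mul hT.le,
        ← Real.rpow_add hT]
      apply le_of_eq
      rw [show -6 * ε + ε * ((6 : ℕ) : ℝ) = 0 by push_cast; ring, Real.rpow_zero]
    log_le := by
      have hYpos : 0 < T ^ ε / windowH ε T := by positivity
      refine Real.log_le_log (by positivity) ?_
      nlinarith }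

/-- The main term is bounded below on the window `|t - T| ≤ H`. -/
theorem exists_le_mainTermW {k : ℕ} (hk : 1 ≤ k) : ∃ m > 0, ∀ ε T t : ℝ, 0 < T →
    0 < windowH ε T → 2 * windowH ε T ≤ T → |t - T| ≤ windowH ε T → m ≤ mainTermW k ε T t := by
  refine ⟨1 / 2 * (1 / 2) ^ (4 * (k : ℝ) - 5 / 2) * Real.exp (-3) * Real.exp (-1), by positivity,
    fun ε T t hT hH hHT ht => ?_⟩
  have hk' : (1 : ℝ) ≤ k := by exact_mod_cast hk
  obtain ⟨h1, h2⟩ := abs_le.1 ht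
  have hx1 : 1 / 2 ≤ t / T := by
    rw [le_div_iff₀ hT]
    linarith
  have hx2 : t / T ≤ 3 / 2 := by
    rw [div_le_iff₀ hT]
    linarith
  have hg : ((t - T) / windowH ε T) ^ 2 ≤ 1 := by
    rw [sq_le_one_iff_abs_le_one, abs_div, abs_of_pos hH]
    exact (div_le_one hH).2 ht
  rw [mainTermW]
  have e1 : (1 / 2 : ℝ) ^ (4 * (k : ℝ) - 5 / 2) ≤ (t / T) ^ (4 * (k : ℝ) - 5 / 2) :=
    Real.rpow_le_rpow (by norm_num) hx1 (by linarith)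
  have e2 : Real.exp (-3) ≤ Real.exp (-2 * t / T) := Real.exp_le_exp.2 (by
    rw [mul_div_assoc]
    linarith)
  have e3 : Real.exp (-1) ≤ Real.exp (-((t - T) / windowH ε T) ^ 2) :=
    Real.exp_le_exp.2 (neg_le_neg hg)
  gcongr

theorem mainTheorem6 (k : ℕ) (hk : 1 ≤ k) (ε : ℝ) (hε : 0 < ε) (hε' : ε < 1 / 3) :
    ∃ T₀ : ℝ, 1 ≤ T₀ ∧
      (∃ A B : ℝ → ℝ → ℝ, IsRelativeErrorW ε T₀ A ∧ IsAbsoluteErrorW ε T₀ B ∧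
        ∀ T : ℝ, T₀ ≤ T → ∀ t : ℝ, 1 < t →
          averagedBlockW k ε T (1 / 2 + (t : ℂ) * Complex.I) =
            (((1 + A T t) * mainTermW k ε T t + B T t : ℝ) : ℂ)) ∧
      (∃ (C : ℝ) (B : ℝ → ℝ → ℝ), 0 < C ∧ IsAbsoluteErrorW ε T₀ B ∧
        ∀ T : ℝ, T₀ ≤ T → ∀ t : ℝ, 1 < t →
          (if |t - T| ≤ windowH ε T then (1 : ℝ) else 0) ≤
            C * ((averagedBlockW k ε T (1 / 2 + (t : ℂ) * Complex.I)).re + B T t)) := by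
  -- The second condition is `|A| ≤ 1/2`, as `1105920 = 2 * 552960`.
  obtain ⟨T₁, hT₁⟩ := Filter.eventually_atTop.1 ((eventually_isLargeScale hε hε').and
    (eventually_mul_log_pow_le 1105920 3 (a := 6 * ε) (by linarith)))
  obtain ⟨C, hC, hB⟩ := exists_abs_re_averagedBlockW_sub_le hk
  obtain ⟨m, hm, hmain⟩ := exists_le_mainTermW hk
  set A : ℝ → ℝ → ℝ := fun T t =>
    (saddleCoeff (windowH ε T) (T ^ ε / windowH ε T) (Real.log T) T t).re - 1 with hA
  set B : ℝ → ℝ → ℝ := fun T t =>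
    (averagedBlockW k ε T (1 / 2 + t * Complex.I)).re - (1 + A T t) * mainTermW k ε T t with hBdef
  have hscale : ∀ T, max 1 T₁ ≤ T → IsLargeScale (windowH ε T) (T ^ ε / windowH ε T)
      (Real.log T) T := fun T hT => (hT₁ T ((le_max_right _ _).trans hT)).1
  have hAle : ∀ T, max 1 T₁ ≤ T → ∀ t, 1 < t →
      |A T t| ≤ 552960 * (Real.log T ^ 3 * T ^ (-6 * ε)) := by
    intro T hT t ht
    have h := hscale T hT
    rw [← div_windowH_cube h.T_pos]
    refine le_trans ?_ (h.norm_saddleCoeff_sub_one_le (t := t) (by linarith))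
    simpa [hA] using Complex.abs_re_le_norm
      (saddleCoeff (windowH ε T) (T ^ ε / windowH ε T) (Real.log T) T t - 1)
  have hAhalf : ∀ T, max 1 T₁ ≤ T → ∀ t, 1 < t → 1 / 2 ≤ 1 + A T t := by
    intro T hT t ht
    have h1 := hAle T hT t ht
    have h2 := (hT₁ T ((le_max_right _ _).trans hT)).2
    have hT0 := (hscale T hT).T_pos
    have h3 : 552960 * (Real.log T ^ 3 * T ^ (-6 * ε)) ≤ 1 / 2 := by
      rw [neg_mul, Real.rpow_neg hT0.le, ← mul_assoc, ← div_eq_mul_inv,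
        div_le_iff₀ (by positivity)]
      linarith
    linarith [(abs_le.1 (h1.trans h3)).1]
  have hBerr : IsAbsoluteErrorW ε (max 1 T₁) B := by
    refine isAbsoluteErrorW_of_le (N := 4 * k) hε' (le_max_left _ _) hC.le fun T hT t ht => ?_
    have := hB ε T t (Real.log T) (hscale T hT) ht
    simpa only [hBdef, hA, add_sub_cancel] using this
  refine ⟨max 1 T₁, le_max_left _ _, ⟨A, B, ?_, hBerr, ?_⟩, 2 / m, fun T t => -B T t, by positivity,
    ?_, ?_⟩
  · exact isRelativeErrorW_of_le (le_max_left _ _) (by norm_num) hAle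
  · intro T hT t ht
    have h := hscale T hT
    have him := averagedBlockW_im (k := k) h.T_pos ht h.Y_pos.le (by linarith [h.inv_T_le, h.Y_le])
    refine Complex.ext ?_ ?_
    · rw [Complex.ofReal_re]
      simp only [hBdef]
      ring
    · rw [Complex.ofReal_im, him]
  · intro δ hδ η hη n
    simpa only [abs_neg] using hBerr δ hδ η hη n
  · intro T hT t ht
    have h := hscale T hT
    have hval : (averagedBlockW k ε T (1 / 2 + t * Complex.I)).re + -B T t =
        (1 + A T t) * mainTermW k ε T t := by
      simp only [hBdef]
      ring
    have hA1 := hAhalf T hT t ht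
    rw [hval]
    split_ifs with hcase
    · -- The main term is at least `m` and `1 + A` at least `1/2`.
      have h1 := hmain ε T t h.T_pos h.H_pos h.two_mul_H_le hcase
      calc (1 : ℝ) = 2 / m * (1 / 2 * m) := by field_simp
        _ ≤ _ := by gcongr
    · have hT0 := h.T_pos
      have : 0 ≤ mainTermW k ε T t := by
        rw [mainTermW]
        positivity
      exact mul_nonneg (by positivity) (mul_nonneg (by linarith) this)
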